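/- All algebras are associative over $\mathbb{C}$, possibly without unit. An algebra $A$ is non-degenerate if $aA=0$ or $Aa=0$ forces $a=0$, and idempotent if $A^2=A$ (products of subspaces denote linear spans). $M(A)$ is the multiplier algebra, i.e. the algebra of pairs $(l,r)$ of linear maps with $l(ab)=l(a)b$, $r(ab)=a\,r(b)$, $r(a)b=a\,l(b)$. A \emph{weak multiplier Hopf algebra} is a non-degenerate idempotent algebra $A$ with a homomorphism $\Delta:A\to M(A\otimes A)$ such that (a) $T_1(a\otimes b)=\Delta(a)(1\otimes b)$ and $T_2(a\otimes b)=(a\otimes 1)\Delta(b)$ lie in $A\otimes A$, and $\Delta$ is coassociative: $(c\otimes1\otimes1)(\Delta\otimes\iota)(\Delta(a)(1\otimes b))=(\iota\otimes\Delta)((c\otimes1)\Delta(a))(1\otimes1\otimes b)$; (b) $\Delta$ is full: $\Delta(A)(1\otimes A)\subseteq V\otimes A$ implies $V=A$, and $(A\otimes 1)\Delta(A)\subseteq A\otimes W$ implies $W=A$; (c) there is a counit: a linear $\varepsilon:A\to\mathbb{C}$ with $(\varepsilon\otimes\iota)T_1(a\otimes b)=ab=(\iota\otimes\varepsilon)T_2(a\otimes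 b)$; (d) there is an idempotent $E\in M(A\otimes A)$ with $T_1(A\otimes A)=E(A\otimes A)$, $T_2(A\otimes A)=(A\otimes A)E$ and $(\iota\otimes\Delta)E=(E\otimes1)(1\otimes E)=(1\otimes E)(E\otimes1)$, where $\iota\otimes\Delta$ is extended to $M(A\otimes A)$ with $(\iota\otimes\Delta)(1)=1\otimes E$; (e) $\ker T_i=(1-G_i)(A\otimes A)$ for $i=1,2$, where the linear maps $G_i$ on $A\otimes A$ are given by $(G_1\otimes\iota)(\Delta_{13}(a)(1\otimes b\otimes c))=\Delta_{13}(a)(1\otimes E)(1\otimes b\otimes c)$ and $(\iota\otimes G_2)((a\otimes b\otimes1)\Delta_{13}(c))=(a\otimes b\otimes1)(E\otimes1)\Delta_{13}(c)$. It is \emph{regular} if also $\Delta(a)(b\otimes1),(1\otimes a)\Delta(b)\in A\otimes A$ for all $a,b\in A$ and $A$ with the flipped coproduct is a weak multiplier Hopf algebra. Its antipode is the linear map $S:A\to A$ with $S(a)b=(\varepsilon\otimes\iota)R_1(a\otimes b)$ and $bS(a)=(\iota\otimes\varepsilon)R_2(b\otimes a)$, where $R_i$ is the generalized inverse of $T_i$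 (that is, $R_iT_iR_i=R_i$) such that $R_iT_i=G_i$, $T_1R_1$ is left multiplication by $E$, and $T_2R_2$ is right multiplication by $E$. The source map $\varepsilon_s:A\to M(A)$ is $\varepsilon_s(a)=\sum S(a_{(1)})a_{(2)}$, i.e. $\varepsilon_s(a)b=\sum S(a_{(1)})a_{(2)}b$. \textbf{Proposition.} Let $A$ be a regular weak multiplier Hopf algebra. Then $S$ and $\varepsilon_s$ are well defined. Write $E=E_{(1)}\otimes E_{(2)}$, put $\alpha_a(x)=\sum a_{(1)}xS(a_{(2)})$ for $a,x\in A$ (the image of $\Delta(a)(x\otimes 1)\in A\otimes A$ under $p\otimes q\mapsto pS(q)$), and let $$A_0=\mathrm{span}\{E_{(1)}p\,S(E_{(2)}q)\mid p,q\in A\}.$$ For every $a\in A$ the expression $E_{(1)}aS(E_{(2)})$ defines an element of $A$: for every $q\in A$ the multiplier $(1\otimes q)E(a\otimes1)$ lies in $A\otimes A$, and $E_{(1)}aS(E_{(2)})$ is the element $z$ with $zS(q)=E_{(1)}aS(qE_{(2)})$ for all $q$; it depends linearly on $a$. Moreover: (1) $A_0=\{E_{(1)}aS(E_{(2)})\mid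 a\in A\}=\mathrm{span}\{\alpha_a(x)\mid a,x\in A\}$. (2) $A_0$ is a subalgebra of $A$, its product is non-degenerate, and $A_0A=AA_0=A$. (3) $A_0=\{a\in A\mid ay=ya\ \text{for all } y\in\varepsilon_s(A)\}$. (4) $M(A_0)=\{m\in M(A)\mid my=ym\ \text{for all } y\in\varepsilon_s(A)\}$; that is, there is an injective unital algebra homomorphism $j:M(A_0)\to M(A)$ with $j(n)x=nx$ and $x\,j(n)=xn$ for all $n\in M(A_0)$, $x\in A_0$, and its image is the commutant of $\varepsilon_s(A)$ in $M(A)$. (5) $A_0$ is a left $A$-module algebra under $a\rhd x=\alpha_a(x)$: $\alpha_a$ maps $A_0$ into itself for every $a\in A$, $A_0$ is a non-degenerate idempotent algebra, $(ab)\rhd x=a\rhd(b\rhd x)$, $A\rhd A_0=A_0$, and $a\rhd(xy)=\sum(a_{(1)}\rhd x)(a_{(2)}\rhd y)$ for all $a,b\in A$, $x,y\in A_0$, where the last sum is the product map applied to $\Delta(a)\rhd(x\otimes y)$, with $\Delta(a)\rhd(c\rhd x'\otimes b\rhd y')=(\Delta(a)(c\otimes b))\rhd(x'\otimes y')$ for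 all $b,c\in A$, $x',y'\in A_0$. -/

import Mathlib

open scoped TensorProduct

noncomputable section

namespace WMHA

section Multipliers

variable (A : Type*) [NonUnitalRing A] [Module ℂ A] [IsScalarTower ℂ A A] [SMulCommClass ℂ A A]

/-- The product of `A` is non-degenerate. -/
def IsNondegenerate : Prop :=
  (∀ a : A, (∀ b, a * b = 0) → a = 0) ∧ (∀ a : A, (∀ b, b * a = 0) → a = 0)

/-- `A` is idempotent: `A` is the linear span of the products `a * b`. -/
def IsIdempotentAlgebra : Prop := LinearMap.range (LinearMap.mul' ℂ A) = ⊤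

/-- The multiplier algebra `M(A)`: pairs `(l, r)` of a left and a right multiplier with
`r(a) b = a l(b)`. Right multipliers compose in the opposite order. -/
def multiplierSubalgebra : Subalgebra ℂ (Module.End ℂ A × (Module.End ℂ A)ᵐᵒᵖ) where
  carrier := {p | (∀ a b, p.1 (a * b) = p.1 a * b) ∧
    (∀ a b, p.2.unop (a * b) = a * p.2.unop b) ∧ ∀ a b, p.2.unop a * b = a * p.1 b}
  mul_mem' := by
    rintro p q ⟨h1, h2, h3⟩ ⟨k1, k2, k3⟩
    refine ⟨?_, ?_, ?_⟩ <;> intro a b <;>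
      simp [Module.End.mul_apply, h1, h2, h3, k1, k2, k3]
  add_mem' := by
    rintro p q ⟨h1, h2, h3⟩ ⟨k1, k2, k3⟩
    refine ⟨?_, ?_, ?_⟩ <;> intro a b <;>
      simp [h1, h2, h3, k1, k2, k3, add_mul, mul_add]
  algebraMap_mem' := by
    intro c
    refine ⟨?_, ?_, ?_⟩ <;> intro a b <;>
      simp [Module.algebraMap_end_apply, smul_mul_assoc, mul_smul_comm]

/-- `M(A)`, as a unital algebra. -/
abbrev Multiplier : Type _ := ↥(multiplierSubalgebra A)

end Multipliers

namespace Multiplier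

variable {A : Type*} [NonUnitalRing A] [Module ℂ A] [IsScalarTower ℂ A A] [SMulCommClass ℂ A A]
variable {B : Type*} [NonUnitalRing B] [Module ℂ B] [IsScalarTower ℂ B B] [SMulCommClass ℂ B B]

/-- `m.left a = m a`. -/
def left (m : Multiplier A) : A →ₗ[ℂ] A := m.1.1

/-- `m.right a = a m`. -/
def right (m : Multiplier A) : A →ₗ[ℂ] A := m.1.2.unop

/-- The canonical map `A → M(A)`. -/
def of : A →ₗ[ℂ] Multiplier A where
  toFun a := ⟨(LinearMap.mulLeft ℂ a, MulOpposite.op (LinearMap.mulRight ℂ a)), by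
    refine ⟨?_, ?_, ?_⟩ <;> intro x y <;> simp [mul_assoc]⟩
  map_add' a b := by
    apply Subtype.ext
    apply Prod.ext
    · ext x; simp [add_mul]
    · apply MulOpposite.unop_injective; ext x; simp [mul_add]
  map_smul' c a := by
    apply Subtype.ext
    apply Prod.ext
    · ext x; simp [smul_mul_assoc]
    · apply MulOpposite.unop_injective; ext x; simp [mul_smul_comm]

/-- Transport of multipliers along an isomorphism of algebras. -/
def congr (e : A ≃ₗ[ℂ] B) (he : ∀ x y, e (x * y) = e x * e y) (m : Multiplier A) :
    Multiplier B :=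
  ⟨(e.toLinearMap ∘ₗ m.left ∘ₗ e.symm.toLinearMap,
    MulOpposite.op (e.toLinearMap ∘ₗ m.right ∘ₗ e.symm.toLinearMap)), by
    have hs : ∀ x y, e.symm (x * y) = e.symm x * e.symm y := fun x y => by
      apply e.injective; simp [he]
    obtain ⟨m, h1, h2, h3⟩ := m
    refine ⟨?_, ?_, ?_⟩
    · intro x y; simp [left, hs, h1, he]
    · intro x y; simp [right, hs, h2, he]
    · intro x y
      have := congrArg e (h3 (e.symm x) (e.symm y))
      simpa [left, right, he] using this⟩

/-- The canonical map `M(A) × M(B) → M(A ⊗ B)`, `(m, n) ↦ m ⊗ n`. -/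
def tmulFun (m : Multiplier A) (n : Multiplier B) : Multiplier (A ⊗[ℂ] B) :=
  ⟨(TensorProduct.map m.left n.left, MulOpposite.op (TensorProduct.map m.right n.right)), by
    obtain ⟨m, h1, h2, h3⟩ := m
    obtain ⟨n, k1, k2, k3⟩ := n
    refine ⟨?_, ?_, ?_⟩ <;> intro x y
    · induction x with
      | zero => simp
      | add x x' hx hx' => simp only [add_mul, map_add, hx, hx']
      | tmul a b =>
        induction y with
        | zero => simp
        | add y y' hy hy' => simp only [mul_add, map_add, hy, hy']
        | tmul c d => simp [left, h1, k1]
    · induction x with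
      | zero => simp
      | add x x' hx hx' => simp only [add_mul, map_add, hx, hx']
      | tmul a b =>
        induction y with
        | zero => simp
        | add y y' hy hy' => simp only [mul_add, map_add, hy, hy']
        | tmul c d => simp [right, h2, k2]
    · induction x with
      | zero => simp
      | add x x' hx hx' => simp only [add_mul, map_add, hx, hx']
      | tmul a b =>
        induction y with
        | zero => simp
        | add y y' hy hy' => simp only [mul_add, map_add, hy, hy']
        | tmul c d => simp [left, right, h3, k3]⟩

/-- `tmulFun` as a bilinear map. -/
def tmul : Multiplier A →ₗ[ℂ] Multiplier B →ₗ[ℂ] Multiplier (A ⊗[ℂ] B) :=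
  LinearMap.mk₂ ℂ tmulFun
    (fun m m' n => by
      apply Subtype.ext
      apply Prod.ext
      · exact TensorProduct.map_add_left m.left m'.left n.left
      · exact congrArg MulOpposite.op (TensorProduct.map_add_left m.right m'.right n.right))
    (fun c m n => by
      apply Subtype.ext
      apply Prod.ext
      · exact TensorProduct.map_smul_left c m.left n.left
      · exact congrArg MulOpposite.op (TensorProduct.map_smul_left c m.right n.right))
    (fun m n n' => by
      apply Subtype.ext
      apply Prod.ext
      · exact TensorProduct.map_add_right m.left n.left n'.left
      · exact congrArg MulOpposite.op (TensorProduct.map_add_right m.right n.right n'.right))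
    (fun c m n => by
      apply Subtype.ext
      apply Prod.ext
      · exact TensorProduct.map_smul_right c m.left n.left
      · exact congrArg MulOpposite.op (TensorProduct.map_smul_right c m.right n.right))

/-- The flip `M(A ⊗ A) → M(A ⊗ A)` induced by `a ⊗ b ↦ b ⊗ a`. -/
def flip (m : Multiplier (A ⊗[ℂ] A)) : Multiplier (A ⊗[ℂ] A) :=
  congr (TensorProduct.comm ℂ A A) (fun x y => by
    induction x with
    | zero => simp
    | add x x' hx hx' => simp only [add_mul, map_add, hx, hx']
    | tmul a b =>
      induction y with
      | zero => simp
      | add y y' hy hy' => simp only [mul_add, map_add, hy, hy']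
      | tmul c d => simp) m

/-- The identification `M((A ⊗ A) ⊗ A) → M(A ⊗ (A ⊗ A))`. -/
def assoc (m : Multiplier ((A ⊗[ℂ] A) ⊗[ℂ] A)) : Multiplier (A ⊗[ℂ] (A ⊗[ℂ] A)) :=
  congr (TensorProduct.assoc ℂ A A A) (fun x y => by
    induction x with
    | zero => simp
    | add x x' hx hx' => simp only [add_mul, map_add, hx, hx']
    | tmul u c =>
      induction u with
      | zero => simp
      | add u u' hu hu' => simp only [TensorProduct.add_tmul, add_mul, map_add, hu, hu']
      | tmul a b =>
        induction y with
        | zero => simp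
        | add y y' hy hy' => simp only [mul_add, map_add, hy, hy']
        | tmul v f =>
          induction v with
          | zero => simp
          | add v v' hv hv' => simp only [TensorProduct.add_tmul, mul_add, map_add, hv, hv']
          | tmul d e => simp) m

/-- `X` is the value at `m` of the extension of the homomorphism `γ : B → M(A)` to `M(B)` that
sends `1` to the idempotent `e`, where `γ(B) A = e A` and `A γ(B) = A e`. -/
structure IsExtensionValue (γ : B →ₗ[ℂ] Multiplier A) (e : Multiplier A) (m : Multiplier B)
    (X : Multiplier A) : Prop where
  mul_left : ∀ b, X * γ b = γ (m.left b)
  mul_right : ∀ b, γ b * X = γ (m.right b)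
  mul_idem : X * e = X
  idem_mul : e * X = X

end Multiplier

open Multiplier

/-- A weak multiplier Hopf algebra structure on the algebra `A`. All data are determined by the
coproduct `Δ`. The maps `T₁`, `T₂` record that `Δ(a)(1 ⊗ b)` and `(a ⊗ 1)Δ(b)` lie in `A ⊗ A`. -/
structure WeakMultiplierHopfAlgebra (A : Type*) [NonUnitalRing A] [Module ℂ A]
    [IsScalarTower ℂ A A] [SMulCommClass ℂ A A] where
  nondegenerate : IsNondegenerate A
  idempotent : IsIdempotentAlgebra A
  /-- the coproduct -/
  Δ : A →ₙₐ[ℂ] Multiplier (A ⊗[ℂ] A)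
  /-- `T₁(a ⊗ b) = Δ(a)(1 ⊗ b)` -/
  T₁ : A ⊗[ℂ] A →ₗ[ℂ] A ⊗[ℂ] A
  /-- `T₂(a ⊗ b) = (a ⊗ 1)Δ(b)` -/
  T₂ : A ⊗[ℂ] A →ₗ[ℂ] A ⊗[ℂ] A
  of_T₁ : ∀ a b, of (T₁ (a ⊗ₜ b)) = Δ a * tmul 1 (of b)
  of_T₂ : ∀ a b, of (T₂ (a ⊗ₜ b)) = tmul (of a) 1 * Δ b
  /-- coassociativity:
  `(c ⊗ 1 ⊗ 1)(Δ ⊗ ι)(Δ(a)(1 ⊗ b)) = (ι ⊗ Δ)((c ⊗ 1)Δ(a))(1 ⊗ 1 ⊗ b)` -/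
  coassoc : ∀ a b c : A,
    TensorProduct.assoc ℂ A A A
      (TensorProduct.map T₂ LinearMap.id
        ((TensorProduct.assoc ℂ A A A).symm (c ⊗ₜ T₁ (a ⊗ₜ b)))) =
    TensorProduct.map LinearMap.id T₁
      (TensorProduct.assoc ℂ A A A (T₂ (c ⊗ₜ a) ⊗ₜ b))
  /-- the coproduct is full: a subspace `V` with `Δ(A)(1 ⊗ A) ⊆ V ⊗ A` is all of `A` -/
  full_left : ∀ V : Submodule ℂ A,
    LinearMap.range T₁ ≤ LinearMap.range (TensorProduct.map V.subtype LinearMap.id) → V = ⊤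
  full_right : ∀ W : Submodule ℂ A,
    LinearMap.range T₂ ≤ LinearMap.range (TensorProduct.map LinearMap.id W.subtype) → W = ⊤
  /-- the counit -/
  ε : A →ₗ[ℂ] ℂ
  counit_left : ∀ a b,
    TensorProduct.lid ℂ A (TensorProduct.map ε LinearMap.id (T₁ (a ⊗ₜ b))) = a * b
  counit_right : ∀ a b,
    TensorProduct.rid ℂ A (TensorProduct.map LinearMap.id ε (T₂ (a ⊗ₜ b))) = a * b
  /-- the canonical idempotent -/
  E : Multiplier (A ⊗[ℂ] A)
  E_mul_E : E * E = E
  range_T₁ : LinearMap.range E.left = LinearMap.range T₁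
  range_T₂ : LinearMap.range E.right = LinearMap.range T₂
  /-- `(E ⊗ 1)(1 ⊗ E) = (1 ⊗ E)(E ⊗ 1)` -/
  E_comm : assoc (tmul E 1) * tmul 1 E = tmul 1 E * assoc (tmul E 1)
  /-- `(ι ⊗ Δ)E = (E ⊗ 1)(1 ⊗ E)`, where `ι ⊗ Δ` is extended to `M(A ⊗ A)` with
  `(ι ⊗ Δ)(1) = 1 ⊗ E` -/
  id_Δ_E : IsExtensionValue
    (TensorProduct.lift ((tmul (A := A) (B := A ⊗[ℂ] A)).compl₁₂ of (Δ : A →ₗ[ℂ] _)))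
    (tmul 1 E) E (assoc (tmul E 1) * tmul 1 E)
  G₁ : A ⊗[ℂ] A →ₗ[ℂ] A ⊗[ℂ] A
  G₂ : A ⊗[ℂ] A →ₗ[ℂ] A ⊗[ℂ] A
  /-- `(G₁ ⊗ ι)(Δ₁₃(a)(1 ⊗ u)) = Δ₁₃(a)(1 ⊗ E)(1 ⊗ u)` for `u ∈ A ⊗ A`. Conjugating `ι ⊗ T₁` by
  the exchange of the first two tensor factors gives `a ⊗ u ↦ Δ₁₃(a)(1 ⊗ u)`. -/
  G₁_spec : ∀ (a : A) (u : A ⊗[ℂ] A),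
    TensorProduct.assoc ℂ A A A (TensorProduct.map G₁ LinearMap.id
      ((TensorProduct.assoc ℂ A A A).symm
        (TensorProduct.leftComm ℂ A A A (TensorProduct.map LinearMap.id T₁
          (TensorProduct.leftComm ℂ A A A (a ⊗ₜ u)))))) =
    TensorProduct.leftComm ℂ A A A (TensorProduct.map LinearMap.id T₁
      (TensorProduct.leftComm ℂ A A A (a ⊗ₜ E.left u)))
  /-- `(ι ⊗ G₂)((u ⊗ 1)Δ₁₃(c)) = (u ⊗ 1)(E ⊗ 1)Δ₁₃(c)` for `u ∈ A ⊗ A`. Conjugating `T₂ ⊗ ι` by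
  the exchange of the last two tensor factors gives `u ⊗ c ↦ (u ⊗ 1)Δ₁₃(c)`. -/
  G₂_spec : ∀ (u : A ⊗[ℂ] A) (c : A),
    TensorProduct.map LinearMap.id G₂ (TensorProduct.assoc ℂ A A A
      (TensorProduct.rightComm ℂ A A A (TensorProduct.map T₂ LinearMap.id
        (TensorProduct.rightComm ℂ A A A (u ⊗ₜ c))))) =
    TensorProduct.assoc ℂ A A A
      (TensorProduct.rightComm ℂ A A A (TensorProduct.map T₂ LinearMap.id
        (TensorProduct.rightComm ℂ A A A (E.right u ⊗ₜ c))))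
  ker_T₁ : LinearMap.ker T₁ = LinearMap.range (LinearMap.id - G₁)
  ker_T₂ : LinearMap.ker T₂ = LinearMap.range (LinearMap.id - G₂)

/-- A regular weak multiplier Hopf algebra: `Δ` is regular and the opposite coproduct
`Δ^{cop}` also makes `A` a weak multiplier Hopf algebra. -/
structure RegularWeakMultiplierHopfAlgebra (A : Type*) [NonUnitalRing A] [Module ℂ A]
    [IsScalarTower ℂ A A] [SMulCommClass ℂ A A] extends WeakMultiplierHopfAlgebra A where
  /-- `T₃(a ⊗ b) = (1 ⊗ b)Δ(a)` -/
  T₃ : A ⊗[ℂ] A →ₗ[ℂ] A ⊗[ℂ] A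
  /-- `T₄(a ⊗ b) = Δ(b)(a ⊗ 1)` -/
  T₄ : A ⊗[ℂ] A →ₗ[ℂ] A ⊗[ℂ] A
  of_T₃ : ∀ a b, of (T₃ (a ⊗ₜ b)) = tmul 1 (of b) * Δ a
  of_T₄ : ∀ a b, of (T₄ (a ⊗ₜ b)) = Δ b * tmul (of a) 1
  cop : WeakMultiplierHopfAlgebra A
  cop_Δ : ∀ a, cop.Δ a = flip (Δ a)

/-- `R` is the generalized inverse of `T` with `T R = P` and `R T = Q`. -/
structure IsGeneralizedInverse {V : Type*} [AddCommGroup V] [Module ℂ V]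
    (T P Q R : V →ₗ[ℂ] V) : Prop where
  comp_right : T ∘ₗ R = P
  comp_left : R ∘ₗ T = Q
  reflexive : R ∘ₗ T ∘ₗ R = R

namespace RegularWeakMultiplierHopfAlgebra

variable {A : Type*} [NonUnitalRing A] [Module ℂ A] [IsScalarTower ℂ A A] [SMulCommClass ℂ A A]
variable (H : RegularWeakMultiplierHopfAlgebra A)

/-- `S : A → A` is the antipode: `S(a)b = (ε ⊗ ι)R₁(a ⊗ b)` and `bS(a) = (ι ⊗ ε)R₂(b ⊗ a)`, where
`R₁`, `R₂` are the generalized inverses of `T₁`, `T₂` determined by `E`, `G₁` and `G₂`. -/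
def IsAntipode (S : A →ₗ[ℂ] A) : Prop :=
  ∃ R₁ R₂ : A ⊗[ℂ] A →ₗ[ℂ] A ⊗[ℂ] A,
    IsGeneralizedInverse H.T₁ H.E.left H.G₁ R₁ ∧
    IsGeneralizedInverse H.T₂ H.E.right H.G₂ R₂ ∧
    (∀ a b, S a * b =
      TensorProduct.lid ℂ A (TensorProduct.map H.ε LinearMap.id (R₁ (a ⊗ₜ b)))) ∧
    (∀ a b, b * S a =
      TensorProduct.rid ℂ A (TensorProduct.map LinearMap.id H.ε (R₂ (b ⊗ₜ a))))

open Classical in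
/-- The antipode. -/
def antipode : A →ₗ[ℂ] A := if h : ∃ S, H.IsAntipode S then h.choose else 0

/-- `p ⊗ q ↦ p S(q)`. -/
def mulAntipode : A ⊗[ℂ] A →ₗ[ℂ] A :=
  LinearMap.mul' ℂ A ∘ₗ TensorProduct.map LinearMap.id H.antipode

/-- `f = ε_s : A → M(A)`, `ε_s(a) = ∑ S(a₁) a₂`, that is `ε_s(a) b = ∑ S(a₁) a₂ b`. -/
def IsSourceMap (f : A →ₗ[ℂ] Multiplier A) : Prop :=
  ∀ a b, (f a).left b =
    LinearMap.mul' ℂ A (TensorProduct.map H.antipode LinearMap.id (H.T₁ (a ⊗ₜ b)))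

open Classical in
/-- The source map `ε_s`. -/
def sourceMap : A →ₗ[ℂ] Multiplier A := if h : ∃ f, H.IsSourceMap f then h.choose else 0

/-- `α_a(x) = ∑ a₁ x S(a₂)`, the image of `Δ(a)(x ⊗ 1)` under `p ⊗ q ↦ p S(q)`. -/
def adj (a x : A) : A := H.mulAntipode (H.T₄ (x ⊗ₜ a))

/-- `A₀ = span {E₁ p S(E₂ q) | p, q ∈ A}`. -/
def adjSpace : Submodule ℂ A :=
  Submodule.span ℂ {z | ∃ p q : A, z = H.mulAntipode (H.E.left (p ⊗ₜ q))}

/-- `z = E₁ a S(E₂)`: for all `q`, the element `(1 ⊗ q)E(a ⊗ 1)` lies in `A ⊗ A` and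
`z S(q) = E₁ a S(q E₂)`. -/
def IsSandwich (a z : A) : Prop :=
  ∀ q : A, ∃ t : A ⊗[ℂ] A, of t = tmul 1 (of q) * H.E * tmul (of a) 1 ∧
    z * H.antipode q = H.mulAntipode t

end RegularWeakMultiplierHopfAlgebra

/-- The action of `A ⊗ A` on `R ⊗ R`, `(a ⊗ b)(r ⊗ s) = ar ⊗ bs`. -/
def tensorAction {A R : Type*} [AddCommGroup A] [Module ℂ A] [AddCommGroup R] [Module ℂ R]
    (act : A →ₗ[ℂ] R →ₗ[ℂ] R) : A ⊗[ℂ] A →ₗ[ℂ] R ⊗[ℂ] R →ₗ[ℂ] R ⊗[ℂ] R :=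
  TensorProduct.homTensorHomMap (RingHom.id ℂ) R R R R ∘ₗ TensorProduct.map act act

/-- `R` is a left module algebra over `A` under `act`: a non-degenerate idempotent algebra that is
a unital left `A`-module, with `a(xy) = m(Δ(a)(x ⊗ y))`. The elements of `R` have the form
`∑ c x`, and `Δ(a)(cx ⊗ by) = (Δ(a)(c ⊗ b))(x ⊗ y)` is the action of `Δ(a) ∈ M(A ⊗ A)`. -/
structure IsModuleAlgebra {A R : Type*} [NonUnitalRing A] [Module ℂ A] [IsScalarTower ℂ A A]
    [SMulCommClass ℂ A A] [NonUnitalRing R] [Module ℂ R] [IsScalarTower ℂ R R]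
    [SMulCommClass ℂ R R] (H : WeakMultiplierHopfAlgebra A) (act : A →ₗ[ℂ] R →ₗ[ℂ] R) :
    Prop where
  nondegenerate : IsNondegenerate R
  idempotent : IsIdempotentAlgebra R
  mul_act : ∀ a b r, act (a * b) r = act a (act b r)
  unital : Submodule.map₂ act ⊤ ⊤ = ⊤
  act_mul : ∀ a b c x y, act a (act c x * act b y) =
    LinearMap.mul' ℂ R (tensorAction act ((H.Δ a).left (c ⊗ₜ b)) (x ⊗ₜ y))

end WMHA

end

/-!
Everything is phrased through operators on `A ⊗ A`: the canonical maps `T₁`, …, `T₄`, the maps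
`G₁`, …, `G₄`, and the left and right multiplications by `E` and by `Δ(a)`. Passing to the opposite
algebra or to the flipped coproduct permutes the four canonical maps, so a statement about `T₁`
yields the other three. The axioms on `A ⊗ A ⊗ A` become commutation relations between the legs of
these operators. The map `b ↦ (ε ⊗ ι)R₁(a ⊗ b)` is the left multiplication by an element `S(a)`
because `S(b S⁻¹(a)) = a S(b)`, where `S⁻¹` is the antipode of the opposite algebra.

The map `π(a) = E₍₁₎ a S(E₍₂₎)` is a projection onto the commutant of `ε_s(A)`. Every `y ∈ ε_s(A)`
satisfies `(y ⊗ 1)E = (1 ⊗ y')E` with `S(y'b) = S(b)y`, so that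
`y E₍₁₎ p S(E₍₂₎q) = E₍₁₎ p S(y'E₍₂₎q) = E₍₁₎ p S(E₍₂₎q) y`. Conversely, if `z` commutes with
`ε_s(A)`, which contains the first legs of `E`, then
`π(z)S(q) = E₍₁₎ z S(qE₍₂₎) = z E₍₁₎ S(qE₍₂₎) = z S(q)`. Hence `A₀ = π(A)` is that commutant.

The identity `∑ ε_t(a₍₁₎) a₍₂₎ b = ab` yields left units in `A`, and `π` turns suitable ones into
left units that lie in `A₀`; by symmetry there are right units in `A₀`. They give `A₀A = AA₀ = A`,
and a multiplier `n` of `A₀` acts on `A` by `n a = (n z) a`, where `z ∈ A₀` is a left unit of `a`,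
which identifies `M(A₀)` with the commutant of `ε_s(A)` in `M(A)`.
-/

open scoped TensorProduct

noncomputable section

namespace WMHA

open Multiplier
open LinearMap (lTensor rTensor)

/-! ### Slice maps and legs of operators -/

section Slices

variable {K U U' V V' W : Type*} [CommSemiring K] [AddCommMonoid U] [Module K U]
  [AddCommMonoid U'] [Module K U'] [AddCommMonoid V] [Module K V] [AddCommMonoid V'] [Module K V']
  [AddCommMonoid W] [Module K W]

/-- The slice map `ω ⊗ ι : V ⊗ W → W`. -/
def sliceLeft (ω : V →ₗ[K] K) : V ⊗[K] W →ₗ[K] W :=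
  (TensorProduct.lid K W).toLinearMap ∘ₗ rTensor W ω

/-- The slice map `ι ⊗ ω : V ⊗ W → V`. -/
def sliceRight (ω : W →ₗ[K] K) : V ⊗[K] W →ₗ[K] V :=
  (TensorProduct.rid K V).toLinearMap ∘ₗ lTensor V ω

@[simp] lemma sliceLeft_tmul (ω : V →ₗ[K] K) (v : V) (w : W) :
    sliceLeft ω (v ⊗ₜ[K] w) = ω v • w := rfl

@[simp] lemma sliceRight_tmul (ω : W →ₗ[K] K) (v : V) (w : W) :
    sliceRight ω (v ⊗ₜ[K] w) = ω w • v := rfl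

lemma eq_of_tmul {f g : U ⊗[K] V →ₗ[K] W} (h : ∀ u v, f (u ⊗ₜ v) = g (u ⊗ₜ v))
    (z : U ⊗[K] V) : f z = g z :=
  DFunLike.congr_fun (TensorProduct.ext' h) z

lemma range_lift_eq_map₂ (f : U →ₗ[K] V →ₗ[K] W) :
    LinearMap.range (TensorProduct.lift f) = Submodule.map₂ f ⊤ ⊤ := by
  rw [LinearMap.range_eq_map, ← TensorProduct.map₂_mk_top_top_eq_top, Submodule.map_map₂]
  rfl

lemma range_eq_span_tmul (f : U ⊗[K] V →ₗ[K] W) :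
    LinearMap.range f = Submodule.span K {w | ∃ u v, w = f (u ⊗ₜ v)} := by
  rw [LinearMap.range_eq_map, ← TensorProduct.span_tmul_eq_top, Submodule.map_span]
  congr 1
  ext w
  simp [eq_comm]

lemma rTensor_lTensor_comm (θ : U →ₗ[K] U') (φ : V →ₗ[K] V') (z : U ⊗[K] V) :
    rTensor V' θ (lTensor U φ z) = lTensor U' φ (rTensor V θ z) :=
  eq_of_tmul (f := rTensor V' θ ∘ₗ lTensor U φ) (g := lTensor U' φ ∘ₗ rTensor V θ)
    (fun _ _ => rfl) z

lemma sliceLeft_rTensor (θ : U →ₗ[K] V) (ω : V →ₗ[K] K) (z : U ⊗[K] W) :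
    sliceLeft ω (rTensor W θ z) = sliceLeft (ω ∘ₗ θ) z :=
  eq_of_tmul (f := sliceLeft ω ∘ₗ rTensor W θ) (g := sliceLeft (ω ∘ₗ θ)) (fun _ _ => by simp) z

lemma sliceRight_lTensor (θ : U →ₗ[K] V) (ω : V →ₗ[K] K) (z : W ⊗[K] U) :
    sliceRight ω (lTensor W θ z) = sliceRight (ω ∘ₗ θ) z :=
  eq_of_tmul (f := sliceRight ω ∘ₗ lTensor W θ) (g := sliceRight (ω ∘ₗ θ)) (fun _ _ => by simp) z

lemma sliceLeft_lTensor (θ : U →ₗ[K] V) (ω : W →ₗ[K] K) (z : W ⊗[K] U) :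
    sliceLeft ω (lTensor W θ z) = θ (sliceLeft ω z) :=
  eq_of_tmul (f := sliceLeft ω ∘ₗ lTensor W θ) (g := θ ∘ₗ sliceLeft ω) (fun _ _ => by simp) z

lemma sliceRight_rTensor (θ : U →ₗ[K] V) (ω : W →ₗ[K] K) (z : U ⊗[K] W) :
    sliceRight ω (rTensor W θ z) = θ (sliceRight ω z) :=
  eq_of_tmul (f := sliceRight ω ∘ₗ rTensor W θ) (g := θ ∘ₗ sliceRight ω) (fun _ _ => by simp) z

@[simp] lemma sliceLeft_comm (ω : W →ₗ[K] K) (z : V ⊗[K] W) :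
    sliceLeft ω (TensorProduct.comm K V W z) = sliceRight ω z :=
  eq_of_tmul (f := sliceLeft ω ∘ₗ (TensorProduct.comm K V W).toLinearMap) (g := sliceRight ω)
    (fun _ _ => rfl) z

@[simp] lemma sliceRight_comm (ω : V →ₗ[K] K) (z : V ⊗[K] W) :
    sliceRight ω (TensorProduct.comm K V W z) = sliceLeft ω z :=
  eq_of_tmul (f := sliceRight ω ∘ₗ (TensorProduct.comm K V W).toLinearMap) (g := sliceLeft ω)
    (fun _ _ => rfl) z

lemma apply_sliceLeft (ω : V →ₗ[K] K) (μ : W →ₗ[K] K) (z : V ⊗[K] W) :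
    μ (sliceLeft ω z) = ω (sliceRight μ z) :=
  eq_of_tmul (f := μ ∘ₗ sliceLeft ω) (g := ω ∘ₗ sliceRight μ) (fun _ _ => by simp [mul_comm]) z

/-- The operator `v ↦ (ω ⊗ ι) X(c ⊗ v)` on the second leg of `X`. -/
def legRight (X : U ⊗[K] V →ₗ[K] U ⊗[K] V) (c : U) (ω : U →ₗ[K] K) : V →ₗ[K] V :=
  sliceLeft ω ∘ₗ X ∘ₗ TensorProduct.mk K U V c

/-- The operator `u ↦ (ι ⊗ ω) X(u ⊗ d)` on the first leg of `X`. -/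
def legLeft (X : U ⊗[K] V →ₗ[K] U ⊗[K] V) (d : V) (ω : V →ₗ[K] K) : U →ₗ[K] U :=
  sliceRight ω ∘ₗ X ∘ₗ (TensorProduct.mk K U V).flip d

lemma legRight_apply (X : U ⊗[K] V →ₗ[K] U ⊗[K] V) (c : U) (ω : U →ₗ[K] K) (v : V) :
    legRight X c ω v = sliceLeft ω (X (c ⊗ₜ v)) := rfl

lemma legLeft_apply (X : U ⊗[K] V →ₗ[K] U ⊗[K] V) (d : V) (ω : V →ₗ[K] K) (u : U) :
    legLeft X d ω u = sliceRight ω (X (u ⊗ₜ d)) := rfl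

/-- Conjugation of an operator on `U ⊗ V` by the flip. -/
def flipConj (X : U ⊗[K] V →ₗ[K] U ⊗[K] V) : V ⊗[K] U →ₗ[K] V ⊗[K] U :=
  (TensorProduct.comm K U V).conj X

@[simp] lemma flipConj_apply (X : U ⊗[K] V →ₗ[K] U ⊗[K] V) (z : V ⊗[K] U) :
    flipConj X z = TensorProduct.comm K U V (X (TensorProduct.comm K V U z)) := rfl

@[simp] lemma flipConj_flipConj (X : U ⊗[K] V →ₗ[K] U ⊗[K] V) : flipConj (flipConj X) = X :=
  LinearMap.ext fun z => by simp

lemma range_flipConj (X : U ⊗[K] V →ₗ[K] U ⊗[K] V) :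
    LinearMap.range (flipConj X) =
      (LinearMap.range X).map (TensorProduct.comm K U V).toLinearMap := by
  rw [flipConj, LinearEquiv.conj_apply, LinearEquiv.range_comp, LinearMap.range_comp]

lemma ker_flipConj (X : U ⊗[K] V →ₗ[K] U ⊗[K] V) :
    LinearMap.ker (flipConj X) = (LinearMap.ker X).map (TensorProduct.comm K U V).toLinearMap := by
  rw [flipConj, LinearEquiv.conj_apply, LinearMap.ker_comp, LinearEquiv.ker_comp,
    Submodule.map_equiv_eq_comap_symm]

@[simp] lemma legRight_flipConj (X : U ⊗[K] V →ₗ[K] U ⊗[K] V) (c : V) (ω : V →ₗ[K] K) :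
    legRight (flipConj X) c ω = legLeft X c ω :=
  LinearMap.ext fun _ => by simp [legRight_apply, legLeft_apply]

@[simp] lemma legLeft_flipConj (X : U ⊗[K] V →ₗ[K] U ⊗[K] V) (d : U) (ω : U →ₗ[K] K) :
    legLeft (flipConj X) d ω = legRight X d ω :=
  LinearMap.ext fun _ => by simp [legRight_apply, legLeft_apply]

/-- The operator `X ⊗ ι` on `U ⊗ (V ⊗ W)`. -/
def onFirstTwo (W : Type*) [AddCommMonoid W] [Module K W] (X : U ⊗[K] V →ₗ[K] U ⊗[K] V) :
    U ⊗[K] (V ⊗[K] W) →ₗ[K] U ⊗[K] (V ⊗[K] W) :=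
  (TensorProduct.assoc K U V W).toLinearMap ∘ₗ rTensor W X ∘ₗ
    (TensorProduct.assoc K U V W).symm.toLinearMap

/-- `X₁₂ Y₂₃ = Y₂₃ X₁₂` on `U ⊗ V ⊗ W`. -/
def LegsCommute (X : U ⊗[K] V →ₗ[K] U ⊗[K] V) (Y : V ⊗[K] W →ₗ[K] V ⊗[K] W) : Prop :=
  ∀ c z, onFirstTwo W X (c ⊗ₜ Y z) = lTensor U Y (onFirstTwo W X (c ⊗ₜ z))

lemma sliceLeft_onFirstTwo (X : U ⊗[K] V →ₗ[K] U ⊗[K] V) (ω : U →ₗ[K] K) (c : U)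
    (z : V ⊗[K] W) : sliceLeft ω (onFirstTwo W X (c ⊗ₜ z)) = rTensor W (legRight X c ω) z := by
  refine eq_of_tmul (f := sliceLeft ω ∘ₗ onFirstTwo W X ∘ₗ TensorProduct.mk K U (V ⊗[K] W) c)
    (g := rTensor W (legRight X c ω)) (fun b d => ?_) z
  exact eq_of_tmul (f := sliceLeft ω ∘ₗ (TensorProduct.assoc K U V W).toLinearMap ∘ₗ
    (TensorProduct.mk K (U ⊗[K] V) W).flip d) (g := (TensorProduct.mk K V W).flip d ∘ₗ sliceLeft ω)
    (fun _ _ => by simp [TensorProduct.smul_tmul']) (X (c ⊗ₜ b))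

end Slices

section VectorSpaces

variable {K U V W : Type*} [Field K] [AddCommGroup U] [Module K U] [AddCommGroup V] [Module K V]
  [AddCommGroup W] [Module K W]

lemma eq_of_sliceLeft {z z' : V ⊗[K] W}
    (h : ∀ ω : V →ₗ[K] K, sliceLeft ω z = sliceLeft ω z') : z = z' := by
  classical
  let b := Module.Basis.ofVectorSpace K V
  have coeff_eq (i) (x : V ⊗[K] W) :
      TensorProduct.equivFinsuppOfBasisLeft (N := W) b x i = sliceLeft (b.coord i) x := by
    induction x with
    | zero => simp
    | add x y hx hy => simp [hx, hy]
    | tmul v w => simp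
  refine (TensorProduct.equivFinsuppOfBasisLeft (N := W) b).injective (Finsupp.ext fun i => ?_)
  rw [coeff_eq, coeff_eq, h]

lemma eq_of_sliceRight {z z' : V ⊗[K] W}
    (h : ∀ ω : W →ₗ[K] K, sliceRight ω z = sliceRight ω z') : z = z' :=
  (TensorProduct.comm K V W).injective <| eq_of_sliceLeft fun ω => by simpa using h ω

lemma eq_of_rTensor {ι : Type*} {f : ι → U →ₗ[K] V}
    (hf : ∀ u u', (∀ i, f i u = f i u') → u = u') {z z' : U ⊗[K] W}
    (h : ∀ i, rTensor W (f i) z = rTensor W (f i) z') : z = z' :=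
  eq_of_sliceRight fun ω => hf _ _ fun i => by
    rw [← sliceRight_rTensor, h, sliceRight_rTensor]

lemma eq_of_lTensor {ι : Type*} {f : ι → U →ₗ[K] V}
    (hf : ∀ u u', (∀ i, f i u = f i u') → u = u') {z z' : W ⊗[K] U}
    (h : ∀ i, lTensor W (f i) z = lTensor W (f i) z') : z = z' :=
  eq_of_sliceLeft fun ω => hf _ _ fun i => by
    rw [← sliceLeft_lTensor, h, sliceLeft_lTensor]

lemma mem_range_rTensor_subtype {Y : Submodule K V} {z : V ⊗[K] W}
    (h : ∀ ω : W →ₗ[K] K, sliceRight ω z ∈ Y) : z ∈ LinearMap.range (rTensor W Y.subtype) := by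
  have hz : rTensor W Y.mkQ z = 0 := eq_of_sliceRight fun ω => by
    rw [sliceRight_rTensor, map_zero]
    simpa using h ω
  exact (rTensor_exact W (LinearMap.exact_subtype_mkQ Y) Y.mkQ_surjective z).1 hz

lemma legsCommute_iff_legRight {X : U ⊗[K] V →ₗ[K] U ⊗[K] V} {Y : V ⊗[K] W →ₗ[K] V ⊗[K] W} :
    LegsCommute X Y ↔
      ∀ c ω z, rTensor W (legRight X c ω) (Y z) = Y (rTensor W (legRight X c ω) z) := by
  simp only [← sliceLeft_onFirstTwo, ← sliceLeft_lTensor]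
  exact ⟨fun h c ω z => congrArg (sliceLeft ω) (h c z),
    fun h c z => eq_of_sliceLeft fun ω => h c ω z⟩

lemma legsCommute_iff_legLeft {X : U ⊗[K] V →ₗ[K] U ⊗[K] V} {Y : V ⊗[K] W →ₗ[K] V ⊗[K] W} :
    LegsCommute X Y ↔
      ∀ d μ z, lTensor U (legLeft Y d μ) (X z) = X (lTensor U (legLeft Y d μ) z) := by
  have slice_XY (c b d) (ω : U →ₗ[K] K) (μ : W →ₗ[K] K) :
      sliceRight μ (rTensor W (legRight X c ω) (Y (b ⊗ₜ d))) =
        sliceLeft ω (X (lTensor U (legLeft Y d μ) (c ⊗ₜ b))) := by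
    rw [sliceRight_rTensor]; rfl
  have slice_YX (c b d) (ω : U →ₗ[K] K) (μ : W →ₗ[K] K) :
      sliceRight μ (Y (rTensor W (legRight X c ω) (b ⊗ₜ d))) =
        sliceLeft ω (lTensor U (legLeft Y d μ) (X (c ⊗ₜ b))) := by
    rw [sliceLeft_lTensor]; rfl
  rw [legsCommute_iff_legRight]
  constructor
  · intro h d μ z
    refine eq_of_tmul (f := lTensor U (legLeft Y d μ) ∘ₗ X) (g := X ∘ₗ lTensor U (legLeft Y d μ))
      (fun c b => eq_of_sliceLeft fun ω => ?_) z
    exact (slice_YX ..).symm.trans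
      ((congrArg (sliceRight μ) (h c ω (b ⊗ₜ d))).symm.trans (slice_XY ..))
  · intro h c ω z
    refine eq_of_tmul (f := rTensor W (legRight X c ω) ∘ₗ Y) (g := Y ∘ₗ rTensor W (legRight X c ω))
      (fun b d => eq_of_sliceRight fun μ => ?_) z
    exact (slice_XY ..).trans
      ((congrArg (sliceLeft ω) (h d μ (c ⊗ₜ b))).symm.trans (slice_YX ..).symm)

lemma LegsCommute.flipConj {X : U ⊗[K] V →ₗ[K] U ⊗[K] V} {Y : V ⊗[K] W →ₗ[K] V ⊗[K] W}
    (h : LegsCommute X Y) : LegsCommute (flipConj Y) (flipConj X) :=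
  legsCommute_iff_legRight.2 fun c ω z => by
    rw [legRight_flipConj, flipConj_apply, LinearMap.rTensor_comm, legsCommute_iff_legLeft.1 h,
      flipConj_apply, ← LinearMap.lTensor_comm]

lemma mem_sup_of_sliceRight_mem {N : Submodule K V} {Y : Submodule K W} {z : V ⊗[K] W}
    (h : ∀ ω : W →ₗ[K] K, Y ≤ LinearMap.ker ω → sliceRight ω z ∈ N) :
    z ∈ LinearMap.range (lTensor V Y.subtype) ⊔ LinearMap.range (rTensor W N.subtype) := by
  rw [← TensorProduct.map_ker (LinearMap.exact_subtype_mkQ N) N.mkQ_surjective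
    (LinearMap.exact_subtype_mkQ Y) Y.mkQ_surjective, LinearMap.mem_ker,
    ← LinearMap.rTensor_comp_lTensor]
  refine eq_of_sliceRight fun ω => ?_
  rw [LinearMap.comp_apply, sliceRight_rTensor, sliceRight_lTensor, map_zero,
    Submodule.mkQ_apply, Submodule.Quotient.mk_eq_zero]
  exact h _ fun y hy => by simp [(Submodule.Quotient.mk_eq_zero Y).2 hy]

end VectorSpaces

/-! ### The canonical maps and the four symmetries -/

/-- The structure maps of a regular weak multiplier Hopf algebra as operators on `A ⊗ A`, with the
product as a bilinear map. `Δₗ a` and `Δᵣ a` are the left and the right multiplication by `Δ(a)`,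
and `Eₗ` and `Eᵣ` are those by the canonical idempotent. In this form the opposite algebra lives
on the same space as `A`, so that a statement about `T₁` yields those about `T₂`, `T₃`, `T₄`. -/
structure HopfMaps (K A : Type*) [Field K] [AddCommGroup A] [Module K A] where
  mul : A →ₗ[K] A →ₗ[K] A
  ε : A →ₗ[K] K
  Δₗ : A → A ⊗[K] A →ₗ[K] A ⊗[K] A
  Δᵣ : A → A ⊗[K] A →ₗ[K] A ⊗[K] A
  T₁ : A ⊗[K] A →ₗ[K] A ⊗[K] A
  T₂ : A ⊗[K] A →ₗ[K] A ⊗[K] A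
  T₃ : A ⊗[K] A →ₗ[K] A ⊗[K] A
  T₄ : A ⊗[K] A →ₗ[K] A ⊗[K] A
  G₁ : A ⊗[K] A →ₗ[K] A ⊗[K] A
  G₂ : A ⊗[K] A →ₗ[K] A ⊗[K] A
  G₃ : A ⊗[K] A →ₗ[K] A ⊗[K] A
  G₄ : A ⊗[K] A →ₗ[K] A ⊗[K] A
  Eₗ : A ⊗[K] A →ₗ[K] A ⊗[K] A
  Eᵣ : A ⊗[K] A →ₗ[K] A ⊗[K] A

namespace HopfMaps

variable {K A : Type*} [Field K] [AddCommGroup A] [Module K A]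

/-- The structure maps of the opposite algebra. -/
@[simps] def op (D : HopfMaps K A) : HopfMaps K A where
  mul := D.mul.flip
  ε := D.ε
  Δₗ := D.Δᵣ
  Δᵣ := D.Δₗ
  T₁ := D.T₃
  T₂ := D.T₄
  T₃ := D.T₁
  T₄ := D.T₂
  G₁ := D.G₃
  G₂ := D.G₄
  G₃ := D.G₁
  G₄ := D.G₂
  Eₗ := D.Eᵣ
  Eᵣ := D.Eₗ

/-- The structure maps of the coopposite coproduct. -/
@[simps] def cop (D : HopfMaps K A) : HopfMaps K A where
  mul := D.mul
  ε := D.ε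
  Δₗ a := flipConj (D.Δₗ a)
  Δᵣ a := flipConj (D.Δᵣ a)
  T₁ := flipConj D.T₄
  T₂ := flipConj D.T₃
  T₃ := flipConj D.T₂
  T₄ := flipConj D.T₁
  G₁ := flipConj D.G₄
  G₂ := flipConj D.G₃
  G₃ := flipConj D.G₂
  G₄ := flipConj D.G₁
  Eₗ := flipConj D.Eₗ
  Eᵣ := flipConj D.Eᵣ

lemma cop_cop (D : HopfMaps K A) : D.cop.cop = D := by
  cases D
  simp [cop]

/-- The conditions of a weak multiplier Hopf algebra that concern the canonical map `T₁`. Those on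
`A ⊗ A ⊗ A` are expressed through the legs of the operators. -/
structure T₁Axioms (D : HopfMaps K A) : Prop where
  mul_assoc : ∀ a b c, D.mul (D.mul a b) c = D.mul a (D.mul b c)
  eq_zero_of_mul : ∀ a, (∀ b, D.mul b a = 0) → a = 0
  idempotent : Submodule.map₂ D.mul ⊤ ⊤ = ⊤
  T₁_T₂ : ∀ a b c,
    rTensor A (D.mul c) (D.T₁ (a ⊗ₜ b)) = lTensor A (D.mul.flip b) (D.T₂ (c ⊗ₜ a))
  T₁_T₃ : ∀ a b c,
    lTensor A (D.mul c) (D.T₁ (a ⊗ₜ b)) = lTensor A (D.mul.flip b) (D.T₃ (a ⊗ₜ c))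
  Δₗ_eq_T₁ : ∀ a x b, rTensor A (D.mul.flip x) (D.T₁ (a ⊗ₜ b)) = D.Δₗ a (x ⊗ₜ b)
  Δₗ_T₁ : ∀ d z, D.Δₗ d (D.T₁ z) = D.T₁ (rTensor A (D.mul d) z)
  Eₗ_Eᵣ : ∀ u v x y, rTensor A (D.mul u) (lTensor A (D.mul v) (D.Eₗ (x ⊗ₜ y))) =
    rTensor A (D.mul.flip x) (lTensor A (D.mul.flip y) (D.Eᵣ (u ⊗ₜ v)))
  Eₗ_Eₗ : ∀ z, D.Eₗ (D.Eₗ z) = D.Eₗ z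
  range_T₁ : LinearMap.range D.T₁ = LinearMap.range D.Eₗ
  ker_T₁ : LinearMap.ker D.T₁ = LinearMap.range (LinearMap.id - D.G₁)
  counit_T₁ : ∀ a b, sliceLeft D.ε (D.T₁ (a ⊗ₜ b)) = D.mul a b
  full_T₁ : ∀ V : Submodule K A,
    LinearMap.range D.T₁ ≤ LinearMap.range (rTensor A V.subtype) → V = ⊤
  T₂_comm_T₁ : LegsCommute D.T₂ D.T₁
  Eₗ_comm_T₁ : LegsCommute D.Eₗ D.T₁
  Eₗ_comm_Eₗ : LegsCommute D.Eₗ D.Eₗ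
  T₁_Eₗ : ∀ d ω z, D.T₁ (rTensor A (legLeft D.Eₗ d ω) z) = lTensor A (legLeft D.Eₗ d ω) (D.T₁ z)
  G₁_T₁ : ∀ b ω z, rTensor A (legLeft D.G₁ b ω) (D.T₁ z) = D.T₁ (lTensor A (legRight D.Eₗ b ω) z)

end HopfMaps

/-- The structure maps of a regular weak multiplier Hopf algebra, with the axioms on each of its
four canonical maps. -/
structure HopfData (K A : Type*) [Field K] [AddCommGroup A] [Module K A] extends
    HopfMaps K A where
  t₁Axioms : toHopfMaps.T₁Axioms
  op_t₁Axioms : toHopfMaps.op.T₁Axioms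
  cop_t₁Axioms : toHopfMaps.cop.T₁Axioms
  cop_op_t₁Axioms : toHopfMaps.cop.op.T₁Axioms

namespace HopfData

variable {K A : Type*} [Field K] [AddCommGroup A] [Module K A] (D : HopfData K A)
variable {W : Type*} [AddCommGroup W] [Module K W]

/-- The opposite algebra. -/
def op : HopfData K A where
  toHopfMaps := D.toHopfMaps.op
  t₁Axioms := D.op_t₁Axioms
  op_t₁Axioms := D.t₁Axioms
  cop_t₁Axioms := D.cop_op_t₁Axioms
  cop_op_t₁Axioms := D.cop_t₁Axioms

@[simp] lemma op_toHopfMaps : D.op.toHopfMaps = D.toHopfMaps.op := rfl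

/-- The coopposite coproduct. -/
def cop : HopfData K A where
  toHopfMaps := D.toHopfMaps.cop
  t₁Axioms := D.cop_t₁Axioms
  op_t₁Axioms := D.cop_op_t₁Axioms
  cop_t₁Axioms := D.toHopfMaps.cop_cop.symm ▸ D.t₁Axioms
  cop_op_t₁Axioms := D.toHopfMaps.cop_cop.symm ▸ D.op_t₁Axioms

@[simp] lemma cop_toHopfMaps : D.cop.toHopfMaps = D.toHopfMaps.cop := rfl

lemma mul_assoc (a b c : A) : D.mul (D.mul a b) c = D.mul a (D.mul b c) :=
  D.t₁Axioms.mul_assoc a b c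

section Cancellation

lemma eq_of_mul_left {x y : A} (h : ∀ c, D.mul c x = D.mul c y) : x = y :=
  sub_eq_zero.1 <| D.t₁Axioms.eq_zero_of_mul _ fun c => by rw [map_sub, h, sub_self]

lemma eq_of_mul_right {x y : A} (h : ∀ c, D.mul x c = D.mul y c) : x = y :=
  D.op.eq_of_mul_left h

lemma eq_of_rTensor_mul {z z' : A ⊗[K] W}
    (h : ∀ c, rTensor W (D.mul c) z = rTensor W (D.mul c) z') : z = z' :=
  eq_of_rTensor (fun _ _ => D.eq_of_mul_left) h

lemma eq_of_lTensor_mul {z z' : W ⊗[K] A}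
    (h : ∀ c, lTensor W (D.mul c) z = lTensor W (D.mul c) z') : z = z' :=
  eq_of_lTensor (fun _ _ => D.eq_of_mul_left) h

lemma eq_of_rTensor_mul_flip {z z' : A ⊗[K] W}
    (h : ∀ c, rTensor W (D.mul.flip c) z = rTensor W (D.mul.flip c) z') : z = z' :=
  D.op.eq_of_rTensor_mul h

lemma eq_of_lTensor_mul_flip {z z' : W ⊗[K] A}
    (h : ∀ c, lTensor W (D.mul.flip c) z = lTensor W (D.mul.flip c) z') : z = z' :=
  D.op.eq_of_lTensor_mul h

lemma ext_of_mul {f g : A →ₗ[K] W} (h : ∀ a b, f (D.mul a b) = g (D.mul a b)) : f = g :=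
  LinearMap.eqLocus_eq_top.1 <| top_unique <| D.t₁Axioms.idempotent.symm.trans_le <|
    Submodule.map₂_le.2 fun a _ b _ => h a b

lemma ext_of_legLeft_T₁ {f g : A →ₗ[K] W}
    (h : ∀ c d ω, f (legLeft D.T₁ d ω c) = g (legLeft D.T₁ d ω c)) : f = g := by
  refine LinearMap.eqLocus_eq_top.1 <| D.t₁Axioms.full_T₁ _ ?_
  rintro _ ⟨z, rfl⟩
  exact mem_range_rTensor_subtype fun ω =>
    eq_of_tmul (f := f ∘ₗ sliceRight ω ∘ₗ D.T₁) (g := g ∘ₗ sliceRight ω ∘ₗ D.T₁)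
      (fun c d => h c d ω) z

lemma ext_of_rTensor_T₁ {f g : A →ₗ[K] W}
    (h : ∀ z, rTensor A f (D.T₁ z) = rTensor A g (D.T₁ z)) : f = g :=
  D.ext_of_legLeft_T₁ fun c d ω => by
    rw [legLeft_apply, ← sliceRight_rTensor, h, sliceRight_rTensor]

lemma ext_of_lTensor_T₂ {f g : A →ₗ[K] W}
    (h : ∀ z, lTensor A f (D.T₂ z) = lTensor A g (D.T₂ z)) : f = g :=
  D.op.cop.ext_of_rTensor_T₁ fun z => by
    simpa [LinearMap.rTensor_comm] using h (TensorProduct.comm K A A z)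

end Cancellation

section CanonicalMaps

lemma T₁_T₂ (a b c : A) :
    rTensor A (D.mul c) (D.T₁ (a ⊗ₜ b)) = lTensor A (D.mul.flip b) (D.T₂ (c ⊗ₜ a)) :=
  D.t₁Axioms.T₁_T₂ a b c

lemma T₃_T₄ (a b c : A) :
    rTensor A (D.mul.flip c) (D.T₃ (a ⊗ₜ b)) = lTensor A (D.mul b) (D.T₄ (c ⊗ₜ a)) :=
  D.op.T₁_T₂ a b c

lemma T₁_T₃ (a b c : A) :
    lTensor A (D.mul c) (D.T₁ (a ⊗ₜ b)) = lTensor A (D.mul.flip b) (D.T₃ (a ⊗ₜ c)) :=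
  D.t₁Axioms.T₁_T₃ a b c

lemma T₂_T₄ (a c d : A) :
    rTensor A (D.mul c) (D.T₄ (d ⊗ₜ a)) = rTensor A (D.mul.flip d) (D.T₂ (c ⊗ₜ a)) := by
  simpa [LinearMap.lTensor_comm] using D.cop.T₁_T₃ a d c

lemma Δₗ_eq_T₁ (a x b : A) : rTensor A (D.mul.flip x) (D.T₁ (a ⊗ₜ b)) = D.Δₗ a (x ⊗ₜ b) :=
  D.t₁Axioms.Δₗ_eq_T₁ a x b

lemma Δₗ_eq_T₄ (a x y : A) : lTensor A (D.mul.flip y) (D.T₄ (x ⊗ₜ a)) = D.Δₗ a (x ⊗ₜ y) := by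
  simpa [LinearMap.rTensor_comm] using D.cop.Δₗ_eq_T₁ a y x

lemma Δᵣ_eq_T₂ (a x y : A) : lTensor A (D.mul y) (D.T₂ (x ⊗ₜ a)) = D.Δᵣ a (x ⊗ₜ y) :=
  D.op.Δₗ_eq_T₄ a x y

lemma Δₗ_T₁ (d : A) (z : A ⊗[K] A) : D.Δₗ d (D.T₁ z) = D.T₁ (rTensor A (D.mul d) z) :=
  D.t₁Axioms.Δₗ_T₁ d z

lemma Δₗ_T₄ (d : A) (z : A ⊗[K] A) : D.Δₗ d (D.T₄ z) = D.T₄ (lTensor A (D.mul d) z) := by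
  simpa [LinearMap.rTensor_comm] using D.cop.Δₗ_T₁ d (TensorProduct.comm K A A z)

lemma Eₗ_Eᵣ (u v x y : A) : rTensor A (D.mul u) (lTensor A (D.mul v) (D.Eₗ (x ⊗ₜ y))) =
    rTensor A (D.mul.flip x) (lTensor A (D.mul.flip y) (D.Eᵣ (u ⊗ₜ v))) :=
  D.t₁Axioms.Eₗ_Eᵣ u v x y

lemma Eₗ_Eₗ (z : A ⊗[K] A) : D.Eₗ (D.Eₗ z) = D.Eₗ z := D.t₁Axioms.Eₗ_Eₗ z

lemma exists_Eₗ_eq_T₁ (z : A ⊗[K] A) : ∃ w, D.Eₗ z = D.T₁ w := by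
  obtain ⟨w, hw⟩ : D.Eₗ z ∈ LinearMap.range D.T₁ := D.t₁Axioms.range_T₁ ▸ ⟨z, rfl⟩
  exact ⟨w, hw.symm⟩

lemma exists_Eᵣ_eq_T₂ (z : A ⊗[K] A) : ∃ w, D.Eᵣ z = D.T₂ w := by
  obtain ⟨w, hw⟩ := D.op.cop.exists_Eₗ_eq_T₁ (TensorProduct.comm K A A z)
  exact ⟨TensorProduct.comm K A A w, by simpa using hw⟩

lemma exists_Eₗ_eq_T₄ (z : A ⊗[K] A) : ∃ w, D.Eₗ z = D.T₄ w :=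
  D.op.exists_Eᵣ_eq_T₂ z

lemma Eₗ_T₁ (z : A ⊗[K] A) : D.Eₗ (D.T₁ z) = D.T₁ z := by
  obtain ⟨w, hw⟩ : D.T₁ z ∈ LinearMap.range D.Eₗ := D.t₁Axioms.range_T₁ ▸ ⟨z, rfl⟩
  rw [← hw, Eₗ_Eₗ]

lemma Eₗ_T₄ (z : A ⊗[K] A) : D.Eₗ (D.T₄ z) = D.T₄ z := by
  simpa using D.cop.Eₗ_T₁ (TensorProduct.comm K A A z)

lemma T₁_G₁ (z : A ⊗[K] A) : D.T₁ (D.G₁ z) = D.T₁ z := by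
  have hz : z - D.G₁ z ∈ LinearMap.ker D.T₁ := D.t₁Axioms.ker_T₁ ▸ ⟨z, rfl⟩
  rw [LinearMap.mem_ker, map_sub, sub_eq_zero] at hz
  exact hz.symm

lemma counit_T₁ (a b : A) : sliceLeft D.ε (D.T₁ (a ⊗ₜ b)) = D.mul a b :=
  D.t₁Axioms.counit_T₁ a b

lemma counit_T₃ (a b : A) : sliceLeft D.ε (D.T₃ (a ⊗ₜ b)) = D.mul b a := D.op.counit_T₁ a b

lemma counit_T₂ (a b : A) : sliceRight D.ε (D.T₂ (a ⊗ₜ b)) = D.mul a b := by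
  simpa using D.cop.counit_T₃ b a

lemma counit_T₄ (a b : A) : sliceRight D.ε (D.T₄ (a ⊗ₜ b)) = D.mul b a := D.op.counit_T₂ a b

lemma T₂_comm_T₁ : LegsCommute D.T₂ D.T₁ := D.t₁Axioms.T₂_comm_T₁

lemma T₄_comm_T₃ : LegsCommute D.T₄ D.T₃ := D.op.T₂_comm_T₁

lemma Eᵣ_comm_T₃ : LegsCommute D.Eᵣ D.T₃ := D.op.t₁Axioms.Eₗ_comm_T₁

lemma T₄_comm_Eₗ : LegsCommute D.T₄ D.Eₗ := by
  simpa using D.cop.t₁Axioms.Eₗ_comm_T₁.flipConj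

lemma Eₗ_comm_Eₗ : LegsCommute D.Eₗ D.Eₗ := D.t₁Axioms.Eₗ_comm_Eₗ

lemma T₁_rTensor_legLeft_Eₗ (d : A) (ω : A →ₗ[K] K) (z : A ⊗[K] A) :
    D.T₁ (rTensor A (legLeft D.Eₗ d ω) z) = lTensor A (legLeft D.Eₗ d ω) (D.T₁ z) :=
  D.t₁Axioms.T₁_Eₗ d ω z

lemma rTensor_legLeft_G₁_T₁ (b : A) (ω : A →ₗ[K] K) (z : A ⊗[K] A) :
    rTensor A (legLeft D.G₁ b ω) (D.T₁ z) = D.T₁ (lTensor A (legRight D.Eₗ b ω) z) :=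
  D.t₁Axioms.G₁_T₁ b ω z

lemma lTensor_legRight_G₂_T₂ (b : A) (ω : A →ₗ[K] K) (z : A ⊗[K] A) :
    lTensor A (legRight D.G₂ b ω) (D.T₂ z) = D.T₂ (rTensor A (legLeft D.Eᵣ b ω) z) := by
  simpa [LinearMap.rTensor_comm, LinearMap.lTensor_comm] using
    D.op.cop.rTensor_legLeft_G₁_T₁ b ω (TensorProduct.comm K A A z)

end CanonicalMaps

section Linearity

lemma mul_mul_eq_comp (a b : A) : D.mul (D.mul a b) = D.mul a ∘ₗ D.mul b :=
  LinearMap.ext fun c => D.mul_assoc a b c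

lemma mul_flip_mul_eq_comp (a b : A) : D.mul.flip (D.mul a b) = D.mul.flip b ∘ₗ D.mul.flip a :=
  LinearMap.ext fun c => (D.mul_assoc c a b).symm

lemma mul_comp_mul_flip (a b : A) : D.mul a ∘ₗ D.mul.flip b = D.mul.flip b ∘ₗ D.mul a :=
  LinearMap.ext fun c => (D.mul_assoc a c b).symm

lemma T₁_lTensor_mul_flip (c : A) (z : A ⊗[K] A) :
    D.T₁ (lTensor A (D.mul.flip c) z) = lTensor A (D.mul.flip c) (D.T₁ z) := by
  refine eq_of_tmul (f := D.T₁ ∘ₗ lTensor A (D.mul.flip c))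
    (g := lTensor A (D.mul.flip c) ∘ₗ D.T₁) (fun a b => D.eq_of_lTensor_mul fun d => ?_) z
  rw [LinearMap.comp_apply, LinearMap.comp_apply, LinearMap.lTensor_tmul, LinearMap.flip_apply,
    T₁_T₃, mul_flip_mul_eq_comp, LinearMap.lTensor_comp_apply, ← T₁_T₃,
    ← LinearMap.lTensor_comp_apply, ← LinearMap.lTensor_comp_apply, mul_comp_mul_flip]

lemma T₄_rTensor_mul_flip (c : A) (z : A ⊗[K] A) :
    D.T₄ (rTensor A (D.mul.flip c) z) = rTensor A (D.mul.flip c) (D.T₄ z) := by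
  simpa [LinearMap.rTensor_comm, LinearMap.lTensor_comm] using
    D.cop.T₁_lTensor_mul_flip c (TensorProduct.comm K A A z)

lemma Eₗ_rTensor_mul_flip (c : A) (z : A ⊗[K] A) :
    D.Eₗ (rTensor A (D.mul.flip c) z) = rTensor A (D.mul.flip c) (D.Eₗ z) := by
  refine eq_of_tmul (f := D.Eₗ ∘ₗ rTensor A (D.mul.flip c))
    (g := rTensor A (D.mul.flip c) ∘ₗ D.Eₗ)
    (fun a b => D.eq_of_lTensor_mul fun v => D.eq_of_rTensor_mul fun u => ?_) z
  rw [LinearMap.comp_apply, LinearMap.comp_apply, LinearMap.rTensor_tmul, LinearMap.flip_apply,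
    Eₗ_Eᵣ, mul_flip_mul_eq_comp, LinearMap.rTensor_comp_apply, ← Eₗ_Eᵣ,
    ← LinearMap.rTensor_comp_apply, ← rTensor_lTensor_comm, ← LinearMap.rTensor_comp_apply,
    mul_comp_mul_flip]

lemma Eₗ_lTensor_mul_flip (c : A) (z : A ⊗[K] A) :
    D.Eₗ (lTensor A (D.mul.flip c) z) = lTensor A (D.mul.flip c) (D.Eₗ z) := by
  simpa [LinearMap.rTensor_comm, LinearMap.lTensor_comm] using
    D.cop.Eₗ_rTensor_mul_flip c (TensorProduct.comm K A A z)

lemma Eᵣ_rTensor_mul (c : A) (z : A ⊗[K] A) :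
    D.Eᵣ (rTensor A (D.mul c) z) = rTensor A (D.mul c) (D.Eᵣ z) :=
  D.op.Eₗ_rTensor_mul_flip c z

lemma Eᵣ_lTensor_mul (c : A) (z : A ⊗[K] A) :
    D.Eᵣ (lTensor A (D.mul c) z) = lTensor A (D.mul c) (D.Eᵣ z) :=
  D.op.Eₗ_lTensor_mul_flip c z

lemma Δₗ_Δᵣ (a u v x y : A) : rTensor A (D.mul u) (lTensor A (D.mul v) (D.Δₗ a (x ⊗ₜ y))) =
    rTensor A (D.mul.flip x) (lTensor A (D.mul.flip y) (D.Δᵣ a (u ⊗ₜ v))) := by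
  rw [← Δₗ_eq_T₁, ← Δᵣ_eq_T₂, ← rTensor_lTensor_comm, ← LinearMap.rTensor_comp_apply,
    mul_comp_mul_flip, LinearMap.rTensor_comp_apply, rTensor_lTensor_comm, T₁_T₂,
    ← LinearMap.lTensor_comp_apply, ← LinearMap.lTensor_comp_apply, mul_comp_mul_flip]

lemma Eₗ_Δₗ (a : A) (z : A ⊗[K] A) : D.Eₗ (D.Δₗ a z) = D.Δₗ a z := by
  refine eq_of_tmul (f := D.Eₗ ∘ₗ D.Δₗ a) (g := D.Δₗ a) (fun x y => ?_) z
  rw [LinearMap.comp_apply, ← Δₗ_eq_T₁, Eₗ_rTensor_mul_flip, Eₗ_T₁]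

lemma Eᵣ_Δᵣ (a : A) (z : A ⊗[K] A) : D.Eᵣ (D.Δᵣ a z) = D.Δᵣ a z := D.op.Eₗ_Δₗ a z

/-- The product of `A ⊗ A`. -/
def mulTensor : A ⊗[K] A →ₗ[K] A ⊗[K] A →ₗ[K] A ⊗[K] A :=
  TensorProduct.map₂ D.mul D.mul

lemma mulTensor_tmul (u v : A) (z : A ⊗[K] A) :
    D.mulTensor (u ⊗ₜ v) z = rTensor A (D.mul u) (lTensor A (D.mul v) z) :=
  eq_of_tmul (f := D.mulTensor (u ⊗ₜ v)) (g := rTensor A (D.mul u) ∘ₗ lTensor A (D.mul v))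
    (fun _ _ => rfl) z

lemma mulTensor_tmul_right (x y : A) (w : A ⊗[K] A) :
    D.mulTensor w (x ⊗ₜ y) = rTensor A (D.mul.flip x) (lTensor A (D.mul.flip y) w) :=
  eq_of_tmul (f := D.mulTensor.flip (x ⊗ₜ y))
    (g := rTensor A (D.mul.flip x) ∘ₗ lTensor A (D.mul.flip y)) (fun _ _ => rfl) w

lemma mulTensor_Eₗ (w z : A ⊗[K] A) : D.mulTensor w (D.Eₗ z) = D.mulTensor (D.Eᵣ w) z := by
  refine DFunLike.congr_fun (f := D.mulTensor.compl₂ D.Eₗ w) (g := (D.mulTensor ∘ₗ D.Eᵣ) w)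
    (eq_of_tmul (fun u v => TensorProduct.ext' fun x y => ?_) w) z
  simpa [mulTensor_tmul, mulTensor_tmul_right] using D.Eₗ_Eᵣ u v x y

lemma mulTensor_Δₗ (a : A) (w z : A ⊗[K] A) :
    D.mulTensor w (D.Δₗ a z) = D.mulTensor (D.Δᵣ a w) z := by
  refine DFunLike.congr_fun (f := D.mulTensor.compl₂ (D.Δₗ a) w)
    (g := (D.mulTensor ∘ₗ D.Δᵣ a) w) (eq_of_tmul (fun u v => TensorProduct.ext' fun x y => ?_) w) z
  simpa [mulTensor_tmul, mulTensor_tmul_right] using D.Δₗ_Δᵣ a u v x y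

lemma eq_of_mulTensor {z z' : A ⊗[K] A} (h : ∀ w, D.mulTensor w z = D.mulTensor w z') :
    z = z' :=
  D.eq_of_lTensor_mul fun v => D.eq_of_rTensor_mul fun u => by
    rw [← mulTensor_tmul, ← mulTensor_tmul, h]

lemma Δₗ_Eₗ (a : A) (z : A ⊗[K] A) : D.Δₗ a (D.Eₗ z) = D.Δₗ a z :=
  D.eq_of_mulTensor fun w => by rw [mulTensor_Δₗ, mulTensor_Eₗ, Eᵣ_Δᵣ, mulTensor_Δₗ]

lemma sliceRight_ε_Δₗ (d : A) (z : A ⊗[K] A) :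
    sliceRight D.ε (D.Δₗ d z) = D.mul d (sliceRight D.ε (D.Eₗ z)) := by
  rw [← Δₗ_Eₗ]
  obtain ⟨w, hw⟩ := D.exists_Eₗ_eq_T₄ z
  rw [hw, Δₗ_T₄]
  refine eq_of_tmul (f := sliceRight D.ε ∘ₗ D.T₄ ∘ₗ lTensor A (D.mul d))
    (g := D.mul d ∘ₗ sliceRight D.ε ∘ₗ D.T₄) (fun a b => ?_) w
  simp only [LinearMap.comp_apply, LinearMap.lTensor_tmul, counit_T₄, mul_assoc]

lemma sliceLeft_ε_Δₗ (d : A) (z : A ⊗[K] A) :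
    sliceLeft D.ε (D.Δₗ d z) = D.mul d (sliceLeft D.ε (D.Eₗ z)) := by
  simpa using D.cop.sliceRight_ε_Δₗ d (TensorProduct.comm K A A z)

lemma rTensor_T₃_comm {θ : A →ₗ[K] A} (h : ∀ z, rTensor A θ (D.T₁ z) = D.T₁ (rTensor A θ z))
    (z : A ⊗[K] A) : rTensor A θ (D.T₃ z) = D.T₃ (rTensor A θ z) := by
  refine eq_of_tmul (f := rTensor A θ ∘ₗ D.T₃) (g := D.T₃ ∘ₗ rTensor A θ)
    (fun a c => D.eq_of_lTensor_mul_flip fun b => ?_) z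
  simp only [LinearMap.comp_apply, LinearMap.rTensor_tmul]
  rw [← rTensor_lTensor_comm, ← T₁_T₃, rTensor_lTensor_comm, h, LinearMap.rTensor_tmul, T₁_T₃]

lemma rTensor_T₁_comm {θ : A →ₗ[K] A} (h : ∀ z, rTensor A θ (D.T₃ z) = D.T₃ (rTensor A θ z))
    (z : A ⊗[K] A) : rTensor A θ (D.T₁ z) = D.T₁ (rTensor A θ z) :=
  D.op.rTensor_T₃_comm h z

lemma lTensor_T₂_comm {θ : A →ₗ[K] A} (h : ∀ z, lTensor A θ (D.T₄ z) = D.T₄ (lTensor A θ z))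
    (z : A ⊗[K] A) : lTensor A θ (D.T₂ z) = D.T₂ (lTensor A θ z) := by
  have comm_cop_T₁ (w : A ⊗[K] A) :
      rTensor A θ (D.cop.T₁ w) = D.cop.T₁ (rTensor A θ w) := by
    simpa [LinearMap.rTensor_comm, LinearMap.lTensor_comm] using
      congrArg (TensorProduct.comm K A A) (h (TensorProduct.comm K A A w))
  simpa [LinearMap.rTensor_comm, LinearMap.lTensor_comm] using
    D.cop.rTensor_T₃_comm comm_cop_T₁ (TensorProduct.comm K A A z)

lemma Eᵣ_comm_T₁ : LegsCommute D.Eᵣ D.T₁ :=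
  legsCommute_iff_legRight.2 fun c ω =>
    D.rTensor_T₁_comm (legsCommute_iff_legRight.1 D.Eᵣ_comm_T₃ c ω)

lemma T₂_comm_T₃ : LegsCommute D.T₂ D.T₃ :=
  legsCommute_iff_legRight.2 fun c ω =>
    D.rTensor_T₃_comm (legsCommute_iff_legRight.1 D.T₂_comm_T₁ c ω)

lemma T₂_comm_Eₗ : LegsCommute D.T₂ D.Eₗ :=
  legsCommute_iff_legLeft.2 fun d ω =>
    D.lTensor_T₂_comm (legsCommute_iff_legLeft.1 D.T₄_comm_Eₗ d ω)

lemma lTensor_Eᵣ_comm {θ : A →ₗ[K] A} (h : ∀ a b, θ (D.mul a b) = D.mul (θ a) b)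
    (z : A ⊗[K] A) : lTensor A θ (D.Eᵣ z) = D.Eᵣ (lTensor A θ z) := by
  refine eq_of_tmul (f := lTensor A θ ∘ₗ D.Eᵣ) (g := D.Eᵣ ∘ₗ lTensor A θ) (fun u v => ?_) z
  refine LinearMap.congr_fun (f := lTensor A θ ∘ₗ D.Eᵣ ∘ₗ TensorProduct.mk K A A u)
    (g := D.Eᵣ ∘ₗ lTensor A θ ∘ₗ TensorProduct.mk K A A u) (D.ext_of_mul fun a b => ?_) v
  have tmul_mul : u ⊗ₜ[K] D.mul a b = lTensor A (D.mul a) (u ⊗ₜ b) := rfl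
  have comp_mul : θ ∘ₗ D.mul a = D.mul (θ a) := LinearMap.ext (h a)
  simp only [LinearMap.comp_apply, TensorProduct.mk_apply]
  rw [tmul_mul, Eᵣ_lTensor_mul, ← LinearMap.lTensor_comp_apply, ← LinearMap.lTensor_comp_apply,
    comp_mul, Eᵣ_lTensor_mul]

lemma legLeft_Eₗ_mul (d : A) (ω : A →ₗ[K] K) (a b : A) :
    legLeft D.Eₗ d ω (D.mul a b) = D.mul (legLeft D.Eₗ d ω a) b := by
  have mul_tmul : D.mul a b ⊗ₜ[K] d = rTensor A (D.mul.flip b) (a ⊗ₜ d) := rfl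
  rw [legLeft_apply, mul_tmul, Eₗ_rTensor_mul_flip, sliceRight_rTensor]
  rfl

lemma Eᵣ_comm_Eₗ : LegsCommute D.Eᵣ D.Eₗ :=
  legsCommute_iff_legLeft.2 fun d ω => D.lTensor_Eᵣ_comm (D.legLeft_Eₗ_mul d ω)

end Linearity

/-! ### Source maps and the antipode -/

section Source

lemma ε_comp_legRight_T₂ (u : A) (ω : A →ₗ[K] K) :
    D.ε ∘ₗ legRight D.T₂ u ω = ω ∘ₗ D.mul u :=
  LinearMap.ext fun a => by
    rw [LinearMap.comp_apply, legRight_apply, apply_sliceLeft, counit_T₂, LinearMap.comp_apply]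

lemma ε_comp_legLeft_T₁ (d : A) (ω : A →ₗ[K] K) :
    D.ε ∘ₗ legLeft D.T₁ d ω = ω ∘ₗ D.mul.flip d :=
  LinearMap.ext fun a => by
    rw [LinearMap.comp_apply, legLeft_apply, ← apply_sliceLeft, counit_T₁, LinearMap.comp_apply,
      LinearMap.flip_apply]

lemma sliceLeft_of_T₂_comm {X : A ⊗[K] A →ₗ[K] A ⊗[K] A} (hX : LegsCommute D.T₂ X) (u : A)
    (ω : A →ₗ[K] K) (z : A ⊗[K] A) :
    sliceLeft (ω ∘ₗ D.mul u) (X z) = sliceLeft D.ε (X (rTensor A (legRight D.T₂ u ω) z)) := by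
  rw [← ε_comp_legRight_T₂, ← sliceLeft_rTensor, legsCommute_iff_legRight.1 hX]

lemma eq_of_sliceLeft_ε {X Y : A ⊗[K] A →ₗ[K] A ⊗[K] A} (hX : LegsCommute D.T₂ X)
    (hY : LegsCommute D.T₂ Y)
    (h : ∀ a b, sliceLeft D.ε (X (a ⊗ₜ b)) = sliceLeft D.ε (Y (a ⊗ₜ b))) (z : A ⊗[K] A) :
    X z = Y z := by
  have slice_eq (z : A ⊗[K] A) : sliceLeft D.ε (X z) = sliceLeft D.ε (Y z) :=
    eq_of_tmul (f := sliceLeft D.ε ∘ₗ X) (g := sliceLeft D.ε ∘ₗ Y) h z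
  refine D.eq_of_rTensor_mul fun u => eq_of_sliceLeft fun ω => ?_
  rw [sliceLeft_rTensor, sliceLeft_rTensor, D.sliceLeft_of_T₂_comm hX,
    D.sliceLeft_of_T₂_comm hY, slice_eq]

/-- The map `c ⊗ b ↦ ε_s(c) b`. -/
def sourceMul : A ⊗[K] A →ₗ[K] A := sliceLeft D.ε ∘ₗ D.G₁

/-- The map `b ⊗ c ↦ b ε_t(c)`. -/
def mulTarget : A ⊗[K] A →ₗ[K] A := sliceRight D.ε ∘ₗ D.G₂

lemma sourceMul_apply (z : A ⊗[K] A) : D.sourceMul z = sliceLeft D.ε (D.G₁ z) := rfl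

lemma mulTarget_apply (z : A ⊗[K] A) : D.mulTarget z = sliceRight D.ε (D.G₂ z) := rfl

@[simp] lemma sourceMul_op_cop (z : A ⊗[K] A) :
    D.op.cop.sourceMul z = D.mulTarget (TensorProduct.comm K A A z) := by
  simp [sourceMul_apply, mulTarget_apply]

lemma sourceMul_legLeft_T₁ (b c d : A) (ω : A →ₗ[K] K) :
    D.sourceMul (legLeft D.T₁ d ω c ⊗ₜ b) = sliceRight (ω ∘ₗ D.mul c) (D.Eₗ (b ⊗ₜ d)) := by
  refine Module.eval_apply_injective K (LinearMap.ext fun μ => ?_)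
  have h := congrArg (fun z => ω (sliceLeft D.ε z)) (D.rTensor_legLeft_G₁_T₁ b μ (c ⊗ₜ d))
  simp only [LinearMap.lTensor_tmul, counit_T₁] at h
  rw [sliceLeft_rTensor, apply_sliceLeft, ← legLeft_apply, LinearMap.comp_apply, legLeft_apply,
    ← apply_sliceLeft] at h
  rw [Module.Dual.eval_apply, Module.Dual.eval_apply, sourceMul_apply, h, legRight_apply,
    ← apply_sliceLeft]
  rfl

lemma mul_sourceMul (u c a : A) :
    D.mul u (D.sourceMul (c ⊗ₜ a)) = D.mul (sliceRight D.ε (D.Eᵣ (u ⊗ₜ c))) a := by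
  refine LinearMap.congr_fun (f := D.mul u ∘ₗ D.sourceMul ∘ₗ (TensorProduct.mk K A A).flip a)
    (g := D.mul.flip a ∘ₗ sliceRight D.ε ∘ₗ D.Eᵣ ∘ₗ TensorProduct.mk K A A u)
    (D.ext_of_legLeft_T₁ fun c d ω => ?_) c
  simp only [LinearMap.comp_apply, LinearMap.flip_apply, TensorProduct.mk_apply]
  rw [sourceMul_legLeft_T₁, ← LinearMap.lTensor_tmul,
    ← legsCommute_iff_legLeft.1 D.Eᵣ_comm_T₁, sliceRight_lTensor, ε_comp_legLeft_T₁,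
    ← sliceRight_lTensor, ← sliceRight_lTensor]
  simpa only [sliceRight_rTensor, LinearMap.flip_apply] using
    congrArg (sliceRight ω) (D.Eₗ_Eᵣ u c a d)

lemma mulTarget_mul (a c u : A) :
    D.mul (D.mulTarget (a ⊗ₜ c)) u = D.mul a (sliceLeft D.ε (D.Eₗ (c ⊗ₜ u))) := by
  simpa using D.op.cop.mul_sourceMul u c a

lemma G₁_rTensor_of_T₁ {θ : A →ₗ[K] A} (h : ∀ z, rTensor A θ (D.T₁ z) = D.T₁ (rTensor A θ z))
    (z : A ⊗[K] A) : rTensor A θ (D.G₁ z) = D.G₁ (rTensor A θ z) := by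
  refine eq_of_tmul (f := rTensor A θ ∘ₗ D.G₁) (g := D.G₁ ∘ₗ rTensor A θ)
    (fun a b => eq_of_sliceRight fun μ => ?_) z
  simp only [LinearMap.comp_apply, sliceRight_rTensor]
  refine LinearMap.congr_fun (f := θ ∘ₗ legLeft D.G₁ b μ) (g := legLeft D.G₁ b μ ∘ₗ θ)
    (D.ext_of_rTensor_T₁ fun z => ?_) a
  rw [LinearMap.rTensor_comp_apply, LinearMap.rTensor_comp_apply, rTensor_legLeft_G₁_T₁, h, h,
    rTensor_legLeft_G₁_T₁, rTensor_lTensor_comm]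

/-- The map `d ↦ (ι ⊗ ω) T₁(c ⊗ d)`; by fullness, these maps together span `A`. -/
def sliceT₁ (c : A) (ω : A →ₗ[K] K) : A →ₗ[K] A :=
  sliceRight ω ∘ₗ D.T₁ ∘ₗ TensorProduct.mk K A A c

lemma sliceT₁_apply (c d : A) (ω : A →ₗ[K] K) :
    D.sliceT₁ c ω d = sliceRight ω (D.T₁ (c ⊗ₜ d)) := rfl

lemma ext_of_sliceT₁ {f g : A ⊗[K] A →ₗ[K] W}
    (h : ∀ c ω b d, f (D.sliceT₁ c ω d ⊗ₜ b) = g (D.sliceT₁ c ω d ⊗ₜ b)) : f = g :=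
  TensorProduct.ext' fun a b => LinearMap.congr_fun (f := f ∘ₗ (TensorProduct.mk K A A).flip b)
    (g := g ∘ₗ (TensorProduct.mk K A A).flip b)
    (D.ext_of_legLeft_T₁ fun c d ω => h c ω b d) a

lemma G₁_rTensor_sliceT₁ (c : A) (ω : A →ₗ[K] K) (z : A ⊗[K] A) :
    D.G₁ (rTensor A (D.sliceT₁ c ω) (TensorProduct.comm K A A z)) =
      rTensor A (D.sliceT₁ c ω) (TensorProduct.comm K A A (D.Eₗ z)) := by
  refine eq_of_tmul
    (f := D.G₁ ∘ₗ rTensor A (D.sliceT₁ c ω) ∘ₗ (TensorProduct.comm K A A).toLinearMap)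
    (g := rTensor A (D.sliceT₁ c ω) ∘ₗ (TensorProduct.comm K A A).toLinearMap ∘ₗ D.Eₗ)
    (fun b d => eq_of_sliceRight fun μ => ?_) z
  have h := congrArg (sliceRight ω) (D.rTensor_legLeft_G₁_T₁ b μ (c ⊗ₜ d))
  rw [sliceRight_rTensor, LinearMap.lTensor_tmul, legRight_apply] at h
  simp only [LinearMap.comp_apply, LinearEquiv.coe_coe, TensorProduct.comm_tmul,
    LinearMap.rTensor_tmul, sliceRight_rTensor, sliceRight_comm]
  exact h

lemma G₁_sliceT₁_tmul (c d b : A) (ω : A →ₗ[K] K) :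
    D.G₁ (D.sliceT₁ c ω d ⊗ₜ b) =
      rTensor A (D.sliceT₁ c ω) (TensorProduct.comm K A A (D.Eₗ (b ⊗ₜ d))) :=
  D.G₁_rTensor_sliceT₁ c ω (b ⊗ₜ d)

lemma G₁_G₁ (z : A ⊗[K] A) : D.G₁ (D.G₁ z) = D.G₁ z :=
  LinearMap.congr_fun (f := D.G₁ ∘ₗ D.G₁) (D.ext_of_sliceT₁ fun c ω b d => by
    rw [LinearMap.comp_apply, G₁_sliceT₁_tmul, G₁_rTensor_sliceT₁, Eₗ_Eₗ]) z

lemma G₁_eq_of_T₁_eq {z z' : A ⊗[K] A} (h : D.T₁ z = D.T₁ z') : D.G₁ z = D.G₁ z' := by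
  obtain ⟨w, hw⟩ : z - z' ∈ LinearMap.range (LinearMap.id - D.G₁) :=
    D.t₁Axioms.ker_T₁ ▸ LinearMap.sub_mem_ker_iff.2 h
  rw [← sub_eq_zero, ← map_sub, ← hw, LinearMap.sub_apply, LinearMap.id_apply, map_sub, G₁_G₁,
    sub_self]

lemma G₁_rTensor_mul (d : A) (z : A ⊗[K] A) :
    D.G₁ (rTensor A (D.mul d) z) = rTensor A (D.mul d) (D.G₁ z) := by
  refine eq_of_tmul (f := D.G₁ ∘ₗ rTensor A (D.mul d)) (g := rTensor A (D.mul d) ∘ₗ D.G₁)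
    (fun a b => eq_of_sliceRight fun μ => ?_) z
  simp only [LinearMap.comp_apply, sliceRight_rTensor]
  refine LinearMap.congr_fun (f := legLeft D.G₁ b μ ∘ₗ D.mul d) (g := D.mul d ∘ₗ legLeft D.G₁ b μ)
    (D.ext_of_mul fun a x => ?_) a
  simp only [LinearMap.comp_apply]
  obtain ⟨w, hw⟩ := D.exists_Eₗ_eq_T₁ (D.T₄ (x ⊗ₜ a))
  rw [Eₗ_T₄] at hw
  have mul_eq : D.mul a x = sliceRight D.ε (D.T₁ w) := by rw [← hw, counit_T₄]
  have mul_mul_eq : D.mul d (D.mul a x) = sliceRight D.ε (D.Δₗ d (D.T₁ w)) := by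
    rw [← hw, Δₗ_T₄, LinearMap.lTensor_tmul, counit_T₄, mul_assoc]
  rw [mul_mul_eq, mul_eq, ← sliceRight_rTensor, ← sliceRight_rTensor, Δₗ_T₁,
    rTensor_legLeft_G₁_T₁, rTensor_legLeft_G₁_T₁, ← rTensor_lTensor_comm, ← Δₗ_T₁,
    sliceRight_ε_Δₗ, Eₗ_T₁]

lemma sliceLeft_ε_T₄ (x c : A) : sliceLeft D.ε (D.T₄ (x ⊗ₜ c)) = D.mulTarget (c ⊗ₜ x) := by
  refine D.eq_of_mul_right fun u => ?_
  rw [mulTarget_mul, ← sliceLeft_ε_Δₗ, ← Δₗ_eq_T₄, sliceLeft_lTensor, LinearMap.flip_apply]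

lemma ε_mulTarget (c x : A) : D.ε (D.mulTarget (c ⊗ₜ x)) = D.ε (D.mul c x) := by
  rw [← sliceLeft_ε_T₄, apply_sliceLeft, counit_T₄]

lemma ε_sourceMul (c x : A) : D.ε (D.sourceMul (c ⊗ₜ x)) = D.ε (D.mul c x) := by
  simpa [mulTarget_apply, sourceMul_apply] using D.op.cop.ε_mulTarget x c

end Source

section GeneralizedInverse

lemma exists_R₁ : ∃ R : A ⊗[K] A →ₗ[K] A ⊗[K] A, (∀ z, D.T₁ (R z) = D.Eₗ z) ∧
    (∀ z, R (D.T₁ z) = D.G₁ z) ∧ ∀ z, D.G₁ (R z) = R z := by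
  obtain ⟨g, hg⟩ := LinearMap.exists_rightInverse_of_surjective D.T₁.rangeRestrict
    D.T₁.range_rangeRestrict
  have Eₗ_mem (z : A ⊗[K] A) : D.Eₗ z ∈ LinearMap.range D.T₁ := D.t₁Axioms.range_T₁ ▸ ⟨z, rfl⟩
  let lift := g ∘ₗ D.Eₗ.codRestrict _ Eₗ_mem
  have T₁_lift (z : A ⊗[K] A) : D.T₁ (lift z) = D.Eₗ z :=
    congrArg Subtype.val (LinearMap.congr_fun hg (D.Eₗ.codRestrict _ Eₗ_mem z))
  refine ⟨D.G₁ ∘ₗ lift, fun z => ?_, fun z => ?_, fun z => D.G₁_G₁ _⟩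
  · rw [LinearMap.comp_apply, T₁_G₁, T₁_lift]
  · exact D.G₁_eq_of_T₁_eq (by rw [T₁_lift, Eₗ_T₁])

/-- The generalized inverse of `T₁` with `R₁ T₁ = G₁` and `T₁ R₁ = E`. -/
def R₁ : A ⊗[K] A →ₗ[K] A ⊗[K] A := D.exists_R₁.choose

lemma T₁_R₁ (z : A ⊗[K] A) : D.T₁ (D.R₁ z) = D.Eₗ z := D.exists_R₁.choose_spec.1 z

lemma R₁_T₁ (z : A ⊗[K] A) : D.R₁ (D.T₁ z) = D.G₁ z := D.exists_R₁.choose_spec.2.1 z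

lemma G₁_R₁ (z : A ⊗[K] A) : D.G₁ (D.R₁ z) = D.R₁ z := D.exists_R₁.choose_spec.2.2 z

lemma R₁_eq {y z : A ⊗[K] A} (hT : D.T₁ y = D.Eₗ z) (hG : D.G₁ y = y) : D.R₁ z = y := by
  rw [← hG, ← G₁_R₁]
  exact D.G₁_eq_of_T₁_eq (by rw [T₁_R₁, hT])

lemma R₁_Eₗ (z : A ⊗[K] A) : D.R₁ (D.Eₗ z) = D.R₁ z :=
  D.R₁_eq (by rw [T₁_R₁, Eₗ_Eₗ]) (D.G₁_R₁ z)

/-- The generalized inverse of `T₂` with `R₂ T₂ = G₂` and `T₂ R₂ = (· E)`. -/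
def R₂ : A ⊗[K] A →ₗ[K] A ⊗[K] A := flipConj D.op.cop.R₁

lemma R₁_op_cop : D.op.cop.R₁ = flipConj D.R₂ := (flipConj_flipConj _).symm

lemma T₂_R₂ (z : A ⊗[K] A) : D.T₂ (D.R₂ z) = D.Eᵣ z := by
  simpa [R₁_op_cop] using
    congrArg (TensorProduct.comm K A A) (D.op.cop.T₁_R₁ (TensorProduct.comm K A A z))

lemma R₂_T₂ (z : A ⊗[K] A) : D.R₂ (D.T₂ z) = D.G₂ z := by
  simpa [R₁_op_cop] using
    congrArg (TensorProduct.comm K A A) (D.op.cop.R₁_T₁ (TensorProduct.comm K A A z))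

lemma G₂_R₂ (z : A ⊗[K] A) : D.G₂ (D.R₂ z) = D.R₂ z := by
  simpa [R₁_op_cop] using
    congrArg (TensorProduct.comm K A A) (D.op.cop.G₁_R₁ (TensorProduct.comm K A A z))

lemma R₂_Eᵣ (z : A ⊗[K] A) : D.R₂ (D.Eᵣ z) = D.R₂ z := by
  simpa [R₁_op_cop] using
    congrArg (TensorProduct.comm K A A) (D.op.cop.R₁_Eₗ (TensorProduct.comm K A A z))

lemma R₁_rTensor_of_T₁ {θ : A →ₗ[K] A} (hT : ∀ z, rTensor A θ (D.T₁ z) = D.T₁ (rTensor A θ z))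
    (hE : ∀ z, rTensor A θ (D.Eₗ z) = D.Eₗ (rTensor A θ z)) (z : A ⊗[K] A) :
    rTensor A θ (D.R₁ z) = D.R₁ (rTensor A θ z) :=
  (D.R₁_eq (by rw [← hT, T₁_R₁, hE]) (by rw [← D.G₁_rTensor_of_T₁ hT, G₁_R₁])).symm

lemma legsCommute_R₁ {X : A ⊗[K] A →ₗ[K] A ⊗[K] A} (hT : LegsCommute X D.T₁)
    (hE : LegsCommute X D.Eₗ) : LegsCommute X D.R₁ :=
  legsCommute_iff_legRight.2 fun c ω => D.R₁_rTensor_of_T₁ (legsCommute_iff_legRight.1 hT c ω)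
    (legsCommute_iff_legRight.1 hE c ω)

lemma R₂_legsCommute {Y : A ⊗[K] A →ₗ[K] A ⊗[K] A} (hT : LegsCommute D.T₂ Y)
    (hE : LegsCommute D.Eᵣ Y) : LegsCommute D.R₂ Y := by
  simpa [R₁_op_cop] using (D.op.cop.legsCommute_R₁ hT.flipConj hE.flipConj).flipConj

lemma T₂_comm_R₁ : LegsCommute D.T₂ D.R₁ := D.legsCommute_R₁ D.T₂_comm_T₁ D.T₂_comm_Eₗ

lemma R₂_comm_R₁ : LegsCommute D.R₂ D.R₁ :=
  D.legsCommute_R₁ (D.R₂_legsCommute D.T₂_comm_T₁ D.Eᵣ_comm_T₁)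
    (D.R₂_legsCommute D.T₂_comm_Eₗ D.Eᵣ_comm_Eₗ)

lemma R₁_Δₗ (d : A) (z : A ⊗[K] A) : D.R₁ (D.Δₗ d z) = rTensor A (D.mul d) (D.R₁ z) :=
  D.R₁_eq (by rw [← Δₗ_T₁, T₁_R₁, Δₗ_Eₗ, Eₗ_Δₗ]) (by rw [G₁_rTensor_mul, G₁_R₁])

end GeneralizedInverse

section AntipodeMul

/-- The map `a ⊗ b ↦ S(a) b`. -/
def antipodeMul : A ⊗[K] A →ₗ[K] A := sliceLeft D.ε ∘ₗ D.R₁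

/-- The map `b ⊗ a ↦ b S(a)`. -/
def mulAntipode : A ⊗[K] A →ₗ[K] A := sliceRight D.ε ∘ₗ D.R₂

lemma antipodeMul_apply (z : A ⊗[K] A) : D.antipodeMul z = sliceLeft D.ε (D.R₁ z) := rfl

lemma mulAntipode_apply (z : A ⊗[K] A) : D.mulAntipode z = sliceRight D.ε (D.R₂ z) := rfl

@[simp] lemma antipodeMul_op_cop (z : A ⊗[K] A) :
    D.op.cop.antipodeMul z = D.mulAntipode (TensorProduct.comm K A A z) := by
  simp [antipodeMul_apply, mulAntipode_apply, R₁_op_cop]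

lemma sourceMul_R₁ (z : A ⊗[K] A) : D.sourceMul (D.R₁ z) = D.antipodeMul z := by
  rw [sourceMul_apply, G₁_R₁, antipodeMul_apply]

lemma antipodeMul_T₁ (z : A ⊗[K] A) : D.antipodeMul (D.T₁ z) = D.sourceMul z := by
  rw [antipodeMul_apply, R₁_T₁, sourceMul_apply]

lemma mulAntipode_Eᵣ (z : A ⊗[K] A) : D.mulAntipode (D.Eᵣ z) = D.mulAntipode z := by
  rw [mulAntipode_apply, R₂_Eᵣ, mulAntipode_apply]

lemma antipodeMul_Eₗ (z : A ⊗[K] A) : D.antipodeMul (D.Eₗ z) = D.antipodeMul z := by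
  rw [antipodeMul_apply, R₁_Eₗ, antipodeMul_apply]

lemma lift_mul_R₁ (z : A ⊗[K] A) :
    TensorProduct.lift D.mul (D.R₁ z) = sliceLeft D.ε (D.Eₗ z) := by
  rw [← T₁_R₁]
  exact eq_of_tmul (f := TensorProduct.lift D.mul) (g := sliceLeft D.ε ∘ₗ D.T₁)
    (fun a b => (D.counit_T₁ a b).symm) _

lemma lift_mul_R₂ (z : A ⊗[K] A) :
    TensorProduct.lift D.mul (D.R₂ z) = sliceRight D.ε (D.Eᵣ z) := by
  rw [← T₂_R₂]
  exact eq_of_tmul (f := TensorProduct.lift D.mul) (g := sliceRight D.ε ∘ₗ D.T₂)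
    (fun a b => (D.counit_T₂ a b).symm) _

/-- The product map `a ⊗ (b ⊗ c) ↦ a b c`. -/
def mulTriple : A ⊗[K] (A ⊗[K] A) →ₗ[K] A :=
  TensorProduct.lift D.mul ∘ₗ lTensor A (TensorProduct.lift D.mul)

lemma mulTriple_assoc_tmul (w : A ⊗[K] A) (b : A) :
    D.mulTriple (TensorProduct.assoc K A A A (w ⊗ₜ b)) = D.mul (TensorProduct.lift D.mul w) b :=
  eq_of_tmul (f := D.mulTriple ∘ₗ (TensorProduct.assoc K A A A).toLinearMap ∘ₗ
    (TensorProduct.mk K (A ⊗[K] A) A).flip b) (g := D.mul.flip b ∘ₗ TensorProduct.lift D.mul)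
    (fun _ _ => by simp [mulTriple, D.mul_assoc]) w

lemma mulTriple_onFirstTwo_R₂ (c : A) (z : A ⊗[K] A) :
    D.mulTriple (onFirstTwo A D.R₂ (c ⊗ₜ z)) = D.mul c (D.sourceMul z) :=
  eq_of_tmul (f := D.mulTriple ∘ₗ onFirstTwo A D.R₂ ∘ₗ TensorProduct.mk K A (A ⊗[K] A) c)
    (g := D.mul c ∘ₗ D.sourceMul) (fun p q => by
      rw [LinearMap.comp_apply (g := D.sourceMul), mul_sourceMul, ← lift_mul_R₂]
      exact D.mulTriple_assoc_tmul (D.R₂ (c ⊗ₜ p)) q) z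

lemma mulTriple_lTensor_R₁ (b : A) (z : A ⊗[K] A) :
    D.mulTriple (lTensor A D.R₁ (TensorProduct.assoc K A A A (z ⊗ₜ b))) =
      D.mul (D.mulTarget z) b :=
  eq_of_tmul (f := D.mulTriple ∘ₗ lTensor A D.R₁ ∘ₗ (TensorProduct.assoc K A A A).toLinearMap ∘ₗ
    (TensorProduct.mk K (A ⊗[K] A) A).flip b) (g := D.mul.flip b ∘ₗ D.mulTarget) (fun p q => by
      simp only [mulTriple, LinearMap.comp_apply, LinearMap.flip_apply, TensorProduct.mk_apply,
        mulTarget_mul, LinearEquiv.coe_coe, TensorProduct.assoc_tmul, LinearMap.lTensor_tmul,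
        lift_mul_R₁, TensorProduct.lift.tmul]) z

/- Both sides are the product of `R₂₁₂ R₁₂₃ (c ⊗ a ⊗ b)`, which is
`c S(a₍₁₎) ⊗ a₍₂₎ ⊗ S(a₍₃₎) b`. -/
lemma mul_antipodeMul (c a b : A) :
    D.mul c (D.antipodeMul (a ⊗ₜ b)) = D.mul (D.mulAntipode (c ⊗ₜ a)) b := by
  have h : onFirstTwo A D.R₂ (c ⊗ₜ D.R₁ (a ⊗ₜ b)) =
      lTensor A D.R₁ (TensorProduct.assoc K A A A (D.R₂ (c ⊗ₜ a) ⊗ₜ b)) :=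
    D.R₂_comm_R₁ c (a ⊗ₜ b)
  rw [← sourceMul_R₁, ← mulTriple_onFirstTwo_R₂, h, mulTriple_lTensor_R₁, mulTarget_apply, G₂_R₂,
    mulAntipode_apply]

/-- The left multiplication by `ε_s(c)`, as a function of `c`. -/
def sourceLeft : A →ₗ[K] A →ₗ[K] A := TensorProduct.curry D.sourceMul

lemma sourceLeft_apply (c a : A) : D.sourceLeft c a = D.sourceMul (c ⊗ₜ a) := rfl

lemma sourceLeft_legLeft_T₁ (c d : A) (ω : A →ₗ[K] K) :
    D.sourceLeft (legLeft D.T₁ d ω c) = legLeft D.Eₗ d (ω ∘ₗ D.mul c) :=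
  LinearMap.ext fun b => D.sourceMul_legLeft_T₁ b c d ω

lemma eq_of_sourceLeft {f g : (A →ₗ[K] A) →ₗ[K] W}
    (h : ∀ a d ω, f (legLeft D.Eₗ d (ω ∘ₗ D.mul a)) = g (legLeft D.Eₗ d (ω ∘ₗ D.mul a))) (c : A) :
    f (D.sourceLeft c) = g (D.sourceLeft c) :=
  LinearMap.congr_fun (f := f ∘ₗ D.sourceLeft) (g := g ∘ₗ D.sourceLeft)
    (D.ext_of_legLeft_T₁ fun c d ω => by
      rw [LinearMap.comp_apply, LinearMap.comp_apply, sourceLeft_legLeft_T₁, h]) c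

lemma T₁_rTensor_sourceLeft (c : A) (z : A ⊗[K] A) :
    D.T₁ (rTensor A (D.sourceLeft c) z) = lTensor A (D.sourceLeft c) (D.T₁ z) :=
  D.eq_of_sourceLeft (f := D.T₁ ∘ₗ LinearMap.applyₗ z ∘ₗ LinearMap.rTensorHom A)
    (g := LinearMap.applyₗ (D.T₁ z) ∘ₗ LinearMap.lTensorHom A)
    (fun _ d _ => D.T₁_rTensor_legLeft_Eₗ d _ z) c

lemma Eₗ_lTensor_sourceLeft (c : A) (z : A ⊗[K] A) :
    D.Eₗ (lTensor A (D.sourceLeft c) z) = lTensor A (D.sourceLeft c) (D.Eₗ z) :=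
  D.eq_of_sourceLeft (f := D.Eₗ ∘ₗ LinearMap.applyₗ z ∘ₗ LinearMap.lTensorHom A)
    (g := LinearMap.applyₗ (D.Eₗ z) ∘ₗ LinearMap.lTensorHom A)
    (fun _ d _ => (legsCommute_iff_legLeft.1 D.Eₗ_comm_Eₗ d _ z).symm) c

lemma G₁_rTensor_sourceLeft (c : A) (z : A ⊗[K] A) :
    D.G₁ (rTensor A (D.sourceLeft c) z) = rTensor A (D.sourceLeft c) (D.G₁ z) := by
  refine D.eq_of_rTensor_mul fun u => ?_
  have mul_comp : D.mul u ∘ₗ D.sourceLeft c = D.mul (sliceRight D.ε (D.Eᵣ (u ⊗ₜ c))) :=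
    LinearMap.ext fun a => D.mul_sourceMul u c a
  rw [← G₁_rTensor_mul, ← LinearMap.rTensor_comp_apply, ← LinearMap.rTensor_comp_apply, mul_comp,
    G₁_rTensor_mul]

lemma R₁_lTensor_sourceLeft (c : A) (z : A ⊗[K] A) :
    D.R₁ (lTensor A (D.sourceLeft c) z) = rTensor A (D.sourceLeft c) (D.R₁ z) :=
  D.R₁_eq (by rw [T₁_rTensor_sourceLeft, T₁_R₁, Eₗ_lTensor_sourceLeft])
    (by rw [G₁_rTensor_sourceLeft, G₁_R₁])

lemma antipodeMul_mul_tmul (c a b : A) :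
    D.antipodeMul (D.mul c a ⊗ₜ b) = D.antipodeMul (a ⊗ₜ D.antipodeMul (c ⊗ₜ b)) := by
  have Eₗ_tmul : D.Eₗ (D.mul c a ⊗ₜ b) = rTensor A (D.mul.flip a) (D.T₁ (D.R₁ (c ⊗ₜ b))) := by
    rw [T₁_R₁, ← Eₗ_rTensor_mul_flip]; rfl
  rw [← antipodeMul_Eₗ, Eₗ_tmul, ← sourceMul_R₁ D (c ⊗ₜ b)]
  refine eq_of_tmul (f := D.antipodeMul ∘ₗ rTensor A (D.mul.flip a) ∘ₗ D.T₁)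
    (g := D.antipodeMul ∘ₗ TensorProduct.mk K A A a ∘ₗ D.sourceMul) (fun p q => ?_)
    (D.R₁ (c ⊗ₜ b))
  have ε_comp : D.ε ∘ₗ D.mul p = D.ε ∘ₗ D.sourceLeft p :=
    LinearMap.ext fun x => (D.ε_sourceMul p x).symm
  simp only [LinearMap.comp_apply, TensorProduct.mk_apply]
  rw [Δₗ_eq_T₁, antipodeMul_apply, R₁_Δₗ, sliceLeft_rTensor, ε_comp, ← sliceLeft_rTensor,
    ← R₁_lTensor_sourceLeft]
  rfl

end AntipodeMul

section AntipodeExists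

lemma range_sourceMul : LinearMap.range D.sourceMul = ⊤ := by
  let q := (LinearMap.range D.sourceMul).mkQ
  have rTensor_q_Eₗ (b d : A) : rTensor A q (D.Eₗ (b ⊗ₜ d)) = 0 :=
    D.eq_of_lTensor_mul fun c => eq_of_sliceRight fun ω => by
      rw [map_zero, map_zero, sliceRight_lTensor, sliceRight_rTensor, ← sourceMul_legLeft_T₁]
      exact (Submodule.Quotient.mk_eq_zero _).2 ⟨_, rfl⟩
  have q_eq_zero : q = 0 := D.ext_of_rTensor_T₁ fun z => by
    rw [← Eₗ_T₁, LinearMap.rTensor_zero]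
    exact eq_of_tmul (f := rTensor A q ∘ₗ D.Eₗ) (g := 0) rTensor_q_Eₗ _
  rw [← Submodule.ker_mkQ (LinearMap.range D.sourceMul), show Submodule.mkQ _ = 0 from q_eq_zero,
    LinearMap.ker_zero]

lemma antipodeMul_surjective : Function.Surjective D.antipodeMul := fun x => by
  obtain ⟨z, rfl⟩ := LinearMap.range_eq_top.1 D.range_sourceMul x
  exact ⟨D.T₁ z, D.antipodeMul_T₁ z⟩

lemma ext_of_antipodeMul {f g : A →ₗ[K] W}
    (h : ∀ a b, f (D.antipodeMul (a ⊗ₜ b)) = g (D.antipodeMul (a ⊗ₜ b))) : f = g :=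
  (LinearMap.cancel_right D.antipodeMul_surjective).1 <| TensorProduct.ext' h

lemma ext_of_mulAntipode {f g : A →ₗ[K] W}
    (h : ∀ a b, f (D.mulAntipode (a ⊗ₜ b)) = g (D.mulAntipode (a ⊗ₜ b))) : f = g :=
  D.op.cop.ext_of_antipodeMul fun a b => by simpa using h b a

/-- The map `b ↦ S(b) c`. -/
def antipodeMulBy (c : A) : A →ₗ[K] A := D.antipodeMul ∘ₗ (TensorProduct.mk K A A).flip c

/-- The map `b ↦ c S(b)`. -/
def mulAntipodeBy (c : A) : A →ₗ[K] A := D.mulAntipode ∘ₗ TensorProduct.mk K A A c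

lemma antipodeMulBy_apply (c b : A) : D.antipodeMulBy c b = D.antipodeMul (b ⊗ₜ c) := rfl

@[simp] lemma antipodeMulBy_op_cop (c : A) : D.op.cop.antipodeMulBy c = D.mulAntipodeBy c :=
  LinearMap.ext fun b => by
    rw [antipodeMulBy_apply, antipodeMul_op_cop]; rfl

lemma antipodeMulBy_mul (a b c : A) :
    D.antipodeMulBy c (D.mul b a) = D.antipodeMulBy (D.antipodeMulBy c b) a :=
  D.antipodeMul_mul_tmul b a c

lemma mul_antipodeMulBy (c a b : A) :
    D.mul c (D.antipodeMulBy b a) = D.mul (D.mulAntipodeBy c a) b :=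
  D.mul_antipodeMul c a b

lemma R₁_lTensor_antipodeMulBy (c : A) (z : A ⊗[K] A) :
    D.R₁ (lTensor A (D.antipodeMulBy c) z) = lTensor A (D.antipodeMulBy c) (D.T₃ z) := by
  refine D.eq_of_sliceLeft_ε (X := D.R₁ ∘ₗ lTensor A (D.antipodeMulBy c))
    (Y := lTensor A (D.antipodeMulBy c) ∘ₗ D.T₃) (legsCommute_iff_legRight.2 fun d ω z => ?_)
    (legsCommute_iff_legRight.2 fun d ω z => ?_) (fun a b => ?_) z
  · rw [LinearMap.comp_apply, LinearMap.comp_apply, legsCommute_iff_legRight.1 D.T₂_comm_R₁,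
      rTensor_lTensor_comm]
  · rw [LinearMap.comp_apply, LinearMap.comp_apply, rTensor_lTensor_comm,
      legsCommute_iff_legRight.1 D.T₂_comm_T₃]
  · rw [LinearMap.comp_apply, LinearMap.comp_apply, sliceLeft_lTensor, counit_T₃,
      LinearMap.lTensor_tmul, ← antipodeMul_apply, antipodeMulBy_mul]
    rfl

lemma lTensor_antipodeMulBy_T₂ (c a b : A) :
    lTensor A (D.antipodeMulBy c) (D.T₂ (a ⊗ₜ b)) = rTensor A (D.mul a) (D.R₁ (b ⊗ₜ c)) := by
  refine eq_of_sliceLeft fun ω => ?_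
  rw [sliceLeft_lTensor, sliceLeft_rTensor, D.sliceLeft_of_T₂_comm D.T₂_comm_R₁]
  rfl

lemma G₁_lTensor_antipodeMulBy_Eᵣ (c : A) (z : A ⊗[K] A) :
    D.G₁ (lTensor A (D.antipodeMulBy c) (D.Eᵣ z)) = lTensor A (D.antipodeMulBy c) (D.Eᵣ z) := by
  obtain ⟨w, hw⟩ := D.exists_Eᵣ_eq_T₂ z
  rw [hw]
  refine eq_of_tmul (f := D.G₁ ∘ₗ lTensor A (D.antipodeMulBy c) ∘ₗ D.T₂)
    (g := lTensor A (D.antipodeMulBy c) ∘ₗ D.T₂) (fun a b => ?_) w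
  rw [LinearMap.comp_apply, LinearMap.comp_apply, lTensor_antipodeMulBy_T₂, G₁_rTensor_mul, G₁_R₁]

lemma T₁_lTensor_antipodeMulBy_Eᵣ (c : A) (z : A ⊗[K] A) :
    D.T₁ (lTensor A (D.antipodeMulBy c) (D.Eᵣ z)) = D.T₁ (lTensor A (D.antipodeMulBy c) z) := by
  refine D.eq_of_lTensor_mul fun u => eq_of_sliceLeft fun μ => ?_
  let t : A →ₗ[K] A := sliceLeft μ ∘ₗ D.T₃ ∘ₗ (TensorProduct.mk K A A).flip u
  have slice_eq (z : A ⊗[K] A) :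
      sliceLeft μ (lTensor A (D.mul u) (D.T₁ (lTensor A (D.antipodeMulBy c) z))) =
        D.mul (D.mulAntipode (rTensor A t z)) c := by
    refine eq_of_tmul
      (f := sliceLeft μ ∘ₗ lTensor A (D.mul u) ∘ₗ D.T₁ ∘ₗ lTensor A (D.antipodeMulBy c))
      (g := D.mul.flip c ∘ₗ D.mulAntipode ∘ₗ rTensor A t) (fun a v => ?_) z
    simp only [LinearMap.comp_apply, LinearMap.lTensor_tmul]
    rw [T₁_T₃, sliceLeft_lTensor, LinearMap.flip_apply, mul_antipodeMulBy]
    rfl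
  have Eᵣ_comm (z : A ⊗[K] A) : rTensor A t (D.Eᵣ z) = D.Eᵣ (rTensor A t z) := by
    refine eq_of_tmul (f := rTensor A t ∘ₗ D.Eᵣ) (g := D.Eᵣ ∘ₗ rTensor A t)
      (fun a d => eq_of_sliceRight fun ω => ?_) z
    have h := congrArg (sliceLeft μ) (D.op.T₁_rTensor_legLeft_Eₗ d ω (a ⊗ₜ u))
    rw [sliceLeft_lTensor] at h
    rw [LinearMap.comp_apply, sliceRight_rTensor]
    exact h
  rw [slice_eq, slice_eq, Eᵣ_comm, mulAntipode_Eᵣ]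

lemma G₁_lTensor_antipodeMulBy (c : A) (z : A ⊗[K] A) :
    D.G₁ (lTensor A (D.antipodeMulBy c) z) = lTensor A (D.antipodeMulBy c) (D.Eᵣ z) := by
  rw [← G₁_lTensor_antipodeMulBy_Eᵣ]
  exact D.G₁_eq_of_T₁_eq (D.T₁_lTensor_antipodeMulBy_Eᵣ c z).symm

lemma G₂_rTensor_mulAntipodeBy (c : A) (z : A ⊗[K] A) :
    D.G₂ (rTensor A (D.mulAntipodeBy c) z) = rTensor A (D.mulAntipodeBy c) (D.Eₗ z) := by
  simpa [LinearMap.rTensor_comm, LinearMap.lTensor_comm] using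
    congrArg (TensorProduct.comm K A A)
      (D.op.cop.G₁_lTensor_antipodeMulBy c (TensorProduct.comm K A A z))

lemma G₂_mulAntipodeBy (c b d y v₀ b₀ : A) :
    rTensor A (D.mul.flip (D.antipodeMulBy c b))
        (lTensor A (D.mul d) (D.G₂ (D.mulAntipodeBy v₀ b₀ ⊗ₜ y))) =
      rTensor A (D.mul (D.mulAntipodeBy v₀ b₀) ∘ₗ D.antipodeMulBy c)
        (lTensor A (D.mul.flip y) (D.Eᵣ (b ⊗ₜ d))) := by
  have comp_mul : D.mul.flip (D.antipodeMulBy c b) ∘ₗ D.mulAntipodeBy v₀ =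
      (D.mul v₀ ∘ₗ D.antipodeMulBy c) ∘ₗ D.mul b :=
    LinearMap.ext fun x => by
      rw [LinearMap.comp_apply, LinearMap.comp_apply, LinearMap.comp_apply, LinearMap.flip_apply,
        antipodeMulBy_mul, ← mul_antipodeMulBy]
  have comp_mul_flip : (D.mul v₀ ∘ₗ D.antipodeMulBy c) ∘ₗ D.mul.flip b₀ =
      D.mul (D.mulAntipodeBy v₀ b₀) ∘ₗ D.antipodeMulBy c :=
    LinearMap.ext fun x => by
      rw [LinearMap.comp_apply, LinearMap.comp_apply, LinearMap.comp_apply, LinearMap.flip_apply,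
        antipodeMulBy_mul, mul_antipodeMulBy]
  rw [← LinearMap.rTensor_tmul, G₂_rTensor_mulAntipodeBy, rTensor_lTensor_comm,
    ← LinearMap.rTensor_comp_apply, comp_mul, LinearMap.rTensor_comp_apply,
    ← rTensor_lTensor_comm, ← rTensor_lTensor_comm, Eₗ_Eᵣ, ← LinearMap.rTensor_comp_apply,
    comp_mul_flip]

lemma mul_op_sliceT₁ (a u d : A) (ω : A →ₗ[K] K) :
    D.mul u (D.op.sliceT₁ a ω d) = sliceRight (ω ∘ₗ D.mul d) (D.T₂ (u ⊗ₜ a)) := by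
  rw [sliceT₁_apply, ← sliceRight_rTensor, ← sliceRight_lTensor, Δᵣ_eq_T₂]
  exact congrArg (sliceRight ω) (D.op.Δₗ_eq_T₁ a u d)

lemma mulAntipodeBy_Eₗ_op_sliceT₁ (a b c d v₀ b₀ : A) (ω : A →ₗ[K] K) :
    lTensor A (D.mul (D.mulAntipodeBy v₀ b₀))
        (D.Eₗ (D.op.sliceT₁ a ω d ⊗ₜ D.antipodeMulBy c b)) =
      lTensor A (D.mul (D.mulAntipodeBy v₀ b₀)) (rTensor A (D.op.sliceT₁ a ω)
        (TensorProduct.comm K A A (rTensor A (D.antipodeMulBy c) (D.Eᵣ (b ⊗ₜ d))))) := by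
  refine D.eq_of_rTensor_mul fun u => eq_of_sliceRight fun μ => ?_
  have legRight_G₂ : (ω ∘ₗ D.mul d) ∘ₗ legRight D.G₂ (D.mulAntipodeBy v₀ b₀)
        (μ ∘ₗ D.mul.flip (D.antipodeMulBy c b)) =
      ω ∘ₗ D.mul (sliceRight μ (lTensor A (D.mul (D.mulAntipodeBy v₀ b₀))
        (TensorProduct.comm K A A (rTensor A (D.antipodeMulBy c) (D.Eᵣ (b ⊗ₜ d)))))) := by
    ext y
    have h := congrArg (fun z => ω (sliceLeft μ z)) (D.G₂_mulAntipodeBy c b d y v₀ b₀)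
    simp only [sliceLeft_rTensor, sliceLeft_lTensor] at h
    rw [LinearMap.comp_apply, legRight_apply, LinearMap.comp_apply, h, LinearMap.lTensor_comm,
      sliceRight_comm, sliceLeft_rTensor, sliceLeft_rTensor]
    rfl
  have h := congrArg (sliceRight (ω ∘ₗ D.mul d))
    (D.lTensor_legRight_G₂_T₂ (D.mulAntipodeBy v₀ b₀)
      (μ ∘ₗ D.mul.flip (D.antipodeMulBy c b)) (u ⊗ₜ a))
  rw [Eₗ_Eᵣ, sliceRight_rTensor, sliceRight_lTensor, LinearMap.flip_apply,
    ← legLeft_apply, mul_op_sliceT₁, ← LinearMap.rTensor_tmul, ← h, sliceRight_lTensor,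
    sliceRight_rTensor, ← rTensor_lTensor_comm, sliceRight_rTensor, mul_op_sliceT₁, legRight_G₂]

lemma eq_of_lTensor_mulAntipodeBy {z z' : W ⊗[K] A}
    (h : ∀ v b, lTensor W (D.mul (D.mulAntipodeBy v b)) z =
      lTensor W (D.mul (D.mulAntipodeBy v b)) z') : z = z' :=
  D.eq_of_lTensor_mul fun v =>
    LinearMap.congr_fun (f := LinearMap.applyₗ z ∘ₗ LinearMap.lTensorHom W ∘ₗ D.mul)
      (g := LinearMap.applyₗ z' ∘ₗ LinearMap.lTensorHom W ∘ₗ D.mul) (D.ext_of_mulAntipode h) v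

lemma Eₗ_op_sliceT₁_tmul_antipodeMulBy (a b c d : A) (ω : A →ₗ[K] K) :
    D.Eₗ (D.op.sliceT₁ a ω d ⊗ₜ D.antipodeMulBy c b) =
      rTensor A (D.op.sliceT₁ a ω)
        (TensorProduct.comm K A A (rTensor A (D.antipodeMulBy c) (D.Eᵣ (b ⊗ₜ d)))) :=
  D.eq_of_lTensor_mulAntipodeBy (D.mulAntipodeBy_Eₗ_op_sliceT₁ a b c d · · ω)

lemma Eₗ_lTensor_antipodeMulBy (c : A) (z : A ⊗[K] A) :
    D.Eₗ (lTensor A (D.antipodeMulBy c) z) = lTensor A (D.antipodeMulBy c) (D.G₃ z) :=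
  LinearMap.congr_fun (f := D.Eₗ ∘ₗ lTensor A (D.antipodeMulBy c))
    (g := lTensor A (D.antipodeMulBy c) ∘ₗ D.G₃) (D.op.ext_of_sliceT₁ fun a ω b d => by
      rw [LinearMap.comp_apply, LinearMap.comp_apply, LinearMap.lTensor_tmul,
        Eₗ_op_sliceT₁_tmul_antipodeMulBy, show D.G₃ _ = _ from D.op.G₁_sliceT₁_tmul a d b ω,
        ← rTensor_lTensor_comm, LinearMap.lTensor_comm]
      rfl) z

lemma lTensor_antipodeMulBy_op_R₁ (c : A) (z : A ⊗[K] A) :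
    lTensor A (D.antipodeMulBy c) (D.op.R₁ z) = D.T₁ (lTensor A (D.antipodeMulBy c) z) := by
  have G₃_R₃ : D.G₃ (D.op.R₁ z) = D.op.R₁ z := D.op.G₁_R₁ z
  have T₃_R₃ : D.T₃ (D.op.R₁ z) = D.Eᵣ z := D.op.T₁_R₁ z
  rw [← T₁_lTensor_antipodeMulBy_Eᵣ, ← T₃_R₃, ← R₁_lTensor_antipodeMulBy, T₁_R₁,
    Eₗ_lTensor_antipodeMulBy, G₃_R₃]

lemma antipodeMul_op_antipodeMul (a b c : A) :
    D.antipodeMul (D.op.antipodeMul (a ⊗ₜ b) ⊗ₜ c) = D.mul (D.mulAntipode (a ⊗ₜ b)) c := by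
  have h := congrArg (sliceLeft D.ε) (D.lTensor_antipodeMulBy_op_R₁ c (a ⊗ₜ b))
  rw [sliceLeft_lTensor, LinearMap.lTensor_tmul, counit_T₁, mul_antipodeMulBy] at h
  exact h

lemma exists_antipode (a : A) : ∃ z, ∀ c, D.antipodeMul (a ⊗ₜ c) = D.mul z c := by
  obtain ⟨w, rfl⟩ := D.op.antipodeMul_surjective a
  exact ⟨D.mulAntipode w, fun c =>
    eq_of_tmul (f := D.antipodeMul ∘ₗ (TensorProduct.mk K A A).flip c ∘ₗ D.op.antipodeMul)
      (g := D.mul.flip c ∘ₗ D.mulAntipode) (fun a b => D.antipodeMul_op_antipodeMul a b c) w⟩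

end AntipodeExists

section Antipode

/-- The antipode, determined by `D.mul (D.S a) c = D.antipodeMul (a ⊗ₜ c)`. -/
def S : A →ₗ[K] A where
  toFun a := (D.exists_antipode a).choose
  map_add' a b := D.eq_of_mul_right fun c => by
    rw [map_add, LinearMap.add_apply, ← (D.exists_antipode _).choose_spec,
      ← (D.exists_antipode _).choose_spec, ← (D.exists_antipode _).choose_spec,
      TensorProduct.add_tmul, map_add]
  map_smul' k a := D.eq_of_mul_right fun c => by
    rw [map_smul, LinearMap.smul_apply, ← (D.exists_antipode _).choose_spec,
      ← (D.exists_antipode _).choose_spec, ← TensorProduct.smul_tmul', map_smul, RingHom.id_apply]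

lemma S_mul (a c : A) : D.mul (D.S a) c = D.antipodeMul (a ⊗ₜ c) :=
  ((D.exists_antipode a).choose_spec c).symm

lemma mul_S (b a : A) : D.mul b (D.S a) = D.mulAntipode (b ⊗ₜ a) :=
  D.eq_of_mul_right fun c => by rw [mul_assoc, S_mul, mul_antipodeMul]

lemma S_mul_rev (a b : A) : D.S (D.mul a b) = D.mul (D.S b) (D.S a) :=
  D.eq_of_mul_right fun c => by rw [mul_assoc, S_mul, S_mul, S_mul, antipodeMul_mul_tmul]

lemma S_op_antipodeMul (a b : A) : D.S (D.op.antipodeMul (a ⊗ₜ b)) = D.mulAntipode (a ⊗ₜ b) :=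
  D.eq_of_mul_right fun c => by rw [S_mul, antipodeMul_op_antipodeMul]

lemma S_surjective : Function.Surjective D.S := by
  have mkQ_eq_zero : (LinearMap.range D.S).mkQ = 0 := D.ext_of_mulAntipode fun a b => by
    rw [← S_op_antipodeMul]
    exact (Submodule.Quotient.mk_eq_zero _).2 ⟨_, rfl⟩
  rw [← LinearMap.range_eq_top, ← Submodule.ker_mkQ (LinearMap.range D.S), mkQ_eq_zero,
    LinearMap.ker_zero]

lemma S_op_S (a : A) : D.S (D.op.S a) = a :=
  D.eq_of_mul_right fun c => by
    obtain ⟨b, rfl⟩ := D.S_surjective c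
    have op_S_mul : D.op.antipodeMul (a ⊗ₜ b) = D.mul b (D.op.S a) := (D.op.S_mul a b).symm
    rw [← S_mul_rev, ← op_S_mul, S_op_antipodeMul, mul_S]

end Antipode

/-! ### The projection onto the commutant -/

section Sandwich

lemma mulAntipode_tmul (p q : A) : D.mulAntipode (p ⊗ₜ q) = D.mul p (D.S q) := (D.mul_S p q).symm

lemma antipodeMul_tmul (p q : A) : D.antipodeMul (p ⊗ₜ q) = D.mul (D.S p) q := (D.S_mul p q).symm

lemma mulAntipode_rTensor_mul_flip_S (r : A) (t : A ⊗[K] A) :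
    D.mulAntipode (rTensor A (D.mul.flip (D.S r)) t) =
      D.mulAntipode (lTensor A (D.mul.flip r) t) :=
  eq_of_tmul (f := D.mulAntipode ∘ₗ rTensor A (D.mul.flip (D.S r)))
    (g := D.mulAntipode ∘ₗ lTensor A (D.mul.flip r))
    (fun p q => by simp [mulAntipode_tmul, S_mul_rev, D.mul_assoc]) t

lemma mulAntipode_lTensor_mul (r : A) (t : A ⊗[K] A) :
    D.mulAntipode (lTensor A (D.mul r) t) = D.mul (D.mulAntipode t) (D.S r) :=
  eq_of_tmul (f := D.mulAntipode ∘ₗ lTensor A (D.mul r))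
    (g := D.mul.flip (D.S r) ∘ₗ D.mulAntipode)
    (fun p q => by simp [mulAntipode_tmul, S_mul_rev, D.mul_assoc]) t

lemma mulAntipode_mul (t : A ⊗[K] A) (c : A) :
    D.mul (D.mulAntipode t) c = TensorProduct.lift D.mul (lTensor A (D.antipodeMulBy c) t) :=
  eq_of_tmul (f := D.mul.flip c ∘ₗ D.mulAntipode)
    (g := TensorProduct.lift D.mul ∘ₗ lTensor A (D.antipodeMulBy c))
    (fun p q => (D.mul_antipodeMulBy p q c).symm) t

lemma lift_mul_surjective : Function.Surjective (TensorProduct.lift D.mul) := by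
  rw [← LinearMap.range_eq_top, eq_top_iff, ← D.t₁Axioms.idempotent, Submodule.map₂_le]
  exact fun a _ b _ => ⟨a ⊗ₜ b, rfl⟩

lemma mulAntipode_surjective : Function.Surjective D.mulAntipode := fun a => by
  obtain ⟨w, rfl⟩ := D.lift_mul_surjective a
  exact ⟨lTensor A D.op.S w, eq_of_tmul (f := D.mulAntipode ∘ₗ lTensor A D.op.S)
    (g := TensorProduct.lift D.mul) (fun p q => by simp [mulAntipode_tmul, S_op_S]) w⟩

lemma G₁_lTensor_mul_flip (b : A) (z : A ⊗[K] A) :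
    D.G₁ (lTensor A (D.mul.flip b) z) = lTensor A (D.mul.flip b) (D.G₁ z) :=
  LinearMap.congr_fun (f := D.G₁ ∘ₗ lTensor A (D.mul.flip b))
    (g := lTensor A (D.mul.flip b) ∘ₗ D.G₁) (D.ext_of_sliceT₁ fun c ω a d => by
      rw [LinearMap.comp_apply, LinearMap.comp_apply, LinearMap.lTensor_tmul, G₁_sliceT₁_tmul,
        G₁_sliceT₁_tmul, ← LinearMap.rTensor_tmul, Eₗ_rTensor_mul_flip, ← rTensor_lTensor_comm,
        LinearMap.lTensor_comm]) z

lemma sourceMul_tmul_mul (c a b : A) :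
    D.sourceMul (c ⊗ₜ D.mul a b) = D.mul (D.sourceMul (c ⊗ₜ a)) b := by
  have tmul_mul : c ⊗ₜ[K] D.mul a b = lTensor A (D.mul.flip b) (c ⊗ₜ a) := rfl
  rw [sourceMul_apply, tmul_mul, G₁_lTensor_mul_flip, sliceLeft_lTensor]
  rfl

lemma rTensor_sourceLeft_flip_T₁ (b q d : A) :
    rTensor A (D.sourceLeft.flip b) (D.T₁ (q ⊗ₜ d)) = lTensor A (D.mul q) (D.Eₗ (b ⊗ₜ d)) := by
  refine eq_of_sliceRight fun ω => ?_
  rw [sliceRight_rTensor, sliceRight_lTensor, LinearMap.flip_apply, ← legLeft_apply,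
    sourceLeft_legLeft_T₁]
  rfl

/-- `D.IsCover q b t` says that `t` is the multiplier `(1 ⊗ q) E (b ⊗ 1)` of `A ⊗ A`, tested by
right multiplication with the elements `1 ⊗ d`. -/
def IsCover (q b : A) (t : A ⊗[K] A) : Prop :=
  ∀ d, lTensor A (D.mul.flip d) t = lTensor A (D.mul q) (D.Eₗ (b ⊗ₜ d))

variable {D} in
lemma IsCover.unique {q b : A} {t t' : A ⊗[K] A} (h : D.IsCover q b t) (h' : D.IsCover q b t') :
    t = t' :=
  D.eq_of_lTensor_mul_flip fun d => by rw [h d, h' d]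

lemma isCover_sourceLeft (b : A) (w : A ⊗[K] A) :
    D.IsCover (TensorProduct.lift D.mul.flip w) b (rTensor A (D.sourceLeft.flip b) (D.T₃ w)) := by
  intro d
  refine eq_of_tmul (f := lTensor A (D.mul.flip d) ∘ₗ rTensor A (D.sourceLeft.flip b) ∘ₗ D.T₃)
    (g := LinearMap.applyₗ (D.Eₗ (b ⊗ₜ d)) ∘ₗ LinearMap.lTensorHom A ∘ₗ D.mul ∘ₗ
      TensorProduct.lift D.mul.flip) (fun q q' => ?_) w
  simp only [LinearMap.comp_apply]
  rw [← rTensor_lTensor_comm, ← T₁_T₃, rTensor_lTensor_comm, rTensor_sourceLeft_flip_T₁,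
    ← LinearMap.lTensor_comp_apply, ← mul_mul_eq_comp]
  rfl

lemma exists_isCover (q b : A) : ∃ t, D.IsCover q b t := by
  obtain ⟨w, rfl⟩ := D.op.lift_mul_surjective q
  exact ⟨_, D.isCover_sourceLeft b w⟩

lemma mulAntipode_Eₗ_mul_S (w : A ⊗[K] A) {q : A} {t : A ⊗[K] A}
    (h : D.IsCover q (D.mulAntipode w) t) :
    D.mul (D.mulAntipode (D.Eₗ w)) (D.S q) = D.mulAntipode t := by
  obtain ⟨v, rfl⟩ := D.op.lift_mul_surjective q
  rw [h.unique (D.isCover_sourceLeft _ v)]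
  refine eq_of_tmul
    (f := D.mul.flip (D.S (TensorProduct.lift D.op.mul v)) ∘ₗ D.mulAntipode ∘ₗ D.Eₗ)
    (g := D.mulAntipode ∘ₗ LinearMap.applyₗ (D.T₃ v) ∘ₗ LinearMap.rTensorHom A ∘ₗ
      D.sourceLeft.flip ∘ₗ D.mulAntipode) (fun p r => ?_) w
  change D.mul (D.mulAntipode (D.Eₗ (p ⊗ₜ r))) (D.S (TensorProduct.lift D.op.mul v)) =
    D.mulAntipode (rTensor A (D.sourceLeft.flip (D.mulAntipode (p ⊗ₜ r))) (D.T₃ v))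
  have sourceLeft_flip_mul : D.sourceLeft.flip (D.mulAntipode (p ⊗ₜ r)) =
      D.mul.flip (D.S r) ∘ₗ D.sourceLeft.flip p :=
    LinearMap.ext fun c => by
      rw [mulAntipode_tmul]
      exact D.sourceMul_tmul_mul c p (D.S r)
  rw [sourceLeft_flip_mul, LinearMap.rTensor_comp_apply, mulAntipode_rTensor_mul_flip_S,
    D.isCover_sourceLeft p v r, mulAntipode_lTensor_mul]
  rfl

lemma exists_sandwich :
    ∃ π : A →ₗ[K] A, ∀ q b t, D.IsCover q b t → D.mul (π b) (D.S q) = D.mulAntipode t := by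
  obtain ⟨g, hg⟩ := LinearMap.exists_rightInverse_of_surjective D.mulAntipode
    (LinearMap.range_eq_top.2 D.mulAntipode_surjective)
  refine ⟨D.mulAntipode ∘ₗ D.Eₗ ∘ₗ g, fun q b t h => D.mulAntipode_Eₗ_mul_S (g b) ?_⟩
  rwa [show D.mulAntipode (g b) = b from LinearMap.congr_fun hg b]

/-- The map `a ↦ E₍₁₎ a S(E₍₂₎)`, where `E = E₍₁₎ ⊗ E₍₂₎`. -/
def sandwich : A →ₗ[K] A := D.exists_sandwich.choose

variable {D} in
lemma IsCover.sandwich_mul_S {q b : A} {t : A ⊗[K] A} (h : D.IsCover q b t) :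
    D.mul (D.sandwich b) (D.S q) = D.mulAntipode t := D.exists_sandwich.choose_spec q b t h

lemma sandwich_mulAntipode (w : A ⊗[K] A) :
    D.sandwich (D.mulAntipode w) = D.mulAntipode (D.Eₗ w) := D.eq_of_mul_right fun c => by
  obtain ⟨q, rfl⟩ := D.S_surjective c
  obtain ⟨t, ht⟩ := D.exists_isCover q (D.mulAntipode w)
  rw [ht.sandwich_mul_S, D.mulAntipode_Eₗ_mul_S w ht]

/-- The algebra `A₀`, spanned by the elements `E₍₁₎ p S(E₍₂₎ q)`. -/
def A₀ : Submodule K A := LinearMap.range (D.mulAntipode ∘ₗ D.Eₗ)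

lemma range_sandwich : LinearMap.range D.sandwich = D.A₀ := by
  rw [A₀, ← LinearMap.range_comp_of_range_eq_top D.sandwich
    (LinearMap.range_eq_top.2 D.mulAntipode_surjective)]
  exact congrArg LinearMap.range (LinearMap.ext D.sandwich_mulAntipode)

lemma sandwich_mem_A₀ (a : A) : D.sandwich a ∈ D.A₀ :=
  D.range_sandwich ▸ LinearMap.mem_range_self D.sandwich a

lemma range_mulAntipode_T₄ : LinearMap.range (D.mulAntipode ∘ₗ D.T₄) = D.A₀ := by
  apply le_antisymm
  · rintro _ ⟨w, rfl⟩
    exact ⟨D.T₄ w, by rw [LinearMap.comp_apply, Eₗ_T₄, LinearMap.comp_apply]⟩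
  · rintro _ ⟨w, rfl⟩
    obtain ⟨v, hv⟩ := D.exists_Eₗ_eq_T₄ w
    exact ⟨v, by rw [LinearMap.comp_apply, ← hv, LinearMap.comp_apply]⟩

end Sandwich

section Commutant

lemma G₂_lTensor_mul_flip (d : A) (z : A ⊗[K] A) :
    D.G₂ (lTensor A (D.mul.flip d) z) = lTensor A (D.mul.flip d) (D.G₂ z) := by
  simpa [LinearMap.rTensor_comm, LinearMap.lTensor_comm] using
    congrArg (TensorProduct.comm K A A)
      (D.op.cop.G₁_rTensor_mul d (TensorProduct.comm K A A z))

lemma mul_comp_legLeft_Eₗ (u a d : A) (ω : A →ₗ[K] K) :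
    D.mul u ∘ₗ legLeft D.Eₗ d (ω ∘ₗ D.mul a) =
      D.mul (legLeft D.Eᵣ a (ω ∘ₗ D.mul.flip d) u) := LinearMap.ext fun b => by
  have h := congrArg (sliceRight ω) (D.Eₗ_Eᵣ u a b d)
  simp only [sliceRight_rTensor, sliceRight_lTensor] at h
  exact h

lemma legRight_G₂_comp_mul_flip (a e : A) (ω : A →ₗ[K] K) :
    legRight D.G₂ a ω ∘ₗ D.mul.flip e = D.mul.flip e ∘ₗ legRight D.G₂ a ω :=
  LinearMap.ext fun b => by
    have tmul_mul : a ⊗ₜ[K] D.mul.flip e b = lTensor A (D.mul.flip e) (a ⊗ₜ b) := rfl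
    rw [LinearMap.comp_apply, legRight_apply, tmul_mul, G₂_lTensor_mul_flip, sliceLeft_lTensor]
    rfl

lemma rTensor_legLeft_Eₗ_T₁ (a d : A) (ω : A →ₗ[K] K) (z : A ⊗[K] A) :
    rTensor A (legLeft D.Eₗ d (ω ∘ₗ D.mul a)) (D.T₁ z) =
      lTensor A (legRight D.G₂ a (ω ∘ₗ D.mul.flip d)) (D.T₁ z) := by
  refine eq_of_tmul (f := rTensor A (legLeft D.Eₗ d (ω ∘ₗ D.mul a)) ∘ₗ D.T₁)
    (g := lTensor A (legRight D.G₂ a (ω ∘ₗ D.mul.flip d)) ∘ₗ D.T₁)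
    (fun b e => D.eq_of_rTensor_mul fun u => ?_) z
  simp only [LinearMap.comp_apply]
  rw [← LinearMap.rTensor_comp_apply, mul_comp_legLeft_Eₗ, T₁_T₂, ← LinearMap.rTensor_tmul,
    ← lTensor_legRight_G₂_T₂, ← LinearMap.lTensor_comp_apply, ← legRight_G₂_comp_mul_flip,
    LinearMap.lTensor_comp_apply, ← T₁_T₂, rTensor_lTensor_comm]

lemma R₁_lTensor_legLeft_Eₗ (a d : A) (ω : A →ₗ[K] K) (z : A ⊗[K] A) :
    D.R₁ (lTensor A (legLeft D.Eₗ d (ω ∘ₗ D.mul a)) z) =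
      rTensor A (legLeft D.Eₗ d (ω ∘ₗ D.mul a)) (D.R₁ z) := by
  rw [← sourceLeft_legLeft_T₁, R₁_lTensor_sourceLeft]

lemma antipodeMulBy_comp_legRight_G₂ (a c d : A) (ω : A →ₗ[K] K) :
    D.antipodeMulBy c ∘ₗ legRight D.G₂ a (ω ∘ₗ D.mul.flip d) =
      D.antipodeMulBy (legLeft D.Eₗ d (ω ∘ₗ D.mul a) c) := by
  refine D.ext_of_lTensor_T₂ fun z => ?_
  refine eq_of_tmul
    (f := lTensor A (D.antipodeMulBy c ∘ₗ legRight D.G₂ a (ω ∘ₗ D.mul.flip d)) ∘ₗ D.T₂)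
    (g := lTensor A (D.antipodeMulBy (legLeft D.Eₗ d (ω ∘ₗ D.mul a) c)) ∘ₗ D.T₂)
    (fun u b => ?_) z
  simp only [LinearMap.comp_apply]
  rw [LinearMap.lTensor_comp_apply, lTensor_legRight_G₂_T₂, LinearMap.rTensor_tmul,
    lTensor_antipodeMulBy_T₂, lTensor_antipodeMulBy_T₂, ← mul_comp_legLeft_Eₗ,
    LinearMap.rTensor_comp_apply, ← R₁_lTensor_legLeft_Eₗ, LinearMap.lTensor_tmul]

lemma sourceLeft_lift_mul (c : A) (t : A ⊗[K] A) :
    D.sourceLeft c (TensorProduct.lift D.mul t) =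
      TensorProduct.lift D.mul (rTensor A (D.sourceLeft c) t) :=
  eq_of_tmul (f := D.sourceLeft c ∘ₗ TensorProduct.lift D.mul)
    (g := TensorProduct.lift D.mul ∘ₗ rTensor A (D.sourceLeft c))
    (fun p q => D.sourceMul_tmul_mul c p q) t

/-- `D.CommutesWithSource z` says that `z` commutes with the image of the source map. -/
def CommutesWithSource (z : A) : Prop :=
  ∀ a c, D.mul z (D.sourceLeft a c) = D.sourceLeft a (D.mul z c)

lemma commutesWithSource_of_mem {z : A} (hz : z ∈ D.A₀) : D.CommutesWithSource z := by
  obtain ⟨w, rfl⟩ := hz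
  intro a c
  refine D.eq_of_sourceLeft
    (f := D.mul (D.mulAntipode (D.Eₗ w)) ∘ₗ LinearMap.applyₗ c)
    (g := LinearMap.applyₗ (D.mul (D.mulAntipode (D.Eₗ w)) c)) (fun a d ω => ?_) a
  obtain ⟨v, hv⟩ := D.exists_Eₗ_eq_T₁ w
  simp only [LinearMap.comp_apply, LinearMap.applyₗ_apply_apply]
  rw [mulAntipode_mul, mulAntipode_mul, ← sourceLeft_legLeft_T₁, sourceLeft_lift_mul,
    sourceLeft_legLeft_T₁, hv, rTensor_lTensor_comm, rTensor_legLeft_Eₗ_T₁,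
    ← LinearMap.lTensor_comp_apply, antipodeMulBy_comp_legRight_G₂]

lemma Eₗ_rTensor_mul_of_commutesWithSource {z : A} (h : D.CommutesWithSource z) (w : A ⊗[K] A) :
    D.Eₗ (rTensor A (D.mul z) w) = rTensor A (D.mul z) (D.Eₗ w) := by
  refine eq_of_tmul (f := D.Eₗ ∘ₗ rTensor A (D.mul z)) (g := rTensor A (D.mul z) ∘ₗ D.Eₗ)
    (fun b d => D.eq_of_lTensor_mul fun a => eq_of_sliceRight fun ω => ?_) w
  have hb := h (legLeft D.T₁ d ω a) b
  rw [sourceLeft_legLeft_T₁, legLeft_apply, legLeft_apply] at hb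
  rw [LinearMap.comp_apply, LinearMap.comp_apply, sliceRight_lTensor, sliceRight_lTensor,
    sliceRight_rTensor, LinearMap.rTensor_tmul, hb]

lemma isCover_Eᵣ {z : A}
    (h : ∀ w, D.Eₗ (rTensor A (D.mul z) w) = rTensor A (D.mul z) (D.Eₗ w)) (q : A) :
    D.IsCover q z (D.Eᵣ (z ⊗ₜ q)) := fun d => D.eq_of_rTensor_mul_flip fun c => by
  rw [← Eₗ_Eᵣ, rTensor_lTensor_comm, ← h, LinearMap.rTensor_tmul, rTensor_lTensor_comm,
    ← Eₗ_rTensor_mul_flip, LinearMap.rTensor_tmul]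
  rfl

lemma sandwich_eq_self {z : A}
    (h : ∀ w, D.Eₗ (rTensor A (D.mul z) w) = rTensor A (D.mul z) (D.Eₗ w)) : D.sandwich z = z :=
  D.eq_of_mul_right fun c => by
    obtain ⟨q, rfl⟩ := D.S_surjective c
    rw [(D.isCover_Eᵣ h q).sandwich_mul_S, mulAntipode_Eᵣ, mulAntipode_tmul]

lemma mem_A₀_iff_Eₗ {z : A} :
    z ∈ D.A₀ ↔ ∀ w, D.Eₗ (rTensor A (D.mul z) w) = rTensor A (D.mul z) (D.Eₗ w) :=
  ⟨fun h => D.Eₗ_rTensor_mul_of_commutesWithSource (D.commutesWithSource_of_mem h),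
    fun h => D.sandwich_eq_self h ▸ D.sandwich_mem_A₀ z⟩

lemma mem_A₀_iff_commutesWithSource {z : A} : z ∈ D.A₀ ↔ D.CommutesWithSource z :=
  ⟨D.commutesWithSource_of_mem,
    fun h => D.mem_A₀_iff_Eₗ.2 (D.Eₗ_rTensor_mul_of_commutesWithSource h)⟩

lemma Eᵣ_rTensor_mul_flip_of_Eₗ {z : A}
    (h : ∀ w, D.Eₗ (rTensor A (D.mul z) w) = rTensor A (D.mul z) (D.Eₗ w)) (w : A ⊗[K] A) :
    D.Eᵣ (rTensor A (D.mul.flip z) w) = rTensor A (D.mul.flip z) (D.Eᵣ w) := by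
  refine eq_of_tmul (f := D.Eᵣ ∘ₗ rTensor A (D.mul.flip z))
    (g := rTensor A (D.mul.flip z) ∘ₗ D.Eᵣ)
    (fun u v => D.eq_of_lTensor_mul_flip fun y => D.eq_of_rTensor_mul_flip fun x => ?_) w
  simp only [LinearMap.comp_apply, LinearMap.rTensor_tmul]
  rw [← Eₗ_Eᵣ, ← rTensor_lTensor_comm, ← LinearMap.rTensor_comp_apply, ← mul_flip_mul_eq_comp,
    ← Eₗ_Eᵣ, LinearMap.flip_apply, mul_mul_eq_comp, LinearMap.rTensor_comp_apply,
    rTensor_lTensor_comm, ← h]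
  rfl

lemma A₀_op : D.op.A₀ = D.A₀ := by
  ext z
  rw [mem_A₀_iff_Eₗ, mem_A₀_iff_Eₗ]
  exact ⟨fun h => D.op.Eᵣ_rTensor_mul_flip_of_Eₗ h, fun h => D.Eᵣ_rTensor_mul_flip_of_Eₗ h⟩

lemma mul_mem_A₀ {x y : A} (hx : x ∈ D.A₀) (hy : y ∈ D.A₀) : D.mul x y ∈ D.A₀ := by
  rw [mem_A₀_iff_commutesWithSource] at *
  intro a c
  rw [mul_assoc, hy, hx, mul_assoc]

end Commutant

section LocalUnits

lemma op_sourceMul_mul (θ x u : A) :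
    D.mul (D.op.sourceMul (θ ⊗ₜ x)) u = D.mul x (sliceRight D.ε (D.Eₗ (u ⊗ₜ θ))) :=
  D.op.mul_sourceMul u θ x

/-- The map `θ ↦ (ι ⊗ ε)(E (b ⊗ θ))`. -/
def targetLeg (b : A) : A →ₗ[K] A := sliceRight D.ε ∘ₗ D.Eₗ ∘ₗ TensorProduct.mk K A A b

lemma rTensor_targetLeg_T₁ (b : A) (w : A ⊗[K] A) :
    rTensor A (D.targetLeg b) (D.T₁ w) = D.Eₗ (b ⊗ₜ TensorProduct.lift D.mul w) := by
  refine D.eq_of_lTensor_mul fun d => D.eq_of_rTensor_mul fun u => ?_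
  have mul_targetLeg : D.mul u ∘ₗ D.targetLeg b = D.mul.flip b ∘ₗ D.op.sourceLeft.flip u :=
    LinearMap.ext fun θ => (D.op_sourceMul_mul θ u b).symm
  have cover : lTensor A (D.mul d) (rTensor A (D.op.sourceLeft.flip u) (D.T₁ w)) =
      lTensor A (D.mul.flip (TensorProduct.lift D.mul w)) (D.Eᵣ (u ⊗ₜ d)) :=
    D.op.isCover_sourceLeft u w d
  rw [Eₗ_Eᵣ, rTensor_lTensor_comm, ← LinearMap.rTensor_comp_apply, mul_targetLeg,
    LinearMap.rTensor_comp_apply, ← rTensor_lTensor_comm, cover]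

lemma R₁_tmul_mem_range (p t : A) :
    D.R₁ (p ⊗ₜ t) ∈ LinearMap.range (lTensor A (D.mul.flip t)) := by
  refine (lTensor_exact A (LinearMap.exact_map_mkQ_range (D.mul.flip t))
    (Submodule.mkQ_surjective _) _).1 (D.eq_of_rTensor_mul fun u => ?_)
  have mkQ_antipodeMulBy : (LinearMap.range (D.mul.flip t)).mkQ ∘ₗ D.antipodeMulBy t = 0 :=
    LinearMap.ext fun y => (Submodule.Quotient.mk_eq_zero _).2
      ⟨D.S y, by rw [antipodeMulBy_apply, antipodeMul_tmul, LinearMap.flip_apply]⟩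
  rw [rTensor_lTensor_comm, ← lTensor_antipodeMulBy_T₂, ← LinearMap.lTensor_comp_apply,
    mkQ_antipodeMulBy, LinearMap.lTensor_zero, LinearMap.zero_apply, map_zero]

lemma sliceLeft_Eₗ_tmul_mem_range (ω : A →ₗ[K] K) (p t : A) :
    sliceLeft ω (D.Eₗ (p ⊗ₜ t)) ∈ LinearMap.range (D.mul.flip t) := by
  obtain ⟨v, hv⟩ := D.R₁_tmul_mem_range p t
  rw [← T₁_R₁, ← hv, T₁_lTensor_mul_flip, sliceLeft_lTensor]
  exact LinearMap.mem_range_self _ _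

/-- The map `θ, c ↦ ε_t(θ) c`, where `ε_t(θ) = ∑ θ₍₁₎ S(θ₍₂₎)`. It is written as
`S(S⁻¹(c) ∑ θ₍₂₎ S⁻¹(θ₍₁₎))`, since `S⁻¹` is the antipode of the opposite algebra. -/
def targetMul : A →ₗ[K] A →ₗ[K] A := (D.op.sourceLeft.compr₂ D.S).compl₂ D.op.S

lemma targetMul_apply (θ c : A) : D.targetMul θ c = D.S (D.op.sourceMul (θ ⊗ₜ D.op.S c)) := rfl

lemma targetMul_mul (θ a c : A) :
    D.targetMul θ (D.mul a c) = D.mul (D.targetMul θ a) c := by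
  have S_op_mul : D.op.S (D.mul a c) = D.mul (D.op.S c) (D.op.S a) := D.op.S_mul_rev c a
  have sourceMul_op_mul : D.op.sourceMul (θ ⊗ₜ D.mul (D.op.S c) (D.op.S a)) =
      D.mul (D.op.S c) (D.op.sourceMul (θ ⊗ₜ D.op.S a)) :=
    D.op.sourceMul_tmul_mul θ (D.op.S a) (D.op.S c)
  rw [targetMul_apply, S_op_mul, sourceMul_op_mul, S_mul_rev, S_op_S, targetMul_apply]

lemma lift_targetMul (w : A ⊗[K] A) :
    TensorProduct.lift D.targetMul (D.T₁ w) = TensorProduct.lift D.mul w := by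
  refine D.eq_of_mul_left fun c => ?_
  obtain ⟨b, rfl⟩ := D.S_surjective c
  rw [D.S_mul b (TensorProduct.lift D.mul w), ← antipodeMul_Eₗ, ← rTensor_targetLeg_T₁]
  refine eq_of_tmul (f := D.mul (D.S b) ∘ₗ TensorProduct.lift D.targetMul)
    (g := D.antipodeMul ∘ₗ rTensor A (D.targetLeg b)) (fun θ t => ?_) (D.T₁ w)
  simp only [LinearMap.comp_apply, TensorProduct.lift.tmul, LinearMap.rTensor_tmul]
  rw [targetMul_apply, ← S_mul_rev, op_sourceMul_mul, S_mul_rev, S_op_S, antipodeMul_tmul]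
  rfl

lemma targetMul_eq_zero {θ : A} (h : ∀ b, D.targetLeg b θ = 0) : D.targetMul θ = 0 :=
  LinearMap.ext fun c => by
    have sourceMul_eq_zero : D.op.sourceMul (θ ⊗ₜ D.op.S c) = 0 := D.eq_of_mul_right fun u => by
      rw [op_sourceMul_mul, map_zero, LinearMap.zero_apply]
      exact (congrArg _ (h u)).trans (map_zero _)
    rw [targetMul_apply, sourceMul_eq_zero, map_zero, LinearMap.zero_apply]

lemma exists_mul_eq (t : A) : ∃ a, D.mul a t = t := by
  obtain ⟨w, hw⟩ := D.lift_mul_surjective t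
  set Y := LinearMap.range (D.mul.flip t)
  have sliceRight_mem (ω : A →ₗ[K] K) (hω : Y ≤ LinearMap.ker ω) :
      sliceRight ω (D.T₁ w) ∈ LinearMap.ker D.targetMul := D.targetMul_eq_zero fun b => by
    rw [← sliceRight_rTensor, rTensor_targetLeg_T₁, hw]
    refine Module.eval_apply_injective K (LinearMap.ext fun μ => ?_)
    rw [Module.Dual.eval_apply, Module.Dual.eval_apply, map_zero, ← apply_sliceLeft]
    exact hω (D.sliceLeft_Eₗ_tmul_mem_range μ b t)
  obtain ⟨_, ⟨v, rfl⟩, _, ⟨v', rfl⟩, hv⟩ :=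
    Submodule.mem_sup.1 (mem_sup_of_sliceRight_mem sliceRight_mem)
  have lift_lTensor : Y.mkQ ∘ₗ TensorProduct.lift D.targetMul ∘ₗ lTensor A Y.subtype = 0 := by
    refine TensorProduct.ext' fun θ y => ?_
    obtain ⟨_, b, rfl⟩ := y
    exact (Submodule.Quotient.mk_eq_zero _).2 ⟨D.targetMul θ b, (D.targetMul_mul θ b t).symm⟩
  have lift_rTensor : TensorProduct.lift D.targetMul
      (rTensor A (LinearMap.ker D.targetMul).subtype v') = 0 :=
    LinearMap.congr_fun (f := TensorProduct.lift D.targetMul ∘ₗ rTensor A _) (g := 0)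
      (TensorProduct.ext' fun θ c => by simp) v'
  suffices t ∈ Y from this
  rw [← hw, ← lift_targetMul, ← hv, map_add, lift_rTensor, add_zero]
  exact (Submodule.Quotient.mk_eq_zero _).1 (LinearMap.congr_fun lift_lTensor v)

lemma exists_lTensor_mul_eq_of_fixed (z : W ⊗[K] A) : ∀ a, ∃ e, lTensor W (D.mul e) z = z ∧
    ∀ y : W ⊗[K] A, lTensor W (D.mul a) y = y → lTensor W (D.mul e) y = y := by
  induction z with
  | zero => exact fun a => ⟨a, map_zero _, fun _ h => h⟩
  | tmul p q =>
    intro a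
    obtain ⟨b, hb⟩ := D.exists_mul_eq (q - D.mul a q)
    have mul_e : D.mul (a + b - D.mul b a) =
        D.mul a + D.mul b ∘ₗ (LinearMap.id - D.mul a) :=
      LinearMap.ext fun q => by simp [D.mul_assoc, add_sub_assoc]
    refine ⟨a + b - D.mul b a, ?_, fun y hy => ?_⟩
    · simp [mul_e, hb, ← TensorProduct.tmul_add]
    · simp [mul_e, LinearMap.lTensor_add, LinearMap.lTensor_comp, LinearMap.lTensor_sub, hy]
  | add z z' h h' =>
    intro a
    obtain ⟨e, he, fixed_e⟩ := h a
    obtain ⟨f, hf, fixed_f⟩ := h' e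
    exact ⟨f, by rw [map_add, fixed_f z he, hf], fun y hy => fixed_f y (fixed_e y hy)⟩

lemma exists_lTensor_mul_eq (z : W ⊗[K] A) : ∃ e, lTensor W (D.mul e) z = z :=
  (D.exists_lTensor_mul_eq_of_fixed z 0).imp fun _ h => h.1

lemma sourceMul_lTensor_S_T₃ (w : A ⊗[K] A) :
    D.sourceMul (lTensor A D.S (D.T₃ w)) = D.S (TensorProduct.lift D.mul.flip w) := by
  refine D.eq_of_mul_right fun c => ?_
  have sourceMul_lTensor_S_mul (z) :
      D.mul (D.sourceMul (lTensor A D.S z)) c = D.sourceMul (lTensor A (D.antipodeMulBy c) z) :=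
    eq_of_tmul (f := D.mul.flip c ∘ₗ D.sourceMul ∘ₗ lTensor A D.S)
      (g := D.sourceMul ∘ₗ lTensor A (D.antipodeMulBy c))
      (fun θ y => by simp [← sourceMul_tmul_mul, S_mul, antipodeMulBy_apply]) z
  have antipodeMul_lTensor (w) : D.antipodeMul (lTensor A (D.antipodeMulBy c) w) =
      D.mul (D.S (TensorProduct.lift D.mul.flip w)) c :=
    eq_of_tmul (f := D.antipodeMul ∘ₗ lTensor A (D.antipodeMulBy c))
      (g := D.mul.flip c ∘ₗ D.S ∘ₗ TensorProduct.lift D.mul.flip)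
      (fun q q' => by simp [antipodeMul_tmul, antipodeMulBy_apply, S_mul_rev, D.mul_assoc]) w
  rw [sourceMul_lTensor_S_mul, ← R₁_lTensor_antipodeMulBy, sourceMul_R₁, antipodeMul_lTensor]

lemma exists_mem_A₀_mul_eq (c : A) : ∃ z ∈ D.A₀, D.mul z c = c := by
  obtain ⟨w, hw⟩ := D.op.lift_mul_surjective (D.op.S c)
  obtain ⟨a, ha⟩ := D.exists_lTensor_mul_eq (lTensor A D.S (D.T₃ w))
  have hc : c = D.S (TensorProduct.lift D.mul.flip w) :=
    (D.S_op_S c).symm.trans (congrArg D.S hw.symm)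
  refine ⟨D.sandwich a, D.sandwich_mem_A₀ a, ?_⟩
  rw [hc, (D.isCover_sourceLeft a w).sandwich_mul_S, ← sourceMul_lTensor_S_T₃, ← ha]
  refine eq_of_tmul (f := D.mulAntipode ∘ₗ rTensor A (D.sourceLeft.flip a))
    (g := D.sourceMul ∘ₗ lTensor A (D.mul a) ∘ₗ lTensor A D.S) (fun θ y => ?_) (D.T₃ w)
  simp [mulAntipode_tmul, sourceMul_tmul_mul, sourceLeft_apply]

lemma exists_mem_A₀_eq_mul (c : A) : ∃ z ∈ D.A₀, D.mul c z = c := by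
  rw [← A₀_op]
  exact D.op.exists_mem_A₀_mul_eq c

end LocalUnits

section Adjoint

/-- The adjoint action `a ▹ x = ∑ a₍₁₎ x S(a₍₂₎)`, the map `α` of the paper. -/
def adjoint : A →ₗ[K] A →ₗ[K] A := (TensorProduct.curry (D.mulAntipode ∘ₗ D.T₄)).flip

lemma adjoint_apply (a x : A) : D.adjoint a x = D.mulAntipode (D.T₄ (x ⊗ₜ a)) := rfl

lemma adjoint_mem_A₀ (a x : A) : D.adjoint a x ∈ D.A₀ :=
  D.range_mulAntipode_T₄ ▸ LinearMap.mem_range_self (D.mulAntipode ∘ₗ D.T₄) (x ⊗ₜ a)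

lemma mulAntipode_Δₗ (a : A) (z : A ⊗[K] A) :
    D.mulAntipode (D.Δₗ a z) = D.adjoint a (D.mulAntipode z) := by
  refine eq_of_tmul (f := D.mulAntipode ∘ₗ D.Δₗ a) (g := D.adjoint a ∘ₗ D.mulAntipode)
    (fun p q => ?_) z
  have mul_tmul : D.mulAntipode (p ⊗ₜ q) ⊗ₜ[K] a = rTensor A (D.mul.flip (D.S q)) (p ⊗ₜ a) := by
    rw [mulAntipode_tmul]; rfl
  rw [LinearMap.comp_apply, LinearMap.comp_apply, adjoint_apply, mul_tmul, T₄_rTensor_mul_flip,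
    mulAntipode_rTensor_mul_flip_S, Δₗ_eq_T₄]

lemma adjoint_mul (a b x : A) : D.adjoint (D.mul a b) x = D.adjoint a (D.adjoint b x) := by
  rw [D.adjoint_apply b, ← mulAntipode_Δₗ, Δₗ_T₄, LinearMap.lTensor_tmul, adjoint_apply]

lemma adjoint_mul_S (a x r : A) :
    D.mul (D.adjoint a x) (D.S r) =
      D.mulAntipode (rTensor A (D.mul.flip x) (D.T₃ (a ⊗ₜ r))) := by
  rw [adjoint_apply, ← mulAntipode_lTensor_mul, T₃_T₄]

lemma adjoint_mul_eq_lift_R₁ (p x v : A) : D.mul (D.adjoint p x) v =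
    TensorProduct.lift D.mul (rTensor A (D.mul.flip x) (D.R₁ (p ⊗ₜ v))) := by
  rw [adjoint_apply, mulAntipode_mul]
  congr 1
  refine D.eq_of_rTensor_mul fun u => ?_
  rw [rTensor_lTensor_comm, T₂_T₄, ← rTensor_lTensor_comm, lTensor_antipodeMulBy_T₂,
    ← LinearMap.rTensor_comp_apply, ← LinearMap.rTensor_comp_apply, mul_comp_mul_flip]

lemma lift_mul_map_adjoint (x u : A) (z : A ⊗[K] A) :
    TensorProduct.lift D.mul (TensorProduct.map (D.adjoint.flip x) (D.mul.flip u) z) =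
      TensorProduct.lift D.mul
        (rTensor A (D.mul.flip x) (D.R₁ (lTensor A (D.mul.flip u) z))) :=
  eq_of_tmul
    (f := TensorProduct.lift D.mul ∘ₗ TensorProduct.map (D.adjoint.flip x) (D.mul.flip u))
    (g := TensorProduct.lift D.mul ∘ₗ rTensor A (D.mul.flip x) ∘ₗ D.R₁ ∘ₗ
      lTensor A (D.mul.flip u))
    (fun p q => D.adjoint_mul_eq_lift_R₁ p x (D.mul q u)) z

lemma lift_mul_rTensor_mul (g : A) (z : A ⊗[K] A) :
    TensorProduct.lift D.mul (rTensor A (D.mul g) z) = D.mul g (TensorProduct.lift D.mul z) :=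
  eq_of_tmul (f := TensorProduct.lift D.mul ∘ₗ rTensor A (D.mul g))
    (g := D.mul g ∘ₗ TensorProduct.lift D.mul) (fun p q => D.mul_assoc g p q) z

lemma lift_mul_map_adjoint_T₄ (x u c g : A) :
    TensorProduct.lift D.mul
      (TensorProduct.map (D.adjoint.flip x) (D.mul.flip u) (D.T₄ (c ⊗ₜ g))) =
      D.mul g (D.mul (D.adjoint c x) u) := by
  rw [lift_mul_map_adjoint, Δₗ_eq_T₄, R₁_Δₗ, ← LinearMap.rTensor_comp_apply, ← mul_comp_mul_flip,
    LinearMap.rTensor_comp_apply, lift_mul_rTensor_mul, ← adjoint_mul_eq_lift_R₁]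

/-- The map `a ⊗ b ⊗ r ↦ (a ▹ x) b y S(r)`. -/
def adjointTriple (x y : A) : A ⊗[K] (A ⊗[K] A) →ₗ[K] A :=
  TensorProduct.lift D.mul ∘ₗ
    TensorProduct.map (D.adjoint.flip x) (D.mulAntipode ∘ₗ rTensor A (D.mul.flip y))

lemma adjointTriple_T₃ (x y r : A) (z : A ⊗[K] A) :
    D.adjointTriple x y (lTensor A D.T₃ (TensorProduct.assoc K A A A (z ⊗ₜ r))) =
      D.mul (TensorProduct.lift D.mul
        (TensorProduct.map (D.adjoint.flip x) (D.adjoint.flip y) z)) (D.S r) := by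
  refine eq_of_tmul (f := D.adjointTriple x y ∘ₗ lTensor A D.T₃ ∘ₗ
      (TensorProduct.assoc K A A A).toLinearMap ∘ₗ (TensorProduct.mk K (A ⊗[K] A) A).flip r)
    (g := D.mul.flip (D.S r) ∘ₗ TensorProduct.lift D.mul ∘ₗ
      TensorProduct.map (D.adjoint.flip x) (D.adjoint.flip y)) (fun p q => ?_) z
  change D.mul (D.adjoint p x) (D.mulAntipode (rTensor A (D.mul.flip y) (D.T₃ (q ⊗ₜ r)))) =
    D.mul (D.mul (D.adjoint p x) (D.adjoint q y)) (D.S r)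
  rw [mul_assoc, adjoint_mul_S]

lemma adjointTriple_assoc (x y h : A) (z : A ⊗[K] A) :
    D.adjointTriple x y (TensorProduct.assoc K A A A (z ⊗ₜ h)) = TensorProduct.lift D.mul
      (TensorProduct.map (D.adjoint.flip x) (D.mul.flip (D.mul y (D.S h))) z) :=
  eq_of_tmul (f := D.adjointTriple x y ∘ₗ (TensorProduct.assoc K A A A).toLinearMap ∘ₗ
      (TensorProduct.mk K (A ⊗[K] A) A).flip h)
    (g := TensorProduct.lift D.mul ∘ₗ
      TensorProduct.map (D.adjoint.flip x) (D.mul.flip (D.mul y (D.S h))))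
    (fun p q => by simp [adjointTriple, mulAntipode_tmul, D.mul_assoc]) z

lemma adjointTriple_onFirstTwo_T₄ (x y c : A) (z : A ⊗[K] A) :
    D.adjointTriple x y (onFirstTwo A D.T₄ (c ⊗ₜ z)) =
      D.mulAntipode (rTensor A (D.mul.flip (D.mul (D.adjoint c x) y)) z) := by
  refine eq_of_tmul
    (f := D.adjointTriple x y ∘ₗ onFirstTwo A D.T₄ ∘ₗ TensorProduct.mk K A (A ⊗[K] A) c)
    (g := D.mulAntipode ∘ₗ rTensor A (D.mul.flip (D.mul (D.adjoint c x) y))) (fun g h => ?_) z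
  refine (D.adjointTriple_assoc x y h (D.T₄ (c ⊗ₜ g))).trans ?_
  rw [lift_mul_map_adjoint_T₄, LinearMap.comp_apply, LinearMap.rTensor_tmul, mulAntipode_tmul,
    LinearMap.flip_apply, mul_assoc, mul_assoc]

/-- `∑ (a₍₁₎ c ▹ x) (a₍₂₎ ▹ y) = a ▹ ((c ▹ x) y)`. -/
lemma lift_mul_map_adjoint_adjoint_T₄ (a c x y : A) :
    TensorProduct.lift D.mul
      (TensorProduct.map (D.adjoint.flip x) (D.adjoint.flip y) (D.T₄ (c ⊗ₜ a))) =
      D.adjoint a (D.mul (D.adjoint c x) y) := by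
  refine D.eq_of_mul_right fun v => ?_
  obtain ⟨r, rfl⟩ := D.S_surjective v
  rw [adjoint_mul_S, ← adjointTriple_T₃, ← adjointTriple_onFirstTwo_T₄, D.T₄_comm_T₃ c (a ⊗ₜ r)]
  rfl

end Adjoint

end HopfData

/-! ### Multipliers -/

section TripleTensor

variable {K U V W : Type*} [CommSemiring K] [AddCommMonoid U] [Module K U]
  [AddCommMonoid V] [Module K V] [AddCommMonoid W] [Module K W]

lemma lTensor_sliceLeft_assoc (ω : V →ₗ[K] K) (z : (U ⊗[K] V) ⊗[K] W) :
    lTensor U (sliceLeft ω) (TensorProduct.assoc K U V W z) = rTensor W (sliceRight ω) z := by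
  refine eq_of_tmul (f := lTensor U (sliceLeft ω) ∘ₗ (TensorProduct.assoc K U V W).toLinearMap)
    (g := rTensor W (sliceRight ω)) (fun u w => ?_) z
  exact eq_of_tmul (f := lTensor U (sliceLeft ω) ∘ₗ (TensorProduct.assoc K U V W).toLinearMap ∘ₗ
    (TensorProduct.mk K (U ⊗[K] V) W).flip w) (g := (TensorProduct.mk K U W).flip w ∘ₗ sliceRight ω)
    (fun _ _ => by simp) u

lemma sliceLeft_leftComm (ω : V →ₗ[K] K) (z : U ⊗[K] (V ⊗[K] W)) :
    sliceLeft ω (TensorProduct.leftComm K U V W z) = lTensor U (sliceLeft ω) z := by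
  refine eq_of_tmul (f := sliceLeft ω ∘ₗ (TensorProduct.leftComm K U V W).toLinearMap)
    (g := lTensor U (sliceLeft ω)) (fun u w => ?_) z
  exact eq_of_tmul (f := sliceLeft ω ∘ₗ (TensorProduct.leftComm K U V W).toLinearMap ∘ₗ
    TensorProduct.mk K U (V ⊗[K] W) u) (g := TensorProduct.mk K U W u ∘ₗ sliceLeft ω)
    (fun _ _ => by simp) w

lemma lTensor_sliceLeft_leftComm (ω : U →ₗ[K] K) (z : U ⊗[K] (V ⊗[K] W)) :
    lTensor V (sliceLeft ω) (TensorProduct.leftComm K U V W z) = sliceLeft ω z := by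
  refine eq_of_tmul (f := lTensor V (sliceLeft ω) ∘ₗ (TensorProduct.leftComm K U V W).toLinearMap)
    (g := sliceLeft ω) (fun u w => ?_) z
  exact eq_of_tmul (f := lTensor V (sliceLeft ω) ∘ₗ (TensorProduct.leftComm K U V W).toLinearMap ∘ₗ
    TensorProduct.mk K U (V ⊗[K] W) u) (g := ω u • LinearMap.id) (fun _ _ => by simp) w

lemma sliceRight_rightComm (ω : V →ₗ[K] K) (z : (U ⊗[K] V) ⊗[K] W) :
    sliceRight ω (TensorProduct.rightComm K U V W z) = rTensor W (sliceRight ω) z := by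
  refine eq_of_tmul (f := sliceRight ω ∘ₗ (TensorProduct.rightComm K U V W).toLinearMap)
    (g := rTensor W (sliceRight ω)) (fun u w => ?_) z
  exact eq_of_tmul (f := sliceRight ω ∘ₗ (TensorProduct.rightComm K U V W).toLinearMap ∘ₗ
    (TensorProduct.mk K (U ⊗[K] V) W).flip w) (g := (TensorProduct.mk K U W).flip w ∘ₗ sliceRight ω)
    (fun _ _ => by simp [TensorProduct.smul_tmul']) u

lemma rTensor_sliceRight_rightComm (ω : W →ₗ[K] K) (z : (U ⊗[K] V) ⊗[K] W) :
    rTensor V (sliceRight ω) (TensorProduct.rightComm K U V W z) = sliceRight ω z := by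
  rw [← sliceRight_rightComm, ← TensorProduct.rightComm_symm, LinearEquiv.symm_apply_apply]

lemma lTensor_sliceLeft_onFirstTwo_leftComm (X : U ⊗[K] V →ₗ[K] U ⊗[K] V) (ω : V →ₗ[K] K)
    (b : V) (z : U ⊗[K] W) :
    lTensor U (sliceLeft ω) (onFirstTwo W X (TensorProduct.leftComm K V U W (b ⊗ₜ z))) =
      rTensor W (legLeft X b ω) z :=
  eq_of_tmul (f := lTensor U (sliceLeft ω) ∘ₗ onFirstTwo W X ∘ₗ
    (TensorProduct.leftComm K V U W).toLinearMap ∘ₗ TensorProduct.mk K V (U ⊗[K] W) b)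
    (g := rTensor W (legLeft X b ω))
    (fun u w => lTensor_sliceLeft_assoc ω (X (u ⊗ₜ b) ⊗ₜ w)) z

lemma lTensor_onFirstTwo {U' : Type*} [AddCommMonoid U'] [Module K U']
    (Y : U ⊗[K] V →ₗ[K] U ⊗[K] V) (X : V ⊗[K] W →ₗ[K] U') (c : U) (b : V) (d : W) :
    lTensor U X (onFirstTwo W Y (c ⊗ₜ (b ⊗ₜ d))) =
      lTensor U (X ∘ₗ (TensorProduct.mk K V W).flip d) (Y (c ⊗ₜ b)) :=
  eq_of_tmul (f := lTensor U X ∘ₗ (TensorProduct.assoc K U V W).toLinearMap ∘ₗ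
    (TensorProduct.mk K (U ⊗[K] V) W).flip d)
    (g := lTensor U (X ∘ₗ (TensorProduct.mk K V W).flip d)) (fun _ _ => rfl) (Y (c ⊗ₜ b))

end TripleTensor

namespace IsNondegenerate

variable {A : Type*} [NonUnitalRing A]

lemma eq_of_mul_right (h : IsNondegenerate A) {x y : A} (hxy : ∀ b, x * b = y * b) : x = y :=
  sub_eq_zero.1 <| h.1 _ fun b => by rw [sub_mul, hxy, sub_self]

lemma eq_of_mul_left (h : IsNondegenerate A) {x y : A} (hxy : ∀ b, b * x = b * y) : x = y :=
  sub_eq_zero.1 <| h.2 _ fun b => by rw [mul_sub, hxy, sub_self]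

variable {B : Type*} [NonUnitalRing B] [Module ℂ B] [IsScalarTower ℂ B B] [SMulCommClass ℂ B B]
variable [Module ℂ A] [IsScalarTower ℂ A A] [SMulCommClass ℂ A A]

lemma tensorProduct (hA : IsNondegenerate A) (hB : IsNondegenerate B) :
    IsNondegenerate (A ⊗[ℂ] B) := by
  have mul_tmul (z : A ⊗[ℂ] B) (a : A) (b : B) : z * (a ⊗ₜ b) =
      rTensor B ((LinearMap.mul ℂ A).flip a) (lTensor A ((LinearMap.mul ℂ B).flip b) z) :=
    eq_of_tmul (f := (LinearMap.mul ℂ (A ⊗[ℂ] B)).flip (a ⊗ₜ b))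
      (g := rTensor B ((LinearMap.mul ℂ A).flip a) ∘ₗ lTensor A ((LinearMap.mul ℂ B).flip b))
      (fun _ _ => by simp) z
  have tmul_mul (z : A ⊗[ℂ] B) (a : A) (b : B) : (a ⊗ₜ b) * z =
      rTensor B (LinearMap.mul ℂ A a) (lTensor A (LinearMap.mul ℂ B b) z) :=
    eq_of_tmul (f := LinearMap.mul ℂ (A ⊗[ℂ] B) (a ⊗ₜ b))
      (g := rTensor B (LinearMap.mul ℂ A a) ∘ₗ lTensor A (LinearMap.mul ℂ B b))
      (fun _ _ => by simp) z
  constructor <;> intro z hz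
  · exact eq_of_lTensor (fun _ _ => hB.eq_of_mul_right) fun b =>
      eq_of_rTensor (fun _ _ => hA.eq_of_mul_right) fun a =>
        (mul_tmul z a b).symm.trans <| by simp only [hz, map_zero]
  · exact eq_of_lTensor (fun _ _ => hB.eq_of_mul_left) fun b =>
      eq_of_rTensor (fun _ _ => hA.eq_of_mul_left) fun a =>
        (tmul_mul z a b).symm.trans <| by simp only [hz, map_zero]

end IsNondegenerate

namespace Multiplier

variable {A : Type*} [NonUnitalRing A] [Module ℂ A] [IsScalarTower ℂ A A] [SMulCommClass ℂ A A]
variable {B : Type*} [NonUnitalRing B] [Module ℂ B] [IsScalarTower ℂ B B] [SMulCommClass ℂ B B]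

lemma of_left (a b : A) : (of a).left b = a * b := rfl

lemma of_right (a b : A) : (of a).right b = b * a := rfl

lemma mul_left_apply (m n : Multiplier A) (a : A) : (m * n).left a = m.left (n.left a) := rfl

lemma mul_right_apply (m n : Multiplier A) (a : A) : (m * n).right a = n.right (m.right a) := rfl

lemma left_mul (m : Multiplier A) (a b : A) : m.left (a * b) = m.left a * b := m.2.1 a b

lemma right_mul (m : Multiplier A) (a b : A) : m.right (a * b) = a * m.right b := m.2.2.1 a b

lemma right_mul_eq (m : Multiplier A) (a b : A) : m.right a * b = a * m.left b := m.2.2.2 a b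

lemma ext_left_right {m n : Multiplier A} (hl : ∀ a, m.left a = n.left a)
    (hr : ∀ a, m.right a = n.right a) : m = n :=
  Subtype.ext (Prod.ext (LinearMap.ext hl) (MulOpposite.unop_injective (LinearMap.ext hr)))

lemma ext_left (h : IsNondegenerate A) {m n : Multiplier A} (hmn : ∀ a, m.left a = n.left a) :
    m = n :=
  ext_left_right hmn fun a => h.eq_of_mul_right fun b => by rw [right_mul_eq, right_mul_eq, hmn]

lemma ext_right (h : IsNondegenerate A) {m n : Multiplier A}
    (hmn : ∀ a, m.right a = n.right a) : m = n :=
  ext_left h fun a => h.eq_of_mul_left fun b => by rw [← right_mul_eq, ← right_mul_eq, hmn]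

lemma of_injective (h : IsNondegenerate A) : Function.Injective (of : A → Multiplier A) :=
  fun x y hxy => h.eq_of_mul_right fun b => by rw [← of_left, hxy, of_left]

lemma of_apply_left (m : Multiplier A) (a : A) : of (m.left a) = m * of a :=
  ext_left_right (fun b => (left_mul m a b).symm) (fun b => (right_mul_eq m b a).symm)

lemma of_apply_right (m : Multiplier A) (a : A) : of (m.right a) = of a * m :=
  ext_left_right (fun b => right_mul_eq m a b) (fun b => (right_mul m b a).symm)

lemma tmul_mul_tmul (m m' : Multiplier A) (n n' : Multiplier B) :
    tmul m n * tmul m' n' = tmul (m * m') (n * n') :=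
  ext_left_right
    (eq_of_tmul (f := (tmul m n * tmul m' n').left) (g := (tmul (m * m') (n * n')).left)
      fun _ _ => rfl)
    (eq_of_tmul (f := (tmul m n * tmul m' n').right) (g := (tmul (m * m') (n * n')).right)
      fun _ _ => rfl)

lemma of_tmul (a : A) (b : B) : of (a ⊗ₜ[ℂ] b) = tmul (of a) (of b) :=
  ext_left_right
    (eq_of_tmul (f := (of (a ⊗ₜ[ℂ] b)).left) (g := (tmul (of a) (of b)).left)
      fun c d => Algebra.TensorProduct.tmul_mul_tmul a c b d)
    (eq_of_tmul (f := (of (a ⊗ₜ[ℂ] b)).right) (g := (tmul (of a) (of b)).right)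
      fun c d => Algebra.TensorProduct.tmul_mul_tmul c a d b)

lemma of_tmul_eq_mul (a : A) (b : B) : of (a ⊗ₜ[ℂ] b) = tmul (of a) 1 * tmul 1 (of b) := by
  rw [of_tmul, tmul_mul_tmul, mul_one, one_mul]

lemma of_tmul_eq_mul_rev (a : A) (b : B) : of (a ⊗ₜ[ℂ] b) = tmul 1 (of b) * tmul (of a) 1 := by
  rw [of_tmul, tmul_mul_tmul, mul_one, one_mul]

lemma of_rTensor_mul (a : A) (z : A ⊗[ℂ] B) :
    of (rTensor B (LinearMap.mul ℂ A a) z) = tmul (of a) 1 * of z :=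
  of_apply_left (tmul (of a) 1) z

lemma of_lTensor_mul (b : B) (z : A ⊗[ℂ] B) :
    of (lTensor A (LinearMap.mul ℂ B b) z) = tmul 1 (of b) * of z :=
  of_apply_left (tmul 1 (of b)) z

lemma of_rTensor_mul_flip (a : A) (z : A ⊗[ℂ] B) :
    of (rTensor B ((LinearMap.mul ℂ A).flip a) z) = of z * tmul (of a) 1 :=
  of_apply_right (tmul (of a) 1) z

lemma of_lTensor_mul_flip (b : B) (z : A ⊗[ℂ] B) :
    of (lTensor A ((LinearMap.mul ℂ B).flip b) z) = of z * tmul 1 (of b) :=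
  of_apply_right (tmul 1 (of b)) z

section Flip

lemma flip_left (m : Multiplier (A ⊗[ℂ] A)) : (flip m).left = flipConj m.left := rfl

lemma flip_right (m : Multiplier (A ⊗[ℂ] A)) : (flip m).right = flipConj m.right := rfl

lemma flip_mul (m n : Multiplier (A ⊗[ℂ] A)) : flip (m * n) = flip m * flip n :=
  ext_left_right (fun a => by simp [mul_left_apply, flip_left])
    (fun a => by simp [mul_right_apply, flip_right])

lemma flip_flip (m : Multiplier (A ⊗[ℂ] A)) : flip (flip m) = m :=
  ext_left_right (fun a => by simp only [flip_left, flipConj_flipConj])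
    (fun a => by simp only [flip_right, flipConj_flipConj])

lemma flip_tmul (m n : Multiplier A) : flip (tmul m n) = tmul n m :=
  ext_left_right
    (eq_of_tmul (f := (flip (tmul m n)).left) (g := (tmul n m).left) fun _ _ => rfl)
    (eq_of_tmul (f := (flip (tmul m n)).right) (g := (tmul n m).right) fun _ _ => rfl)

lemma comm_mul (z w : A ⊗[ℂ] A) : TensorProduct.comm ℂ A A (z * w) =
    TensorProduct.comm ℂ A A z * TensorProduct.comm ℂ A A w := by
  induction z with
  | zero => simp
  | add z z' hz hz' => simp only [add_mul, map_add, hz, hz']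
  | tmul a b =>
    induction w with
    | zero => simp
    | add w w' hw hw' => simp only [mul_add, map_add, hw, hw']
    | tmul c d => simp

lemma of_comm (z : A ⊗[ℂ] A) : of (TensorProduct.comm ℂ A A z) = flip (of z) :=
  ext_left_right (fun w => by simp [of_left, flip_left, comm_mul])
    (fun w => by simp [of_right, flip_right, comm_mul])

end Flip

end Multiplier

namespace WeakMultiplierHopfAlgebra

variable {A : Type*} [NonUnitalRing A] [Module ℂ A] [IsScalarTower ℂ A A] [SMulCommClass ℂ A A]
variable (H : WeakMultiplierHopfAlgebra A)

include H in
lemma nondegenerate_tensor : IsNondegenerate (A ⊗[ℂ] A) :=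
  H.nondegenerate.tensorProduct H.nondegenerate

include H in
lemma of_tensor_injective : Function.Injective (of : A ⊗[ℂ] A → Multiplier (A ⊗[ℂ] A)) :=
  of_injective H.nondegenerate_tensor

lemma rTensor_mul_T₁ (a b c : A) : rTensor A (LinearMap.mul ℂ A c) (H.T₁ (a ⊗ₜ b)) =
    lTensor A ((LinearMap.mul ℂ A).flip b) (H.T₂ (c ⊗ₜ a)) := H.of_tensor_injective <| by
  rw [of_rTensor_mul, of_lTensor_mul_flip, H.of_T₁, H.of_T₂, mul_assoc]

lemma rTensor_mul_flip_T₁ (a x b : A) :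
    rTensor A ((LinearMap.mul ℂ A).flip x) (H.T₁ (a ⊗ₜ b)) = (H.Δ a).left (x ⊗ₜ b) :=
  H.of_tensor_injective <| by
    rw [of_rTensor_mul_flip, H.of_T₁, of_apply_left, of_tmul_eq_mul_rev, mul_assoc]

lemma lTensor_mul_T₂ (a x y : A) :
    lTensor A (LinearMap.mul ℂ A y) (H.T₂ (x ⊗ₜ a)) = (H.Δ a).right (x ⊗ₜ y) :=
  H.of_tensor_injective <| by
    rw [of_lTensor_mul, H.of_T₂, of_apply_right, of_tmul_eq_mul_rev, mul_assoc]

lemma Δ_left_T₁ (d : A) (z : A ⊗[ℂ] A) :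
    (H.Δ d).left (H.T₁ z) = H.T₁ (rTensor A (LinearMap.mul ℂ A d) z) :=
  eq_of_tmul (f := (H.Δ d).left ∘ₗ H.T₁) (g := H.T₁ ∘ₗ rTensor A (LinearMap.mul ℂ A d))
    (fun a b => H.of_tensor_injective <| by
      simp only [LinearMap.comp_apply, LinearMap.rTensor_tmul, LinearMap.mul_apply',
        of_apply_left, H.of_T₁, map_mul, mul_assoc]) z

lemma Δ_right_T₂ (d : A) (z : A ⊗[ℂ] A) :
    (H.Δ d).right (H.T₂ z) = H.T₂ (lTensor A ((LinearMap.mul ℂ A).flip d) z) :=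
  eq_of_tmul (f := (H.Δ d).right ∘ₗ H.T₂) (g := H.T₂ ∘ₗ lTensor A ((LinearMap.mul ℂ A).flip d))
    (fun a b => H.of_tensor_injective <| by
      simp only [LinearMap.comp_apply, LinearMap.lTensor_tmul, LinearMap.flip_apply,
        LinearMap.mul_apply', of_apply_right, H.of_T₂, map_mul, mul_assoc]) z

lemma E_left_right (u v x y : A) :
    rTensor A (LinearMap.mul ℂ A u) (lTensor A (LinearMap.mul ℂ A v) (H.E.left (x ⊗ₜ y))) =
      rTensor A ((LinearMap.mul ℂ A).flip x) (lTensor A ((LinearMap.mul ℂ A).flip y)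
        (H.E.right (u ⊗ₜ v))) := H.of_tensor_injective <| by
  rw [of_rTensor_mul, of_lTensor_mul, of_rTensor_mul_flip, of_lTensor_mul_flip, of_apply_left,
    of_apply_right, of_tmul_eq_mul u, of_tmul_eq_mul_rev x]
  simp only [mul_assoc]

lemma E_left_E_left (z : A ⊗[ℂ] A) : H.E.left (H.E.left z) = H.E.left z := by
  rw [← mul_left_apply, H.E_mul_E]

lemma E_right_E_right (z : A ⊗[ℂ] A) : H.E.right (H.E.right z) = H.E.right z := by
  rw [← mul_right_apply, H.E_mul_E]

lemma E_left_T₁ (z : A ⊗[ℂ] A) : H.E.left (H.T₁ z) = H.T₁ z := by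
  obtain ⟨w, hw⟩ : H.T₁ z ∈ LinearMap.range H.E.left := H.range_T₁ ▸ ⟨z, rfl⟩
  rw [← hw, E_left_E_left]

lemma E_right_T₂ (z : A ⊗[ℂ] A) : H.E.right (H.T₂ z) = H.T₂ z := by
  obtain ⟨w, hw⟩ : H.T₂ z ∈ LinearMap.range H.E.right := H.range_T₂ ▸ ⟨z, rfl⟩
  rw [← hw, E_right_E_right]

lemma E_mul_Δ (a : A) : H.E * H.Δ a = H.Δ a :=
  ext_left H.nondegenerate_tensor <| eq_of_tmul (f := (H.E * H.Δ a).left) (g := (H.Δ a).left)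
    fun x b => H.of_tensor_injective <| by
      rw [mul_left_apply, ← rTensor_mul_flip_T₁, of_apply_left, of_rTensor_mul_flip, ← mul_assoc,
        ← of_apply_left, E_left_T₁]

lemma Δ_mul_E (a : A) : H.Δ a * H.E = H.Δ a :=
  ext_right H.nondegenerate_tensor <| eq_of_tmul (f := (H.Δ a * H.E).right) (g := (H.Δ a).right)
    fun x b => H.of_tensor_injective <| by
      rw [mul_right_apply, ← lTensor_mul_T₂, of_apply_right, of_lTensor_mul, mul_assoc,
        ← of_apply_right, E_right_T₂]

lemma mul_E_eq_of_mul_Δ {m : Multiplier (A ⊗[ℂ] A)} (hm : ∀ a, m * H.Δ a = H.Δ a) :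
    m * H.E = H.E := by
  have left_T₁ : ∀ z, m.left (H.T₁ z) = H.T₁ z :=
    eq_of_tmul (f := m.left ∘ₗ H.T₁) (g := H.T₁) fun a b => H.of_tensor_injective <| by
      rw [LinearMap.comp_apply, of_apply_left, H.of_T₁, ← mul_assoc, hm]
  refine ext_left H.nondegenerate_tensor fun z => ?_
  obtain ⟨w, hw⟩ : H.E.left z ∈ LinearMap.range H.T₁ := H.range_T₁ ▸ ⟨z, rfl⟩
  rw [mul_left_apply, ← hw, left_T₁]

lemma E_mul_eq_of_Δ_mul {m : Multiplier (A ⊗[ℂ] A)} (hm : ∀ a, H.Δ a * m = H.Δ a) :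
    H.E * m = H.E := by
  have right_T₂ : ∀ z, m.right (H.T₂ z) = H.T₂ z :=
    eq_of_tmul (f := m.right ∘ₗ H.T₂) (g := H.T₂) fun a b => H.of_tensor_injective <| by
      rw [LinearMap.comp_apply, of_apply_right, H.of_T₂, mul_assoc, hm]
  refine ext_right H.nondegenerate_tensor fun z => ?_
  obtain ⟨w, hw⟩ : H.E.right z ∈ LinearMap.range H.T₂ := H.range_T₂ ▸ ⟨z, rfl⟩
  rw [mul_right_apply, ← hw, right_T₂]

lemma legsCommute_T₂_T₁ : LegsCommute H.T₂ H.T₁ := fun c z =>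
  eq_of_tmul (f := onFirstTwo A H.T₂ ∘ₗ TensorProduct.mk ℂ A _ c ∘ₗ H.T₁)
    (g := lTensor A H.T₁ ∘ₗ onFirstTwo A H.T₂ ∘ₗ TensorProduct.mk ℂ A _ c)
    (fun a b => H.coassoc a b c) z

lemma legsCommute_E_left : LegsCommute H.E.left H.E.left := fun c z =>
  LinearMap.congr_fun (congrArg Multiplier.left H.E_comm) (c ⊗ₜ z)

lemma legsCommute_E_right : LegsCommute H.E.right H.E.right := fun c z =>
  (LinearMap.congr_fun (congrArg Multiplier.right H.E_comm) (c ⊗ₜ z)).symm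

section CoproductOnSecondLeg

/-- The map `ι ⊗ Δ` on `A ⊗ A`, with values in the multipliers. -/
def idΔ : A ⊗[ℂ] A →ₗ[ℂ] Multiplier (A ⊗[ℂ] (A ⊗[ℂ] A)) :=
  TensorProduct.lift ((tmul (A := A) (B := A ⊗[ℂ] A)).compl₁₂ of (H.Δ : A →ₗ[ℂ] _))

lemma idΔ_tmul (a b : A) : H.idΔ (a ⊗ₜ b) = tmul (of a) (H.Δ b) := rfl

lemma E_mul_idΔ (z : A ⊗[ℂ] A) : assoc (tmul H.E 1) * H.idΔ z = H.idΔ (H.E.left z) := by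
  have one_E_mul : tmul 1 H.E * H.idΔ z = H.idΔ z := by
    induction z with
    | zero => rw [map_zero, mul_zero]
    | add z z' hz hz' => rw [map_add, mul_add, hz, hz']
    | tmul a b => rw [idΔ_tmul, tmul_mul_tmul, one_mul, E_mul_Δ]
  calc assoc (tmul H.E 1) * H.idΔ z
    _ = assoc (tmul H.E 1) * tmul 1 H.E * H.idΔ z := by rw [mul_assoc, one_E_mul]
    _ = H.idΔ (H.E.left z) := H.id_Δ_E.mul_left z

lemma idΔ_mul_E (z : A ⊗[ℂ] A) : H.idΔ z * assoc (tmul H.E 1) = H.idΔ (H.E.right z) := by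
  have mul_one_E : H.idΔ z * tmul 1 H.E = H.idΔ z := by
    induction z with
    | zero => rw [map_zero, zero_mul]
    | add z z' hz hz' => rw [map_add, add_mul, hz, hz']
    | tmul a b => rw [idΔ_tmul, tmul_mul_tmul, mul_one, Δ_mul_E]
  calc H.idΔ z * assoc (tmul H.E 1)
    _ = H.idΔ z * (assoc (tmul H.E 1) * tmul 1 H.E) := by
      rw [H.E_comm, ← mul_assoc, mul_one_E]
    _ = H.idΔ (H.E.right z) := H.id_Δ_E.mul_right z

lemma idΔ_mul_one_tmul {X : A →ₗ[ℂ] A ⊗[ℂ] A} {n : Multiplier (A ⊗[ℂ] A)}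
    (hX : ∀ b, of (X b) = H.Δ b * n) (z : A ⊗[ℂ] A) :
    H.idΔ z * tmul 1 n = of (lTensor A X z) := by
  induction z with
  | zero => simp only [map_zero, zero_mul]
  | add z z' hz hz' => simp only [map_add, add_mul, hz, hz']
  | tmul a b => rw [idΔ_tmul, LinearMap.lTensor_tmul, of_tmul, hX, tmul_mul_tmul, mul_one]

lemma one_tmul_mul_idΔ {X : A →ₗ[ℂ] A ⊗[ℂ] A} {n : Multiplier (A ⊗[ℂ] A)}
    (hX : ∀ b, of (X b) = n * H.Δ b) (z : A ⊗[ℂ] A) :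
    tmul 1 n * H.idΔ z = of (lTensor A X z) := by
  induction z with
  | zero => simp only [map_zero, mul_zero]
  | add z z' hz hz' => simp only [map_add, mul_add, hz, hz']
  | tmul a b => rw [idΔ_tmul, LinearMap.lTensor_tmul, of_tmul, hX, tmul_mul_tmul, one_mul]

lemma onFirstTwo_E_left_lTensor {X : A →ₗ[ℂ] A ⊗[ℂ] A} {n : Multiplier (A ⊗[ℂ] A)}
    (hX : ∀ b, of (X b) = H.Δ b * n) (z : A ⊗[ℂ] A) :
    onFirstTwo A H.E.left (lTensor A X z) = lTensor A X (H.E.left z) := by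
  refine of_injective (H.nondegenerate.tensorProduct H.nondegenerate_tensor) ?_
  change of ((assoc (tmul H.E 1)).left (lTensor A X z)) = _
  rw [of_apply_left, ← H.idΔ_mul_one_tmul hX, ← H.idΔ_mul_one_tmul hX, ← mul_assoc, E_mul_idΔ]

lemma onFirstTwo_E_right_lTensor {X : A →ₗ[ℂ] A ⊗[ℂ] A} {n : Multiplier (A ⊗[ℂ] A)}
    (hX : ∀ b, of (X b) = n * H.Δ b) (z : A ⊗[ℂ] A) :
    onFirstTwo A H.E.right (lTensor A X z) = lTensor A X (H.E.right z) := by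
  refine of_injective (H.nondegenerate.tensorProduct H.nondegenerate_tensor) ?_
  change of ((assoc (tmul H.E 1)).right (lTensor A X z)) = _
  rw [of_apply_right, ← H.one_tmul_mul_idΔ hX, ← H.one_tmul_mul_idΔ hX, mul_assoc, idΔ_mul_E]

lemma legsCommute_E_left_T₁ : LegsCommute H.E.left H.T₁ := fun c z =>
  eq_of_tmul (f := onFirstTwo A H.E.left ∘ₗ TensorProduct.mk ℂ A _ c ∘ₗ H.T₁)
    (g := lTensor A H.T₁ ∘ₗ onFirstTwo A H.E.left ∘ₗ TensorProduct.mk ℂ A _ c)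
    (fun b d => (H.onFirstTwo_E_left_lTensor (X := H.T₁ ∘ₗ (TensorProduct.mk ℂ A A).flip d)
      (fun b => H.of_T₁ b d) (c ⊗ₜ b)).trans (lTensor_onFirstTwo _ _ c b d).symm) z

lemma T₂_lTensor_legRight_E (c : A) (ω : A →ₗ[ℂ] ℂ) (z : A ⊗[ℂ] A) :
    H.T₂ (lTensor A (legRight H.E.right c ω) z) = rTensor A (legRight H.E.right c ω) (H.T₂ z) := by
  refine eq_of_tmul (f := H.T₂ ∘ₗ lTensor A (legRight H.E.right c ω))
    (g := rTensor A (legRight H.E.right c ω) ∘ₗ H.T₂) (fun d b => ?_) z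
  have h := congrArg (sliceLeft ω) (H.onFirstTwo_E_right_lTensor
    (X := H.T₂ ∘ₗ TensorProduct.mk ℂ A A d) (fun b => H.of_T₂ d b) (c ⊗ₜ b))
  rw [LinearMap.lTensor_tmul, sliceLeft_onFirstTwo, sliceLeft_lTensor] at h
  exact h.symm

end CoproductOnSecondLeg

lemma rTensor_legLeft_G₁ (b : A) (ω : A →ₗ[ℂ] ℂ) (z : A ⊗[ℂ] A) :
    rTensor A (legLeft H.G₁ b ω) (H.T₁ z) = H.T₁ (lTensor A (legRight H.E.left b ω) z) := by
  refine eq_of_tmul (f := rTensor A (legLeft H.G₁ b ω) ∘ₗ H.T₁)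
    (g := H.T₁ ∘ₗ lTensor A (legRight H.E.left b ω)) (fun a d => ?_) z
  have T₁_sliceLeft (u : A ⊗[ℂ] A) : lTensor A (sliceLeft ω) (TensorProduct.leftComm ℂ A A A
      (lTensor A H.T₁ (TensorProduct.leftComm ℂ A A A (a ⊗ₜ u)))) =
        H.T₁ (a ⊗ₜ sliceLeft ω u) := by
    rw [lTensor_sliceLeft_leftComm, sliceLeft_lTensor, sliceLeft_leftComm, LinearMap.lTensor_tmul]
  exact (lTensor_sliceLeft_onFirstTwo_leftComm H.G₁ ω b (H.T₁ (a ⊗ₜ d))).symm.trans <|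
    (congrArg (lTensor A (sliceLeft ω)) (H.G₁_spec a (b ⊗ₜ d))).trans (T₁_sliceLeft _)

lemma lTensor_legRight_G₂ (b : A) (ω : A →ₗ[ℂ] ℂ) (z : A ⊗[ℂ] A) :
    lTensor A (legRight H.G₂ b ω) (H.T₂ z) = H.T₂ (rTensor A (legLeft H.E.right b ω) z) := by
  refine eq_of_tmul (f := lTensor A (legRight H.G₂ b ω) ∘ₗ H.T₂)
    (g := H.T₂ ∘ₗ rTensor A (legLeft H.E.right b ω)) (fun a c => ?_) z
  have sliceLeft_G₂ (w : A ⊗[ℂ] A) : lTensor A (sliceLeft ω) (lTensor A H.G₂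
      (TensorProduct.assoc ℂ A A A (TensorProduct.rightComm ℂ A A A (w ⊗ₜ b)))) =
        lTensor A (legRight H.G₂ b ω) w :=
    eq_of_tmul (f := lTensor A (sliceLeft ω) ∘ₗ lTensor A H.G₂ ∘ₗ
      (TensorProduct.assoc ℂ A A A).toLinearMap ∘ₗ (TensorProduct.rightComm ℂ A A A).toLinearMap ∘ₗ
      (TensorProduct.mk ℂ (A ⊗[ℂ] A) A).flip b) (g := lTensor A (legRight H.G₂ b ω))
      (fun _ _ => rfl) w
  have T₂_sliceRight (u : A ⊗[ℂ] A) : lTensor A (sliceLeft ω) (TensorProduct.assoc ℂ A A A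
      (TensorProduct.rightComm ℂ A A A (rTensor A H.T₂
        (TensorProduct.rightComm ℂ A A A (u ⊗ₜ c))))) = H.T₂ (sliceRight ω u ⊗ₜ c) := by
    rw [lTensor_sliceLeft_assoc, rTensor_sliceRight_rightComm, sliceRight_rTensor,
      sliceRight_rightComm, LinearMap.rTensor_tmul]
  exact (sliceLeft_G₂ _).symm.trans <|
    (congrArg (lTensor A (sliceLeft ω)) (H.G₂_spec (a ⊗ₜ b) c)).trans (T₂_sliceRight _)

end WeakMultiplierHopfAlgebra

namespace RegularWeakMultiplierHopfAlgebra

variable {A : Type*} [NonUnitalRing A] [Module ℂ A] [IsScalarTower ℂ A A] [SMulCommClass ℂ A A]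
variable (H : RegularWeakMultiplierHopfAlgebra A)

lemma lTensor_mul_T₁ (a b c : A) : lTensor A (LinearMap.mul ℂ A c) (H.T₁ (a ⊗ₜ b)) =
    lTensor A ((LinearMap.mul ℂ A).flip b) (H.T₃ (a ⊗ₜ c)) := H.of_tensor_injective <| by
  rw [of_lTensor_mul, of_lTensor_mul_flip, H.of_T₁, H.of_T₃, mul_assoc]

lemma rTensor_mul_T₄ (a c d : A) : rTensor A (LinearMap.mul ℂ A c) (H.T₄ (d ⊗ₜ a)) =
    rTensor A ((LinearMap.mul ℂ A).flip d) (H.T₂ (c ⊗ₜ a)) := H.of_tensor_injective <| by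
  rw [of_rTensor_mul, of_rTensor_mul_flip, H.of_T₂, H.of_T₄, mul_assoc]

lemma legsCommute_E_right_T₃ : LegsCommute H.E.right H.T₃ := fun c z =>
  eq_of_tmul (f := onFirstTwo A H.E.right ∘ₗ TensorProduct.mk ℂ A _ c ∘ₗ H.T₃)
    (g := lTensor A H.T₃ ∘ₗ onFirstTwo A H.E.right ∘ₗ TensorProduct.mk ℂ A _ c)
    (fun b d => (H.onFirstTwo_E_right_lTensor (X := H.T₃ ∘ₗ (TensorProduct.mk ℂ A A).flip d)
      (fun b => H.of_T₃ b d) (c ⊗ₜ b)).trans (lTensor_onFirstTwo _ _ c b d).symm) z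

lemma T₄_lTensor_legRight_E (c : A) (ω : A →ₗ[ℂ] ℂ) (z : A ⊗[ℂ] A) :
    H.T₄ (lTensor A (legRight H.E.left c ω) z) = rTensor A (legRight H.E.left c ω) (H.T₄ z) := by
  refine eq_of_tmul (f := H.T₄ ∘ₗ lTensor A (legRight H.E.left c ω))
    (g := rTensor A (legRight H.E.left c ω) ∘ₗ H.T₄) (fun d b => ?_) z
  have h := congrArg (sliceLeft ω) (H.onFirstTwo_E_left_lTensor
    (X := H.T₄ ∘ₗ TensorProduct.mk ℂ A A d) (fun b => H.of_T₄ d b) (c ⊗ₜ b))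
  rw [LinearMap.lTensor_tmul, sliceLeft_onFirstTwo, sliceLeft_lTensor] at h
  exact h.symm

section Flipped

/-- The regular weak multiplier Hopf algebra with the opposite coproduct. -/
def flipped : RegularWeakMultiplierHopfAlgebra A where
  toWeakMultiplierHopfAlgebra := H.cop
  T₃ := flipConj H.T₂
  T₄ := flipConj H.T₁
  of_T₃ a b := by
    rw [flipConj_apply, TensorProduct.comm_tmul, of_comm, H.of_T₂, flip_mul, flip_tmul, H.cop_Δ]
  of_T₄ a b := by
    rw [flipConj_apply, TensorProduct.comm_tmul, of_comm, H.of_T₁, flip_mul, flip_tmul, H.cop_Δ]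
  cop := H.toWeakMultiplierHopfAlgebra
  cop_Δ a := by rw [H.cop_Δ, Multiplier.flip_flip]

lemma flipped_Δ (a : A) : H.flipped.Δ a = flip (H.Δ a) := H.cop_Δ a

lemma flipped_T₁ : H.flipped.T₁ = flipConj H.T₄ :=
  TensorProduct.ext' fun a b => H.of_tensor_injective <| by
    rw [H.flipped.of_T₁, flipConj_apply, TensorProduct.comm_tmul, of_comm, H.of_T₄, flip_mul,
      flip_tmul, flipped_Δ]

lemma flipped_T₂ : H.flipped.T₂ = flipConj H.T₃ :=
  TensorProduct.ext' fun a b => H.of_tensor_injective <| by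
    rw [H.flipped.of_T₂, flipConj_apply, TensorProduct.comm_tmul, of_comm, H.of_T₃, flip_mul,
      flip_tmul, flipped_Δ]

lemma flip_flipped_E_mul_Δ (a : A) : flip H.flipped.E * H.Δ a = H.Δ a := by
  have h := congrArg Multiplier.flip (H.flipped.E_mul_Δ a)
  rwa [flip_mul, flipped_Δ, Multiplier.flip_flip] at h

lemma Δ_mul_flip_flipped_E (a : A) : H.Δ a * flip H.flipped.E = H.Δ a := by
  have h := congrArg Multiplier.flip (H.flipped.Δ_mul_E a)
  rwa [flip_mul, flipped_Δ, Multiplier.flip_flip] at h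

lemma flipped_E : H.flipped.E = flip H.E := by
  have E_mul : H.E * flip H.flipped.E = H.E := H.E_mul_eq_of_Δ_mul H.Δ_mul_flip_flipped_E
  have mul_flipped_E : flip H.E * H.flipped.E = H.flipped.E :=
    H.flipped.mul_E_eq_of_mul_Δ H.flipped.flip_flipped_E_mul_Δ
  have flip_mul_flipped_E := congrArg Multiplier.flip E_mul
  rw [flip_mul, Multiplier.flip_flip] at flip_mul_flipped_E
  exact mul_flipped_E.symm.trans flip_mul_flipped_E

lemma sliceLeft_flipped_ε_T₃ (a b : A) : sliceLeft H.flipped.ε (H.T₃ (a ⊗ₜ b)) = b * a := by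
  have h : sliceRight H.flipped.ε (H.flipped.T₂ (b ⊗ₜ a)) = b * a := H.flipped.counit_right b a
  simpa [flipped_T₂] using h

lemma flipped_ε : H.flipped.ε = H.ε := by
  have slice_eq : ∀ z, sliceLeft H.flipped.ε (H.T₁ z) = sliceLeft H.ε (H.T₁ z) := by
    refine eq_of_tmul (f := sliceLeft H.flipped.ε ∘ₗ H.T₁) (g := sliceLeft H.ε ∘ₗ H.T₁)
      fun a b => H.nondegenerate.eq_of_mul_left fun c => ?_
    have h := congrArg (sliceLeft H.flipped.ε) (H.lTensor_mul_T₁ a b c)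
    rw [sliceLeft_lTensor, sliceLeft_lTensor, sliceLeft_flipped_ε_T₃] at h
    calc c * sliceLeft H.flipped.ε (H.T₁ (a ⊗ₜ b))
      _ = c * a * b := h
      _ = c * sliceLeft H.ε (H.T₁ (a ⊗ₜ b)) := by
        rw [mul_assoc]; exact congrArg (c * ·) (H.counit_left a b).symm
  refine LinearMap.eqLocus_eq_top.1 <| H.full_left _ ?_
  rintro _ ⟨z, rfl⟩
  refine mem_range_rTensor_subtype fun ω => ?_
  rw [LinearMap.mem_eqLocus, ← apply_sliceLeft, ← apply_sliceLeft, slice_eq]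

end Flipped

section HopfData

/-- The structure maps of a regular weak multiplier Hopf algebra. The maps `G₃` and `G₄` are those
of the opposite coproduct. -/
@[simps] def toHopfMaps : HopfMaps ℂ A where
  mul := LinearMap.mul ℂ A
  ε := H.ε
  Δₗ a := (H.Δ a).left
  Δᵣ a := (H.Δ a).right
  T₁ := H.T₁
  T₂ := H.T₂
  T₃ := H.T₃
  T₄ := H.T₄
  G₁ := H.G₁
  G₂ := H.G₂
  G₃ := flipConj H.flipped.G₂
  G₄ := flipConj H.flipped.G₁
  Eₗ := H.E.left
  Eᵣ := H.E.right

lemma toHopfMaps_flipped : H.flipped.toHopfMaps = H.toHopfMaps.cop := by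
  have flipped_flipped_G₂ : H.flipped.flipped.G₂ = H.G₂ := rfl
  have flipped_flipped_G₁ : H.flipped.flipped.G₁ = H.G₁ := rfl
  have flipped_T₃ : H.flipped.T₃ = flipConj H.T₂ := rfl
  have flipped_T₄ : H.flipped.T₄ = flipConj H.T₁ := rfl
  simp [toHopfMaps, HopfMaps.cop, *, flipped_ε, flipped_Δ, flipped_T₁, flipped_T₂, flipped_E,
    flip_left, flip_right]

include H in
lemma map₂_mul_top : Submodule.map₂ (LinearMap.mul ℂ A) ⊤ ⊤ = ⊤ := by
  rw [← range_lift_eq_map₂]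
  exact H.idempotent

lemma t₁Axioms : H.toHopfMaps.T₁Axioms where
  mul_assoc := mul_assoc
  eq_zero_of_mul := H.nondegenerate.2
  idempotent := H.map₂_mul_top
  T₁_T₂ := H.rTensor_mul_T₁
  T₁_T₃ := H.lTensor_mul_T₁
  Δₗ_eq_T₁ := H.rTensor_mul_flip_T₁
  Δₗ_T₁ := H.Δ_left_T₁
  Eₗ_Eᵣ := H.E_left_right
  Eₗ_Eₗ := H.E_left_E_left
  range_T₁ := H.range_T₁.symm
  ker_T₁ := H.ker_T₁
  counit_T₁ := H.counit_left
  full_T₁ := H.full_left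
  T₂_comm_T₁ := H.legsCommute_T₂_T₁
  Eₗ_comm_T₁ := H.legsCommute_E_left_T₁
  Eₗ_comm_Eₗ := H.legsCommute_E_left
  T₁_Eₗ d ω z := by
    have flipped_T₄ : H.flipped.T₄ = flipConj H.T₁ := rfl
    simpa [flipped_T₄, flipped_E, flip_left, LinearMap.rTensor_comm, LinearMap.lTensor_comm] using
      congrArg (TensorProduct.comm ℂ A A)
        (H.flipped.T₄_lTensor_legRight_E d ω (TensorProduct.comm ℂ A A z))
  G₁_T₁ := H.rTensor_legLeft_G₁

lemma cop_op_t₁Axioms : H.toHopfMaps.cop.op.T₁Axioms where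
  mul_assoc a b c := (mul_assoc c b a).symm
  eq_zero_of_mul := H.nondegenerate.1
  idempotent := (Submodule.map₂_flip _ _ _).trans H.map₂_mul_top
  T₁_T₂ a b c := by
    simpa [LinearMap.rTensor_comm, LinearMap.lTensor_comm] using
      congrArg (TensorProduct.comm ℂ A A) (H.rTensor_mul_T₁ a c b).symm
  T₁_T₃ a b c := by
    simpa [LinearMap.rTensor_comm, LinearMap.lTensor_comm] using
      congrArg (TensorProduct.comm ℂ A A) (H.rTensor_mul_T₄ a b c).symm
  Δₗ_eq_T₁ a x b := by
    simpa [LinearMap.rTensor_comm, LinearMap.lTensor_comm] using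
      congrArg (TensorProduct.comm ℂ A A) (H.lTensor_mul_T₂ a b x)
  Δₗ_T₁ d z := by
    simpa [LinearMap.rTensor_comm, LinearMap.lTensor_comm] using
      congrArg (TensorProduct.comm ℂ A A) (H.Δ_right_T₂ d (TensorProduct.comm ℂ A A z))
  Eₗ_Eᵣ u v x y := by
    simpa [LinearMap.rTensor_comm, LinearMap.lTensor_comm, rTensor_lTensor_comm] using
      congrArg (TensorProduct.comm ℂ A A) (H.E_left_right y x v u).symm
  Eₗ_Eₗ z := by
    simpa using congrArg (TensorProduct.comm ℂ A A) (H.E_right_E_right (TensorProduct.comm ℂ A A z))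
  range_T₁ := (range_flipConj H.T₂).trans <|
    (congrArg _ H.range_T₂.symm).trans (range_flipConj H.E.right).symm
  ker_T₁ := (ker_flipConj H.T₂).trans <| (congrArg _ H.ker_T₂).trans <| by
    rw [← range_flipConj]
    exact congrArg LinearMap.range (LinearMap.ext fun z => by simp)
  counit_T₁ a b := (sliceLeft_comm ..).trans (H.counit_right b a)
  full_T₁ V h := H.full_right V <| by
    rintro _ ⟨z, rfl⟩
    obtain ⟨w, hw⟩ := h ⟨TensorProduct.comm ℂ A A z, rfl⟩
    refine ⟨TensorProduct.comm ℂ V A w, ?_⟩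
    rw [← LinearMap.lTensor_def, LinearMap.lTensor_comm, hw]
    simp
  T₂_comm_T₁ := H.legsCommute_T₂_T₁.flipConj
  Eₗ_comm_T₁ := by
    have h := H.flipped.legsCommute_E_right_T₃
    rwa [flipped_E, flip_right] at h
  Eₗ_comm_Eₗ := H.legsCommute_E_right.flipConj
  T₁_Eₗ d ω z := by
    simpa [LinearMap.rTensor_comm, LinearMap.lTensor_comm] using
      congrArg (TensorProduct.comm ℂ A A)
        (H.T₂_lTensor_legRight_E d ω (TensorProduct.comm ℂ A A z))
  G₁_T₁ b ω z := by
    simpa [LinearMap.rTensor_comm, LinearMap.lTensor_comm] using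
      congrArg (TensorProduct.comm ℂ A A)
        (H.lTensor_legRight_G₂ b ω (TensorProduct.comm ℂ A A z))

/-- The operators on `A ⊗ A` given by a regular weak multiplier Hopf algebra. -/
def toHopfData : HopfData ℂ A where
  toHopfMaps := H.toHopfMaps
  t₁Axioms := H.t₁Axioms
  op_t₁Axioms := by
    simpa only [toHopfMaps_flipped, HopfMaps.cop_cop] using H.flipped.cop_op_t₁Axioms
  cop_t₁Axioms := H.toHopfMaps_flipped ▸ H.flipped.t₁Axioms
  cop_op_t₁Axioms := H.cop_op_t₁Axioms

@[simp] lemma toHopfData_toHopfMaps : H.toHopfData.toHopfMaps = H.toHopfMaps := rfl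

end HopfData

end RegularWeakMultiplierHopfAlgebra

/-! ### Multipliers of a subalgebra with local units -/

/-- `B` contains a left unit and a right unit for every element of `A`. -/
def HasLocalUnits {A : Type*} [NonUnitalRing A] [Module ℂ A] (B : NonUnitalSubalgebra ℂ A) : Prop :=
  (∀ a : A, ∃ z ∈ B, z * a = a) ∧ ∀ a : A, ∃ z ∈ B, a * z = a

namespace HasLocalUnits

variable {A : Type*} [NonUnitalRing A] [Module ℂ A] {B : NonUnitalSubalgebra ℂ A}

lemma eq_of_mul_left (h : HasLocalUnits B) {a b : A} (hab : ∀ x : B, (x : A) * a = x * b) :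
    a = b := by
  obtain ⟨z, hz, hz_mul⟩ := h.1 (a - b)
  rw [mul_sub, hab ⟨z, hz⟩, sub_self] at hz_mul
  exact sub_eq_zero.1 hz_mul.symm

lemma eq_of_mul_right (h : HasLocalUnits B) {a b : A} (hab : ∀ x : B, a * (x : A) = b * x) :
    a = b := by
  obtain ⟨z, hz, mul_hz⟩ := h.2 (a - b)
  rw [sub_mul, hab ⟨z, hz⟩, sub_self] at mul_hz
  exact sub_eq_zero.1 mul_hz.symm

lemma isNondegenerate (h : HasLocalUnits B) : IsNondegenerate A :=
  ⟨fun a ha => h.eq_of_mul_right fun z => by rw [ha, zero_mul],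
    fun a ha => h.eq_of_mul_left fun z => by rw [ha, mul_zero]⟩

lemma isNondegenerate_subalgebra (h : HasLocalUnits B) : IsNondegenerate B :=
  ⟨fun _ ha => Subtype.ext <| h.eq_of_mul_right fun z =>
      (congrArg Subtype.val (ha z)).trans (zero_mul (z : A)).symm,
    fun _ ha => Subtype.ext <| h.eq_of_mul_left fun z =>
      (congrArg Subtype.val (ha z)).trans (mul_zero (z : A)).symm⟩

variable [IsScalarTower ℂ A A] [SMulCommClass ℂ A A]

lemma isIdempotentAlgebra (h : HasLocalUnits B) : IsIdempotentAlgebra B :=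
  LinearMap.range_eq_top.2 fun x => by
    obtain ⟨z, hz, mul_hz⟩ := h.2 x
    exact ⟨x ⊗ₜ ⟨z, hz⟩, Subtype.ext mul_hz⟩

lemma map₂_mul_left (h : HasLocalUnits B) :
    Submodule.map₂ (LinearMap.mul ℂ A) B.toSubmodule ⊤ = ⊤ :=
  eq_top_iff.2 fun a _ => by
    obtain ⟨z, hz, hz_mul⟩ := h.1 a
    exact hz_mul ▸ Submodule.apply_mem_map₂ (LinearMap.mul ℂ A) hz Submodule.mem_top

lemma map₂_mul_right (h : HasLocalUnits B) :
    Submodule.map₂ (LinearMap.mul ℂ A) ⊤ B.toSubmodule = ⊤ :=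
  eq_top_iff.2 fun a _ => by
    obtain ⟨z, hz, mul_hz⟩ := h.2 a
    exact mul_hz ▸ Submodule.apply_mem_map₂ (LinearMap.mul ℂ A) Submodule.mem_top hz

lemma coe_right_mul (n : Multiplier B) (x y : B) : (n.right x : A) * y = x * (n.left y : A) :=
  congrArg Subtype.val (right_mul_eq n x y)

lemma exists_coe_mul_eq_right_mul (h : HasLocalUnits B) (n : Multiplier B) (a : A) :
    ∃ b, ∀ x : B, (x : A) * b = (n.right x : A) * a := by
  obtain ⟨z, hz, hz_mul⟩ := h.1 a
  exact ⟨n.left ⟨z, hz⟩ * a, fun x => by rw [← mul_assoc, ← coe_right_mul, mul_assoc, hz_mul]⟩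

lemma exists_mul_coe_eq_mul_left (h : HasLocalUnits B) (n : Multiplier B) (a : A) :
    ∃ b, ∀ x : B, b * (x : A) = a * (n.left x : A) := by
  obtain ⟨z, hz, mul_hz⟩ := h.2 a
  exact ⟨a * n.right ⟨z, hz⟩, fun x => by rw [mul_assoc, coe_right_mul, ← mul_assoc, mul_hz]⟩

/-- The left action of a multiplier of `B` on `A`, given by `(n z) a` for a left unit `z ∈ B`
of `a`. -/
def extendLeft (h : HasLocalUnits B) (n : Multiplier B) : A →ₗ[ℂ] A where
  toFun a := (h.exists_coe_mul_eq_right_mul n a).choose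
  map_add' a b := h.eq_of_mul_left fun x => by
    rw [mul_add, (h.exists_coe_mul_eq_right_mul n _).choose_spec,
      (h.exists_coe_mul_eq_right_mul n _).choose_spec,
      (h.exists_coe_mul_eq_right_mul n _).choose_spec, mul_add]
  map_smul' c a := h.eq_of_mul_left fun x => by
    rw [mul_smul_comm, (h.exists_coe_mul_eq_right_mul n _).choose_spec,
      (h.exists_coe_mul_eq_right_mul n _).choose_spec, mul_smul_comm, RingHom.id_apply]

/-- The right action of a multiplier of `B` on `A`, given by `a (z n)` for a right unit `z ∈ B`
of `a`. -/
def extendRight (h : HasLocalUnits B) (n : Multiplier B) : A →ₗ[ℂ] A where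
  toFun a := (h.exists_mul_coe_eq_mul_left n a).choose
  map_add' a b := h.eq_of_mul_right fun x => by
    rw [add_mul, (h.exists_mul_coe_eq_mul_left n _).choose_spec,
      (h.exists_mul_coe_eq_mul_left n _).choose_spec,
      (h.exists_mul_coe_eq_mul_left n _).choose_spec, add_mul]
  map_smul' c a := h.eq_of_mul_right fun x => by
    rw [smul_mul_assoc, (h.exists_mul_coe_eq_mul_left n _).choose_spec,
      (h.exists_mul_coe_eq_mul_left n _).choose_spec, smul_mul_assoc, RingHom.id_apply]

lemma coe_mul_extendLeft (h : HasLocalUnits B) (n : Multiplier B) (x : B) (a : A) :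
    (x : A) * h.extendLeft n a = (n.right x : A) * a :=
  (h.exists_coe_mul_eq_right_mul n a).choose_spec x

lemma extendRight_mul_coe (h : HasLocalUnits B) (n : Multiplier B) (x : B) (a : A) :
    h.extendRight n a * (x : A) = a * (n.left x : A) :=
  (h.exists_mul_coe_eq_mul_left n a).choose_spec x

lemma extendRight_mul (h : HasLocalUnits B) (n : Multiplier B) (a b : A) :
    h.extendRight n a * b = a * h.extendLeft n b := by
  obtain ⟨z, hz, hz_mul⟩ := h.1 b
  have extendLeft_eq : h.extendLeft n b = n.left ⟨z, hz⟩ * b := h.eq_of_mul_left fun x => by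
    rw [coe_mul_extendLeft, ← mul_assoc, ← coe_right_mul, mul_assoc, hz_mul]
  calc h.extendRight n a * b
    _ = h.extendRight n a * z * b := by rw [mul_assoc, hz_mul]
    _ = a * n.left ⟨z, hz⟩ * b := by rw [← h.extendRight_mul_coe n ⟨z, hz⟩]
    _ = a * h.extendLeft n b := by rw [extendLeft_eq, mul_assoc]

/-- The extension of a multiplier of `B` to a multiplier of `A`. -/
def extend (h : HasLocalUnits B) (n : Multiplier B) : Multiplier A :=
  ⟨(h.extendLeft n, MulOpposite.op (h.extendRight n)),
    fun a b => h.eq_of_mul_left fun x => by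
      rw [← mul_assoc, coe_mul_extendLeft, coe_mul_extendLeft, mul_assoc],
    fun a b => h.eq_of_mul_right fun x => by
      rw [MulOpposite.unop_op, mul_assoc, extendRight_mul_coe, extendRight_mul_coe, mul_assoc],
    h.extendRight_mul n⟩

lemma extend_left_coe (h : HasLocalUnits B) (n : Multiplier B) (x : B) :
    (h.extend n).left (x : A) = n.left x :=
  h.eq_of_mul_left fun z => (h.coe_mul_extendLeft n z x).trans (coe_right_mul n z x)

lemma extend_right_coe (h : HasLocalUnits B) (n : Multiplier B) (x : B) :
    (h.extend n).right (x : A) = n.right x :=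
  h.eq_of_mul_right fun z =>
    (h.extendRight_mul_coe n z x).trans (coe_right_mul n x z).symm

lemma of_mul_extend (h : HasLocalUnits B) (n : Multiplier B) (x : B) :
    of (x : A) * h.extend n = of (n.right x : A) := by
  rw [← of_apply_right, extend_right_coe]

lemma ext_of_mul (h : HasLocalUnits B) {m m' : Multiplier A}
    (hm : ∀ x : B, of (x : A) * m = of (x : A) * m') : m = m' :=
  ext_left h.isNondegenerate fun a => h.eq_of_mul_left fun x =>
    congrArg (fun k => Multiplier.left k a) (hm x)

lemma extend_eq_of_mul (h : HasLocalUnits B) {n : Multiplier B} {m : Multiplier A}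
    (hm : ∀ x : B, of (x : A) * m = of (n.right x : A)) : h.extend n = m :=
  h.ext_of_mul fun x => (h.of_mul_extend n x).trans (hm x).symm

/-- The extension of multipliers as a unital homomorphism `M(B) → M(A)`. -/
def extendHom (h : HasLocalUnits B) : Multiplier B →ₐ[ℂ] Multiplier A :=
  AlgHom.ofLinearMap
    { toFun := h.extend
      map_add' := fun n n' => h.extend_eq_of_mul fun x => by
        rw [mul_add, of_mul_extend, of_mul_extend, ← map_add]
        rfl
      map_smul' := fun c n => h.extend_eq_of_mul fun x => by
        rw [RingHom.id_apply, mul_smul_comm, of_mul_extend, ← map_smul]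
        rfl }
    (h.extend_eq_of_mul fun x => mul_one _)
    fun n n' => h.extend_eq_of_mul fun x => by
      change of (x : A) * (h.extend n * h.extend n') = _
      rw [← mul_assoc, of_mul_extend, of_mul_extend]
      rfl

lemma extendHom_apply (h : HasLocalUnits B) (n : Multiplier B) : h.extendHom n = h.extend n := rfl

lemma extendHom_injective (h : HasLocalUnits B) : Function.Injective h.extendHom := fun n n' hn =>
  ext_left h.isNondegenerate_subalgebra fun x => Subtype.ext <| by
    rw [← extend_left_coe h, ← extend_left_coe h, ← extendHom_apply, hn, extendHom_apply]

end HasLocalUnits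

namespace Multiplier

variable {A : Type*} [NonUnitalRing A] [Module ℂ A] [IsScalarTower ℂ A A] [SMulCommClass ℂ A A]

/-- The restriction of a multiplier of `A` to an invariant subalgebra `B`. -/
def restrict (B : NonUnitalSubalgebra ℂ A) (m : Multiplier A) (hl : ∀ x ∈ B, m.left x ∈ B)
    (hr : ∀ x ∈ B, m.right x ∈ B) : Multiplier B :=
  ⟨(m.left.restrict (p := B.toSubmodule) (q := B.toSubmodule) hl,
    MulOpposite.op (m.right.restrict (p := B.toSubmodule) (q := B.toSubmodule) hr)),
    fun a b => Subtype.ext (left_mul m a b), fun a b => Subtype.ext (right_mul m a b),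
    fun a b => Subtype.ext (right_mul_eq m a b)⟩

end Multiplier

lemma HasLocalUnits.range_extendHom {A : Type*} [NonUnitalRing A] [Module ℂ A]
    [IsScalarTower ℂ A A] [SMulCommClass ℂ A A] {B : NonUnitalSubalgebra ℂ A}
    (h : HasLocalUnits B) {Y : Set (Multiplier A)}
    (hB : ∀ a : A, a ∈ B ↔ ∀ y ∈ Y, of a * y = y * of a) :
    h.extendHom.range = Subalgebra.centralizer ℂ Y := by
  ext m
  rw [AlgHom.mem_range, Subalgebra.mem_centralizer_iff]
  constructor
  · rintro ⟨n, rfl⟩ y hy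
    refine h.ext_of_mul fun x => ?_
    calc of (x : A) * (y * h.extend n)
      _ = y * (of (x : A) * h.extend n) := by
        rw [← mul_assoc, (hB x).1 x.2 y hy, mul_assoc]
      _ = of (x : A) * h.extend n * y := by
        rw [of_mul_extend, (hB _).1 (n.right x).2 y hy]
      _ = of (x : A) * (h.extend n * y) := mul_assoc ..
  · intro hm
    have left_mem : ∀ x ∈ B, m.left x ∈ B := fun x hx => (hB _).2 fun y hy => by
      rw [of_apply_left, mul_assoc, (hB x).1 hx y hy, ← mul_assoc, ← hm y hy, mul_assoc]
    have right_mem : ∀ x ∈ B, m.right x ∈ B := fun x hx => (hB _).2 fun y hy => by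
      rw [of_apply_right, mul_assoc, ← hm y hy, ← mul_assoc, (hB x).1 hx y hy, mul_assoc]
    exact ⟨m.restrict B left_mem right_mem, h.extend_eq_of_mul fun x => (of_apply_right m x).symm⟩

/-! ### The adjoint algebra -/

namespace RegularWeakMultiplierHopfAlgebra

variable {A : Type*} [NonUnitalRing A] [Module ℂ A] [IsScalarTower ℂ A A] [SMulCommClass ℂ A A]
variable (H : RegularWeakMultiplierHopfAlgebra A)

section Antipode

lemma isAntipode_S : H.IsAntipode H.toHopfData.S :=
  ⟨H.toHopfData.R₁, H.toHopfData.R₂,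
    ⟨LinearMap.ext H.toHopfData.T₁_R₁, LinearMap.ext H.toHopfData.R₁_T₁,
      LinearMap.ext fun z => (H.toHopfData.R₁_T₁ _).trans (H.toHopfData.G₁_R₁ z)⟩,
    ⟨LinearMap.ext H.toHopfData.T₂_R₂, LinearMap.ext H.toHopfData.R₂_T₂,
      LinearMap.ext fun z => (H.toHopfData.R₂_T₂ _).trans (H.toHopfData.G₂_R₂ z)⟩,
    H.toHopfData.S_mul, fun a b => H.toHopfData.mul_S b a⟩

lemma isAntipode_antipode : H.IsAntipode H.antipode := by
  have exists_isAntipode : ∃ S, H.IsAntipode S := ⟨_, H.isAntipode_S⟩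
  rw [antipode, dif_pos exists_isAntipode]
  exact exists_isAntipode.choose_spec

variable {H} in
lemma IsAntipode.eq_S {S : A →ₗ[ℂ] A} (h : H.IsAntipode S) : S = H.toHopfData.S := by
  obtain ⟨R, -, hR, -, S_mul, -⟩ := h
  have R₁_eq (z : A ⊗[ℂ] A) : H.toHopfData.R₁ z = R z :=
    H.toHopfData.R₁_eq (LinearMap.congr_fun hR.comp_right z) <|
      (LinearMap.congr_fun hR.comp_left (R z)).symm.trans (LinearMap.congr_fun hR.reflexive z)
  refine LinearMap.ext fun a => H.nondegenerate.eq_of_mul_right fun b => ?_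
  rw [S_mul, ← R₁_eq]
  exact (H.toHopfData.S_mul a b).symm

lemma antipode_eq : H.antipode = H.toHopfData.S := H.isAntipode_antipode.eq_S

lemma mulAntipode_eq : H.mulAntipode = H.toHopfData.mulAntipode :=
  TensorProduct.ext' fun p q => by
    rw [HopfData.mulAntipode_tmul, mulAntipode, antipode_eq]
    rfl

lemma adj_eq (a x : A) : H.adj a x = H.toHopfData.adjoint a x := by
  rw [adj, mulAntipode_eq]
  rfl

end Antipode

section SourceMap

/-- The multiplier `ε_s(a)`, with `b ε_s(a) = (ι ⊗ ε)((b ⊗ a)E)`. -/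
def source (a : A) : Multiplier A :=
  ⟨(H.toHopfData.sourceLeft a, MulOpposite.op
      (sliceRight H.ε ∘ₗ H.E.right ∘ₗ (TensorProduct.mk ℂ A A).flip a)),
    fun b c => H.toHopfData.sourceMul_tmul_mul a b c,
    fun b c => (congrArg (sliceRight H.ε) (H.toHopfData.Eᵣ_rTensor_mul b (c ⊗ₜ a))).trans
      (sliceRight_rTensor ..),
    fun b c => (H.toHopfData.mul_sourceMul b a c).symm⟩

/-- The map `ε_s` as a linear map. -/
def sourceHom : A →ₗ[ℂ] Multiplier A where
  toFun := H.source
  map_add' a b := ext_left H.nondegenerate (LinearMap.map_add₂ H.toHopfData.sourceLeft a b)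
  map_smul' k a := ext_left H.nondegenerate (LinearMap.map_smul₂ H.toHopfData.sourceLeft k a)

lemma sourceLeft_eq (a b : A) : H.toHopfData.sourceLeft a b =
    LinearMap.mul' ℂ A (TensorProduct.map H.antipode LinearMap.id (H.T₁ (a ⊗ₜ b))) := by
  have antipodeMul_eq : H.toHopfData.antipodeMul =
      LinearMap.mul' ℂ A ∘ₗ TensorProduct.map H.antipode LinearMap.id :=
    TensorProduct.ext' fun p q => by
      rw [HopfData.antipodeMul_tmul, antipode_eq]
      rfl
  exact (H.toHopfData.antipodeMul_T₁ (a ⊗ₜ b)).symm.trans (LinearMap.congr_fun antipodeMul_eq _)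

lemma isSourceMap_sourceMap : H.IsSourceMap H.sourceMap := by
  have exists_isSourceMap : ∃ f, H.IsSourceMap f := ⟨H.sourceHom, H.sourceLeft_eq⟩
  rw [sourceMap, dif_pos exists_isSourceMap]
  exact exists_isSourceMap.choose_spec

lemma sourceMap_left (a b : A) : (H.sourceMap a).left b = H.toHopfData.sourceLeft a b := by
  rw [H.isSourceMap_sourceMap, sourceLeft_eq]

end SourceMap

section AdjointAlgebra

lemma adjSpace_eq : H.adjSpace = H.toHopfData.A₀ := by
  rw [HopfData.A₀, range_eq_span_tmul, adjSpace, mulAntipode_eq]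
  rfl

lemma adjSpace_eq_span_adj : H.adjSpace = Submodule.span ℂ {z | ∃ a x : A, z = H.adj a x} := by
  rw [adjSpace_eq, ← HopfData.range_mulAntipode_T₄, range_eq_span_tmul]
  congr 1
  ext z
  simp only [Set.mem_ofPred_eq, adj_eq]
  exact exists_comm

lemma of_eq_of_isCover {q a : A} {t : A ⊗[ℂ] A} (ht : H.toHopfData.IsCover q a t) :
    of t = tmul 1 (of q) * H.E * tmul (of a) 1 := by
  have mul_tmul (x d : A) : t * (x ⊗ₜ d) = rTensor A ((LinearMap.mul ℂ A).flip x)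
      (lTensor A ((LinearMap.mul ℂ A).flip d) t) :=
    eq_of_tmul (f := LinearMap.mulRight ℂ (x ⊗ₜ d))
      (g := rTensor A ((LinearMap.mul ℂ A).flip x) ∘ₗ lTensor A ((LinearMap.mul ℂ A).flip d))
      (fun _ _ => Algebra.TensorProduct.tmul_mul_tmul ..) t
  refine ext_left H.nondegenerate_tensor fun z => ?_
  refine eq_of_tmul (f := (of t).left) (g := (tmul 1 (of q) * H.E * tmul (of a) 1).left)
    (fun x d => ?_) z
  calc t * (x ⊗ₜ d)
    _ = rTensor A ((LinearMap.mul ℂ A).flip x)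
        (lTensor A (LinearMap.mul ℂ A q) (H.E.left (a ⊗ₜ d))) := by
      rw [mul_tmul]
      exact congrArg _ (ht d)
    _ = lTensor A (LinearMap.mul ℂ A q)
        (H.E.left (rTensor A ((LinearMap.mul ℂ A).flip x) (a ⊗ₜ d))) := by
      rw [rTensor_lTensor_comm]
      exact congrArg _ (H.toHopfData.Eₗ_rTensor_mul_flip x (a ⊗ₜ d)).symm

lemma isSandwich_sandwich (a : A) : H.IsSandwich a (H.toHopfData.sandwich a) := fun q => by
  obtain ⟨t, ht⟩ := H.toHopfData.exists_isCover q a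
  refine ⟨t, H.of_eq_of_isCover ht, ?_⟩
  rw [antipode_eq, mulAntipode_eq]
  exact ht.sandwich_mul_S

/-- The algebra `A₀`. -/
def adjAlgebra : NonUnitalSubalgebra ℂ A where
  __ := H.toHopfData.A₀
  mul_mem' := H.toHopfData.mul_mem_A₀

lemma hasLocalUnits_adjAlgebra : HasLocalUnits H.adjAlgebra :=
  ⟨H.toHopfData.exists_mem_A₀_mul_eq, H.toHopfData.exists_mem_A₀_eq_mul⟩

lemma mem_adjAlgebra_iff (a : A) :
    a ∈ H.adjAlgebra ↔ ∀ b, of a * H.sourceMap b = H.sourceMap b * of a := by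
  refine H.toHopfData.mem_A₀_iff_commutesWithSource.trans <| forall_congr' fun b =>
    ⟨fun h => ext_left H.nondegenerate fun c => ?_, fun h c => ?_⟩
  · rw [mul_left_apply, mul_left_apply, sourceMap_left, sourceMap_left]
    exact h c
  · have h_left := congrArg (fun m => Multiplier.left m c) h
    simp only [mul_left_apply, sourceMap_left] at h_left
    exact h_left

lemma range_extendHom : H.hasLocalUnits_adjAlgebra.extendHom.range =
    Subalgebra.centralizer ℂ (Set.range H.sourceMap) :=
  H.hasLocalUnits_adjAlgebra.range_extendHom fun a => by
    rw [Set.forall_mem_range]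
    exact H.mem_adjAlgebra_iff a

end AdjointAlgebra

section AdjointAction

/-- The adjoint action of `A` on itself, which takes its values in `A₀`. -/
def adjointToAlgebra : A →ₗ[ℂ] A →ₗ[ℂ] H.adjAlgebra :=
  LinearMap.mk₂ ℂ (fun a x => ⟨H.toHopfData.adjoint a x, H.toHopfData.adjoint_mem_A₀ a x⟩)
    (fun a b x => Subtype.ext (LinearMap.map_add₂ H.toHopfData.adjoint a b x))
    (fun c a x => Subtype.ext (LinearMap.map_smul₂ H.toHopfData.adjoint c a x))
    (fun a x y => Subtype.ext (map_add (H.toHopfData.adjoint a) x y))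
    (fun c a x => Subtype.ext (map_smul (H.toHopfData.adjoint a) c x))

/-- The adjoint action of `A` on `A₀`. -/
def adjAction : A →ₗ[ℂ] H.adjAlgebra →ₗ[ℂ] H.adjAlgebra :=
  H.adjointToAlgebra.domRestrict₂ H.adjAlgebra.toSubmodule

lemma map₂_adjointToAlgebra : Submodule.map₂ H.adjointToAlgebra ⊤ ⊤ = ⊤ := by
  rw [← range_lift_eq_map₂, LinearMap.range_eq_top]
  intro x
  obtain ⟨w, hw⟩ : (x : A) ∈ LinearMap.range (H.toHopfData.mulAntipode ∘ₗ H.toHopfData.T₄) :=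
    H.toHopfData.range_mulAntipode_T₄.ge x.2
  refine ⟨TensorProduct.comm ℂ A A w, Subtype.ext (Eq.trans ?_ hw)⟩
  exact eq_of_tmul (f := H.adjAlgebra.toSubmodule.subtype ∘ₗ
    TensorProduct.lift H.adjointToAlgebra ∘ₗ (TensorProduct.comm ℂ A A).toLinearMap)
    (g := H.toHopfData.mulAntipode ∘ₗ H.toHopfData.T₄) (fun _ _ => rfl) w

lemma map₂_adjAction : Submodule.map₂ H.adjAction ⊤ ⊤ = ⊤ := by
  refine top_unique <| H.map₂_adjointToAlgebra.ge.trans <| Submodule.map₂_le.2 fun a _ x _ => ?_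
  suffices h : ⊤ ≤ (Submodule.map₂ H.adjAction ⊤ ⊤).comap (H.adjointToAlgebra.flip x) from
    h Submodule.mem_top
  refine H.map₂_mul_top.ge.trans <| Submodule.map₂_le.2 fun b _ c _ => ?_
  have adjoint_mul : H.adjointToAlgebra (b * c) x = H.adjAction b (H.adjointToAlgebra c x) :=
    Subtype.ext (H.toHopfData.adjoint_mul b c x)
  exact Submodule.mem_comap.2 <| adjoint_mul ▸
    Submodule.apply_mem_map₂ _ Submodule.mem_top Submodule.mem_top

lemma coe_mul'_tensorAction (x y : H.adjAlgebra) (w : A ⊗[ℂ] A) :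
    (LinearMap.mul' ℂ H.adjAlgebra (tensorAction H.adjAction w (x ⊗ₜ y)) : A) =
      TensorProduct.lift (LinearMap.mul ℂ A) (TensorProduct.map
        (H.toHopfData.adjoint.flip x) (H.toHopfData.adjoint.flip y) w) :=
  eq_of_tmul (f := H.adjAlgebra.toSubmodule.subtype ∘ₗ LinearMap.mul' ℂ H.adjAlgebra ∘ₗ
      (tensorAction H.adjAction).flip (x ⊗ₜ y))
    (g := TensorProduct.lift (LinearMap.mul ℂ A) ∘ₗ TensorProduct.map
      (H.toHopfData.adjoint.flip x) (H.toHopfData.adjoint.flip y))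
    (fun _ _ => rfl) w

lemma adjAction_mul_adjAction (a b c : A) (x y : H.adjAlgebra) :
    H.adjAction a (H.adjAction c x * H.adjAction b y) = LinearMap.mul' ℂ H.adjAlgebra
      (tensorAction H.adjAction ((H.Δ a).left (c ⊗ₜ b)) (x ⊗ₜ y)) := by
  have adjoint_flip_comp :
      H.toHopfData.adjoint.flip (y : A) ∘ₗ (LinearMap.mul ℂ A).flip b =
        H.toHopfData.adjoint.flip (H.toHopfData.adjoint b y) :=
    LinearMap.ext fun q => H.toHopfData.adjoint_mul q b y
  refine Subtype.ext ?_
  rw [coe_mul'_tensorAction]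
  calc H.toHopfData.adjoint a (H.toHopfData.adjoint c x * H.toHopfData.adjoint b y)
    _ = TensorProduct.lift (LinearMap.mul ℂ A) (TensorProduct.map (H.toHopfData.adjoint.flip x)
          (H.toHopfData.adjoint.flip (H.toHopfData.adjoint b y)) (H.toHopfData.T₄ (c ⊗ₜ a))) :=
      (H.toHopfData.lift_mul_map_adjoint_adjoint_T₄ a c x (H.toHopfData.adjoint b y)).symm
    _ = TensorProduct.lift (LinearMap.mul ℂ A) (TensorProduct.map (H.toHopfData.adjoint.flip x)
          (H.toHopfData.adjoint.flip y)
          (lTensor A ((LinearMap.mul ℂ A).flip b) (H.toHopfData.T₄ (c ⊗ₜ a)))) := by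
      rw [LinearMap.map_lTensor, adjoint_flip_comp]
    _ = _ := congrArg _ (congrArg _ (H.toHopfData.Δₗ_eq_T₄ a c b))

lemma isModuleAlgebra_adjAction :
    IsModuleAlgebra H.toWeakMultiplierHopfAlgebra H.adjAction where
  nondegenerate := H.hasLocalUnits_adjAlgebra.isNondegenerate_subalgebra
  idempotent := H.hasLocalUnits_adjAlgebra.isIdempotentAlgebra
  mul_act a b r := Subtype.ext (H.toHopfData.adjoint_mul a b r)
  unital := H.map₂_adjAction
  act_mul := H.adjAction_mul_adjAction

end AdjointAction

end RegularWeakMultiplierHopfAlgebra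

end WMHA

end

theorem mainTheorem11 {A : Type*} [NonUnitalRing A] [Module ℂ A] [IsScalarTower ℂ A A]
    [SMulCommClass ℂ A A] (H : WMHA.RegularWeakMultiplierHopfAlgebra A) :
    -- the antipode and the source map are well defined
    H.IsAntipode H.antipode ∧ H.IsSourceMap H.sourceMap ∧
    -- `A₀` is the span of the elements `E₁ a S(E₂)`, and of the elements `α_a(x)`
    (∃ π : A →ₗ[ℂ] A, (∀ a, H.IsSandwich a (π a)) ∧ H.adjSpace = LinearMap.range π) ∧
    H.adjSpace = Submodule.span ℂ {z | ∃ a x : A, z = H.adj a x} ∧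
    -- `A₀` is a non-degenerate subalgebra with `A₀A = AA₀ = A`
    ∃ A₀ : NonUnitalSubalgebra ℂ A, A₀.toSubmodule = H.adjSpace ∧
      WMHA.IsNondegenerate A₀ ∧
      Submodule.map₂ (LinearMap.mul ℂ A) A₀.toSubmodule ⊤ = ⊤ ∧
      Submodule.map₂ (LinearMap.mul ℂ A) ⊤ A₀.toSubmodule = ⊤ ∧
      -- `A₀` is the commutant of `ε_s(A)` in `A`
      (∀ a : A, a ∈ A₀ ↔ ∀ b : A, WMHA.Multiplier.of a * H.sourceMap b =
        H.sourceMap b * WMHA.Multiplier.of a) ∧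
      -- `M(A₀)` embeds in `M(A)`, compatibly with the actions on `A₀`, and its image is the
      -- commutant of `ε_s(A)` in `M(A)`
      (∃ j : WMHA.Multiplier A₀ →ₐ[ℂ] WMHA.Multiplier A, Function.Injective j ∧
        (∀ (n : WMHA.Multiplier A₀) (x : A₀),
          (j n).left (x : A) = (n.left x : A) ∧ (j n).right (x : A) = (n.right x : A)) ∧
        j.range = Subalgebra.centralizer ℂ (Set.range H.sourceMap)) ∧
      -- `A₀` is an `A`-module algebra under the adjoint action
      (∃ act : A →ₗ[ℂ] A₀ →ₗ[ℂ] A₀, (∀ (a : A) (x : A₀), (act a x : A) = H.adj a x) ∧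
        WMHA.IsModuleAlgebra H.toWeakMultiplierHopfAlgebra act) := by
  have hu := H.hasLocalUnits_adjAlgebra
  exact ⟨H.isAntipode_antipode, H.isSourceMap_sourceMap,
    ⟨H.toHopfData.sandwich, H.isSandwich_sandwich,
      H.adjSpace_eq.trans H.toHopfData.range_sandwich.symm⟩,
    H.adjSpace_eq_span_adj,
    H.adjAlgebra, H.adjSpace_eq.symm, hu.isNondegenerate_subalgebra,
    hu.map₂_mul_left, hu.map₂_mul_right,
    H.mem_adjAlgebra_iff,
    ⟨hu.extendHom, hu.extendHom_injective,
      fun n x => ⟨hu.extend_left_coe n x, hu.extend_right_coe n x⟩, H.range_extendHom⟩,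
    ⟨H.adjAction, fun a x => (H.adj_eq a x).symm, H.isModuleAlgebra_adjAction⟩⟩
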